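/- Let $n\ge 3$ and let $\ell=(\ell_1,\dots,\ell_n)$ be positive real numbers with $\ell_j<\tfrac12(\ell_1+\dots+\ell_n)$ for all $j$. Identify $\mathfrak{su}(2)^*$ with oriented Euclidean space $\mathbb R^3$ by means of the invariant scalar product $\langle\xi,\eta\rangle=-\tfrac12\operatorname{tr}(\xi\eta)$ (so that $[\xi,\eta]=2\,\xi\times\eta$). The coadjoint orbit of radius $r$ is the sphere $S^2_r$ with symplectic form $(u,v)\mapsto -\frac{1}{2r^2}\,x\cdot(u\times v)$ at $x$, of total volume $2\pi r$. Let $$\mathcal M_\ell=\{(x_1,\dots,x_n)\in S^2_{\ell_1}\times\dots\times S^2_{\ell_n}\;:\;x_1+\dots+x_n=0\}/SU(2),$$ where $SU(2)$ acts by simultaneous rotations, and let $S_\ell\subset\mathcal M_\ell$ be the set of classes of tuples all of whose vectors lie on one line. Then $\mathcal M_\ell\setminus S_\ell$ is a symplectic manifold of dimension $2(n-3)$, with the smooth structure and symplectic form $\omega$ for which the projection from the manifold of non-collinear closed tuples is a smooth submersion along which $\omega$ pulls back to the restriction of the product symplectic form. Moreover: (1) The subset $\mathcal P_\ell\subset\mathcal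 M_\ell\setminus S_\ell$ of classes of $n$-tuples of coplanar vectors is a closed Lagrangian submanifold (of dimension $n-3$). (2) Consider any triangulation of the $n$-gon by $n-3$ pairwise non-crossing diagonals, the sides of the $n$-gon being numbered $1,\dots,n$ in cyclic order, and let $E_{\rm int}$ be its set of diagonals. A class $[x_1,\dots,x_n]$ is regarded as a closed polygon in $\mathbb R^3$ with vertices $0,x_1,x_1+x_2,\dots,x_1+\dots+x_{n-1}$, up to rotation, with the induced triangulation. For $a\in E_{\rm int}$ let $\lambda_a$ be the length of the diagonal $a$, i.e. $\lambda_a=|\sum_{i\in I(a)}x_i|$, where $I(a)$ is the set of sides of the $n$-gon on one side of $a$. Let $\mathcal M^{\rm reg}$ be the set of classes whose lengths $(\lambda_a)_{a}$ lie in the interior of the polyhedron of those $(d_a)\in\mathbb R_{\ge 0}^{E_{\rm int}}$ that, together with the side lengths $\ell_i$, satisfy the triangle inequalities in each triangle of the triangulation. On $\mathcal M^{\rm reg}$ let $\theta_a\in\mathbb R/2\pi\mathbb Z$ be the oriented dihedral angle between the two faces adjacent to $a$; it is $0$ or $\pi$ when these faces are coplanar, and it increases by $t$ when the vectors $x_i$,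 $i\in I(a)$, are rotated by the angle $t$ around the axis $\sum_{i\in I(a)}x_i$. Then the family $(\tfrac12\lambda_a,\theta_a)_{a\in E_{\rm int}}$ is an action-angle coordinate system on $\mathcal M^{\rm reg}$: near each point of $\mathcal M^{\rm reg}$ it is a smooth local coordinate system (with $\theta_a$ replaced by a local real-valued branch), and $$\omega=\sum_{a\in E_{\rm int}}d(\tfrac12\lambda_a)\wedge d\theta_a\qquad\text{on }\mathcal M^{\rm reg}.$$ -/

import Mathlib

open scoped Manifold ContDiff Topology

noncomputable section

namespace PolygonSpaces

/-! ### Symplectic forms and Lagrangian submanifolds -/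

section Symplectic

variable {d : ℕ} {M : Type*} [TopologicalSpace M] [ChartedSpace (EuclideanSpace ℝ (Fin d)) M]

/-- A field of alternating bilinear forms on the tangent spaces of a `d`-dimensional manifold. -/
abbrev TwoForm (d : ℕ) (M : Type*) [TopologicalSpace M]
    [ChartedSpace (EuclideanSpace ℝ (Fin d)) M] :=
  (p : M) → TangentSpace 𝓘(ℝ, EuclideanSpace ℝ (Fin d)) p [⋀^Fin 2]→L[ℝ] ℝ

/-- The expression of a 2-form in the preferred chart at `p`: its pullback by the inverse chart. -/
def chartForm (σ : TwoForm d M) (p : M) (y : EuclideanSpace ℝ (Fin d)) :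
    EuclideanSpace ℝ (Fin d) [⋀^Fin 2]→L[ℝ] ℝ :=
  (σ ((chartAt (EuclideanSpace ℝ (Fin d)) p).symm y)).compContinuousLinearMap
    (mfderiv 𝓘(ℝ, EuclideanSpace ℝ (Fin d)) 𝓘(ℝ, EuclideanSpace ℝ (Fin d))
      (chartAt (EuclideanSpace ℝ (Fin d)) p).symm y)

/-- A symplectic form: a smooth, closed, nondegenerate 2-form. -/
structure IsSymplecticForm (σ : TwoForm d M) : Prop where
  smooth : ∀ p : M, ContDiffOn ℝ ∞ (chartForm σ p) (chartAt (EuclideanSpace ℝ (Fin d)) p).target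
  closed : ∀ p : M, ∀ y ∈ (chartAt (EuclideanSpace ℝ (Fin d)) p).target,
    extDeriv (chartForm σ p) y = 0
  nondegenerate : ∀ (p : M) (u : TangentSpace 𝓘(ℝ, EuclideanSpace ℝ (Fin d)) p),
    (∀ v : TangentSpace 𝓘(ℝ, EuclideanSpace ℝ (Fin d)) p, σ p ![u, v] = 0) → u = 0

/-- `N` is a Lagrangian submanifold of the `2k`-dimensional manifold `M`: near each of its points
there is a smooth chart in which `N` is the `k`-dimensional coordinate subspace where the last `k`
coordinates vanish, and the 2-form vanishes on the tangent space of `N`. -/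
def IsLagrangianSubmanifold {k : ℕ} {M : Type*} [TopologicalSpace M]
    [ChartedSpace (EuclideanSpace ℝ (Fin (2 * k))) M] (σ : TwoForm (2 * k) M) (N : Set M) : Prop :=
  ∀ p ∈ N, ∃ φ ∈ IsManifold.maximalAtlas 𝓘(ℝ, EuclideanSpace ℝ (Fin (2 * k))) ∞ M,
    p ∈ φ.source ∧
    (∀ q ∈ φ.source, q ∈ N ↔ ∀ i : Fin (2 * k), k ≤ (i : ℕ) → φ q i = 0) ∧
    ∀ u v : TangentSpace 𝓘(ℝ, EuclideanSpace ℝ (Fin (2 * k))) p,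
      (∀ i : Fin (2 * k), k ≤ (i : ℕ) →
        mvfderiv 𝓘(ℝ, EuclideanSpace ℝ (Fin (2 * k))) φ p u i = 0) →
      (∀ i : Fin (2 * k), k ≤ (i : ℕ) →
        mvfderiv 𝓘(ℝ, EuclideanSpace ℝ (Fin (2 * k))) φ p v i = 0) →
      σ p ![u, v] = 0

end Symplectic

/-! ### The polygon space

The space `su(2)^*` is identified with Euclidean 3-space in such a way that `|ξ|² = - tr(ξ²)/2` and
`[ξ, η] = 2 ξ × η`; the coadjoint action of `SU(2)` then has the same orbits on tuples of vectors as
the rotation group. -/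

/-- Euclidean 3-space. -/
abbrev Vec := EuclideanSpace ℝ (Fin 3)

/-- The triple product `u · (v × w)`, i.e. the determinant. -/
def triple (u v w : Vec) : ℝ := (EuclideanSpace.basisFun (Fin 3) ℝ).toBasis.det ![u, v, w]

/-- Rotations of 3-space. -/
def IsRotation (g : Vec ≃ₗᵢ[ℝ] Vec) : Prop := LinearMap.det (g.toLinearEquiv : Vec →ₗ[ℝ] Vec) = 1

theorem triple_rotation {g : Vec ≃ₗᵢ[ℝ] Vec} (hg : IsRotation g) (u v w : Vec) :
    triple (g u) (g v) (g w) = triple u v w := by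
  have h := (EuclideanSpace.basisFun (Fin 3) ℝ).toBasis.det_comp
    (g.toLinearEquiv : Vec →ₗ[ℝ] Vec) ![u, v, w]
  rw [show LinearMap.det (g.toLinearEquiv : Vec →ₗ[ℝ] Vec) = 1 from hg, one_mul] at h
  rw [triple, triple, ← h]
  congr 1
  funext i
  fin_cases i <;> rfl

variable {n : ℕ}

/-- The `n`-tuples of vectors with prescribed lengths and zero sum. -/
def closedPolygons (ℓ : Fin n → ℝ) : Set (Fin n → Vec) :=
  {x | (∀ i, ‖x i‖ = ℓ i) ∧ ∑ i, x i = 0}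

/-- Two closed polygons are equivalent when they differ by a rotation. -/
def rotationSetoid (ℓ : Fin n → ℝ) : Setoid (closedPolygons ℓ) where
  r x y := ∃ g : Vec ≃ₗᵢ[ℝ] Vec, IsRotation g ∧ ∀ i, y.1 i = g (x.1 i)
  iseqv :=
    { refl := fun x => ⟨LinearIsometryEquiv.refl ℝ Vec, by
        change LinearMap.det (LinearMap.id : Vec →ₗ[ℝ] Vec) = 1
        exact LinearMap.det_id, fun i => rfl⟩
      symm := by
        rintro x y ⟨g, hg, h⟩
        refine ⟨g.symm, ?_, fun i => by rw [h i, LinearIsometryEquiv.symm_apply_apply]⟩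
        have h1 := LinearEquiv.det_mul_det_symm g.toLinearEquiv
        rw [show LinearMap.det (g.toLinearEquiv : Vec →ₗ[ℝ] Vec) = 1 from hg, one_mul] at h1
        exact h1
      trans := by
        rintro x y z ⟨g, hg, h⟩ ⟨k, hk, h'⟩
        refine ⟨g.trans k, ?_, fun i => by rw [h' i, h i, LinearIsometryEquiv.trans_apply]⟩
        change LinearMap.det ((k.toLinearEquiv : Vec →ₗ[ℝ] Vec) ∘ₗ
          (g.toLinearEquiv : Vec →ₗ[ℝ] Vec)) = 1
        rw [LinearMap.det_comp, show LinearMap.det (g.toLinearEquiv : Vec →ₗ[ℝ] Vec) = 1 from hg,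
          show LinearMap.det (k.toLinearEquiv : Vec →ₗ[ℝ] Vec) = 1 from hk, one_mul] }

/-- The polygon space, with its quotient topology. -/
abbrev PolygonSpace (ℓ : Fin n → ℝ) := Quotient (rotationSetoid ℓ)

/-- The class of a closed polygon. -/
def polygonClass {ℓ : Fin n → ℝ} (x : closedPolygons ℓ) : PolygonSpace ℓ :=
  Quotient.mk (rotationSetoid ℓ) x

/-- The singular set: classes of tuples all of whose vectors lie on one line. -/
def singularSet (ℓ : Fin n → ℝ) : Set (PolygonSpace ℓ) :=
  {p | ∃ x : closedPolygons ℓ, polygonClass x = p ∧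
    ∃ w : Vec, ∀ i, ∃ c : ℝ, x.1 i = c • w}

/-- The smooth part of the polygon space. -/
abbrev SmoothPart (ℓ : Fin n → ℝ) := {p : PolygonSpace ℓ // p ∉ singularSet ℓ}

/-- The classes, in the smooth part, of tuples of coplanar vectors. -/
def planarSet (ℓ : Fin n → ℝ) : Set (SmoothPart ℓ) :=
  {p | ∃ x : closedPolygons ℓ, polygonClass x = p.1 ∧
    ∃ w : Vec, w ≠ 0 ∧ ∀ i, inner ℝ w (x.1 i) = 0}

/-- Tangent vectors at `x` to the space of closed polygons. -/
def IsTangent (x u : Fin n → Vec) : Prop :=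
  (∀ i, inner ℝ (x i) (u i) = 0) ∧ ∑ i, u i = 0

/-- The symplectic form of the product of the coadjoint orbits `S²_{ℓ i}`. The orbit of radius `r`
carries the form `- x · (u × v) / (2 r²)`: its total volume is `2 π r`, and its inclusion in
`su(2)^*` is a momentum map, in the convention `dμ^ξ + σ(ξ^#, ·) = 0`. -/
def orbitForm (ℓ : Fin n → ℝ) (x u v : Fin n → Vec) : ℝ :=
  ∑ i, -(triple (x i) (u i) (v i) / (2 * ℓ i ^ 2))

/-- The charted space structure on the smooth part and the 2-form `σ` are those of the symplectic
quotient: the projection from the manifold of non-collinear closed polygons is a smooth submersion,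
along which `σ` pulls back to the restriction of the product symplectic form. The projection is
smooth on this submanifold of `(ℝ³)ⁿ` in the sense that it extends smoothly to a neighbourhood of
each point. At most one smooth structure and one 2-form have these properties. -/
def IsSymplecticQuotient (ℓ : Fin n → ℝ)
    [ChartedSpace (EuclideanSpace ℝ (Fin (2 * (n - 3)))) (SmoothPart ℓ)]
    (σ : TwoForm (2 * (n - 3)) (SmoothPart ℓ)) : Prop :=
  ∀ x : closedPolygons ℓ, polygonClass x ∉ singularSet ℓ →
    ∃ U : Set (Fin n → Vec), IsOpen U ∧ x.1 ∈ U ∧ ∃ F : (Fin n → Vec) → SmoothPart ℓ,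
      ContMDiffOn 𝓘(ℝ, Fin n → Vec) 𝓘(ℝ, EuclideanSpace ℝ (Fin (2 * (n - 3)))) ∞ F U ∧
      (∀ y : closedPolygons ℓ, y.1 ∈ U → (F y.1 : PolygonSpace ℓ) = polygonClass y) ∧
      (∀ w : TangentSpace 𝓘(ℝ, EuclideanSpace ℝ (Fin (2 * (n - 3)))) (F x.1),
        ∃ u : Fin n → Vec, IsTangent x.1 u ∧
          mfderiv 𝓘(ℝ, Fin n → Vec) 𝓘(ℝ, EuclideanSpace ℝ (Fin (2 * (n - 3)))) F x.1 u = w) ∧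
      ∀ u v : Fin n → Vec, IsTangent x.1 u → IsTangent x.1 v →
        σ (F x.1)
          ![mfderiv 𝓘(ℝ, Fin n → Vec) 𝓘(ℝ, EuclideanSpace ℝ (Fin (2 * (n - 3)))) F x.1 u,
            mfderiv 𝓘(ℝ, Fin n → Vec) 𝓘(ℝ, EuclideanSpace ℝ (Fin (2 * (n - 3)))) F x.1 v] =
          orbitForm ℓ x.1 u v

/-! ### Triangulations, actions and angles -/

/-- A triangulation of the `n`-gon with vertices `0, …, n - 1` in cyclic order: `n - 3` diagonals
`(i, j)`, `i < j`, no two of which cross. The sides are the pairs `(i, i + 1)` and `(0, n - 1)`. -/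
structure Triangulation (n : ℕ) where
  diagonals : Finset (Fin n × Fin n)
  isDiagonal : ∀ a ∈ diagonals,
    (a.1 : ℕ) + 1 < a.2 ∧ ¬ ((a.1 : ℕ) = 0 ∧ (a.2 : ℕ) + 1 = n)
  noncrossing : ∀ a ∈ diagonals, ∀ b ∈ diagonals, ¬ (a.1 < b.1 ∧ b.1 < a.2 ∧ a.2 < b.2)
  card_diagonals : diagonals.card + 3 = n

namespace Triangulation

variable (T : Triangulation n)

/-- The internal edges of the graph of the triangulation. -/
abbrev Internal := {a : Fin n × Fin n // a ∈ T.diagonals}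

/-- `(i, j)`, with `i < j`, is a side or a diagonal of the triangulation. -/
def IsEdge (i j : Fin n) : Prop :=
  (j : ℕ) = i + 1 ∨ ((i : ℕ) = 0 ∧ (j : ℕ) + 1 = n) ∨ (i, j) ∈ T.diagonals

/-- `i < j < k` are the vertices of a triangle of the triangulation. -/
def IsFace (i j k : Fin n) : Prop :=
  i < j ∧ j < k ∧ T.IsEdge i j ∧ T.IsEdge j k ∧ T.IsEdge i k

/-- The length of the edge `(i, j)`, `i < j`, where the diagonals have lengths `d` and the side
which starts at vertex `m` has length `ℓ m`. -/
def edgeLength (ℓ : Fin n → ℝ) (d : T.Internal → ℝ) (i j : Fin n) : ℝ :=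
  if h : (i, j) ∈ T.diagonals then d ⟨(i, j), h⟩ else if (j : ℕ) = i + 1 then ℓ i else ℓ j

/-- The polyhedron of the diagonal lengths that satisfy the triangle inequalities in each face. -/
def polyhedron (ℓ : Fin n → ℝ) : Set (T.Internal → ℝ) :=
  {d | (∀ a, 0 ≤ d a) ∧ ∀ i j k, T.IsFace i j k →
    |T.edgeLength ℓ d i j - T.edgeLength ℓ d j k| ≤ T.edgeLength ℓ d i k ∧
    T.edgeLength ℓ d i k ≤ T.edgeLength ℓ d i j + T.edgeLength ℓ d j k}

/-- The third vertex of the face adjacent to the diagonal `a = (i, j)` on the side of the vertices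
between `i` and `j`. -/
def innerApex (a : T.Internal) : Fin n :=
  @Classical.epsilon (Fin n) ⟨a.1.1⟩ fun k => T.IsFace a.1.1 k a.1.2

/-- The third vertex of the other face adjacent to the diagonal `a`. -/
def outerApex (a : T.Internal) : Fin n :=
  @Classical.epsilon (Fin n) ⟨a.1.1⟩ fun k => T.IsFace k a.1.1 a.1.2 ∨ T.IsFace a.1.1 a.1.2 k

end Triangulation

/-- The vertices `0, x₀, x₀ + x₁, …` of the polygon with sides `x₀, …, x_{n-1}`. -/
def vertex (x : Fin n → Vec) (k : Fin n) : Vec := ∑ i ∈ Finset.Iio k, x i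

/-- The component of `p` orthogonal to `e`. -/
def orthComponent (e p : Vec) : Vec := p - (inner ℝ e p / ‖e‖ ^ 2) • e

/-- The oriented angle, around the axis directed by `e`, from the half-plane bounded by `ℝ e`
through `q` to the half-plane bounded by `ℝ e` through `p`. -/
def dihedral (e q p : Vec) : Real.Angle :=
  (Complex.arg ⟨inner ℝ (orthComponent e q) (orthComponent e p), triple (‖e‖⁻¹ • e) q p⟩ :
    Real.Angle)

theorem vertex_rotation (g : Vec ≃ₗᵢ[ℝ] Vec) {x y : Fin n → Vec} (h : ∀ i, y i = g (x i))
    (k : Fin n) : vertex y k = g (vertex x k) := by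
  simp [vertex, h, map_sum]

theorem dihedral_rotation {g : Vec ≃ₗᵢ[ℝ] Vec} (hg : IsRotation g) (e q p : Vec) :
    dihedral (g e) (g q) (g p) = dihedral e q p := by
  have h1 : ∀ r, orthComponent (g e) (g r) = g (orthComponent e r) := fun r => by
    simp [orthComponent]
  rw [dihedral, dihedral, h1, h1, LinearIsometryEquiv.inner_map_map,
    LinearIsometryEquiv.norm_map, ← map_smul g, triple_rotation hg]

namespace Triangulation

variable (T : Triangulation n) {ℓ : Fin n → ℝ}

/-- The length of the diagonal `a = (i, j)` of a polygon, that is `|x_i + ⋯ + x_{j-1}|`. -/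
def length (a : T.Internal) : PolygonSpace ℓ → ℝ :=
  Quotient.lift (fun x : closedPolygons ℓ => ‖vertex x.1 a.1.2 - vertex x.1 a.1.1‖) (by
    rintro x y ⟨g, -, h⟩
    simp only [vertex_rotation g h, ← map_sub, LinearIsometryEquiv.norm_map])

/-- The dihedral angle between the two faces adjacent to the diagonal `a = (i, j)`, oriented so that
it increases by `t` when `x_i, …, x_{j-1}` are rotated by `t` around `x_i + ⋯ + x_{j-1}`. It is
`0` or `π` when the two faces are coplanar. -/
def angle (a : T.Internal) : PolygonSpace ℓ → Real.Angle :=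
  Quotient.lift (fun x : closedPolygons ℓ =>
    dihedral (vertex x.1 a.1.2 - vertex x.1 a.1.1)
      (vertex x.1 (T.outerApex a) - vertex x.1 a.1.1)
      (vertex x.1 (T.innerApex a) - vertex x.1 a.1.1)) (by
    rintro x y ⟨g, hg, h⟩
    simp only [vertex_rotation g h, ← map_sub, dihedral_rotation hg])

/-- The regular set: the polygons whose diagonal lengths are interior to the polyhedron. -/
def regularSet (ℓ : Fin n → ℝ) : Set (SmoothPart ℓ) :=
  {p | (fun a => T.length a p.1) ∈ interior (T.polyhedron ℓ)}

end Triangulation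

end PolygonSpaces

end

/-! All computations are made on tuples of vectors and carried to the quotient by local slices. A
non-collinear closed polygon has two independent vectors, and the oriented orthonormal frame built
from them rotates it into standard position. There the length and closing constraints, three gauge
conditions and 2(n-3) linear coordinates together form a local diffeomorphism (`exists_slice`).
Slices give the charts. A transition map is the projection of one slice after the section of
another, hence smooth.

The symplectic form is the pullback of the product form by the sections. On tangent vectors to the
closed polygons, the kernel of the product form is exactly the space of infinitesimal rotations
(`orbitForm_rotationVector`, `mem_range_rotationVector_of_orbitForm_eq_zero`). Hence the pullback
does not depend on the slice and is nondegenerate. It is closed because three vectors tangent to a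
sphere at one point are linearly dependent. For polygons in standard position, planarity means that
all third coordinates vanish. Of these, n-3 can be taken as slice coordinates, and the form vanishes
on planar velocities because every triple product in it does.

For the action-angle formula, let a triangular face move in space and let ω be the angular velocity
of a frame attached to its plane. The 1-form ω·e is linear in the edge e, so the 2-form -d(ω·e) is
additive over the edges of the face (`edgeForm_add`). It equals det(e, de, de)/|e|² plus the wedge
of the spin ω·e/|e|² with e·de. At a side of the polygon e·de = 0, which leaves the form of the
sphere up to the factor -1/2. At a diagonal the determinants seen from its two faces cancel, and the
difference of the two spins is the rate of the dihedral angle divided by |e|. Summation over the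
faces (`Full.sum_faces`) yields ω as the sum of d(λ/2) ∧ dθ (`orbitForm_eq_sum_diagonals`).

This formula also gives the coordinates: a vector killed by all dλ and dθ lies in the kernel of the
symplectic form, so it is zero. As there are 2(n-3) functions, the inverse function theorem applies.
-/

open scoped Manifold ContDiff Topology

noncomputable section

namespace PolygonSpaces

section

/-! ### The cross product -/

/-- The cross product of two vectors. -/
def cross (u v : Vec) : Vec :=
  !₂[u 1 * v 2 - u 2 * v 1, u 2 * v 0 - u 0 * v 2, u 0 * v 1 - u 1 * v 0]

@[simp] theorem cross_apply_zero (u v : Vec) : cross u v 0 = u 1 * v 2 - u 2 * v 1 := rfl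
@[simp] theorem cross_apply_one (u v : Vec) : cross u v 1 = u 2 * v 0 - u 0 * v 2 := rfl
@[simp] theorem cross_apply_two (u v : Vec) : cross u v 2 = u 0 * v 1 - u 1 * v 0 := rfl

theorem inner_coord (u v : Vec) : inner ℝ u v = u 0 * v 0 + u 1 * v 1 + u 2 * v 2 := by
  simp [PiLp.inner_apply, Fin.sum_univ_three]; ring

theorem triple_coord (u v w : Vec) : triple u v w =
    u 0 * (v 1 * w 2 - v 2 * w 1) + u 1 * (v 2 * w 0 - v 0 * w 2)
      + u 2 * (v 0 * w 1 - v 1 * w 0) := by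
  simp [triple, Module.Basis.det_apply, Matrix.det_fin_three, Module.Basis.toMatrix_apply]
  ring

theorem vec_ext {u v : Vec} (h0 : u 0 = v 0) (h1 : u 1 = v 1) (h2 : u 2 = v 2) : u = v := by
  ext i; fin_cases i <;> assumption

theorem triple_eq_inner_cross (u v w : Vec) : triple u v w = inner ℝ u (cross v w) := by
  rw [triple_coord, inner_coord]; simp

theorem cross_add (u v w : Vec) : cross u (v + w) = cross u v + cross u w := by
  apply vec_ext <;> simp <;> ring

theorem add_cross (u v w : Vec) : cross (u + v) w = cross u w + cross v w := by
  apply vec_ext <;> simp <;> ring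

theorem cross_smul (c : ℝ) (u v : Vec) : cross u (c • v) = c • cross u v := by
  apply vec_ext <;> simp <;> ring

theorem smul_cross (c : ℝ) (u v : Vec) : cross (c • u) v = c • cross u v := by
  apply vec_ext <;> simp <;> ring

@[simp] theorem cross_self (u : Vec) : cross u u = 0 := by
  apply vec_ext <;> simp <;> ring

theorem cross_swap (u v : Vec) : cross u v = -cross v u := by
  apply vec_ext <;> simp <;> ring

theorem cross_sum {ι : Type*} (s : Finset ι) (u : Vec) (v : ι → Vec) :
    cross u (∑ i ∈ s, v i) = ∑ i ∈ s, cross u (v i) := by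
  classical
  induction s using Finset.induction_on with
  | empty => simpa using cross_smul 0 u 0
  | insert a s ha ih => rw [Finset.sum_insert ha, Finset.sum_insert ha, cross_add, ih]

@[simp] theorem inner_cross_self_left (u v : Vec) : inner ℝ u (cross u v) = 0 := by
  rw [inner_coord]; simp; ring

@[simp] theorem inner_cross_self_right (u v : Vec) : inner ℝ v (cross u v) = 0 := by
  rw [inner_coord]; simp; ring

theorem inner_cross_cross (u v w z : Vec) : inner ℝ (cross u v) (cross w z) =
    inner ℝ u w * inner ℝ v z - inner ℝ u z * inner ℝ v w := by
  simp only [inner_coord, cross_apply_zero, cross_apply_one, cross_apply_two]; ring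

theorem cross_cross (u v w : Vec) :
    cross u (cross v w) = inner ℝ u w • v - inner ℝ u v • w := by
  apply vec_ext <;> simp [inner_coord] <;> ring

theorem cross_ne_zero_left {u v : Vec} (h : cross u v ≠ 0) : u ≠ 0 := by
  rintro rfl; exact h (by simpa using smul_cross 0 0 v)

theorem cross_ne_zero_right {u v : Vec} (h : cross u v ≠ 0) : v ≠ 0 := by
  rintro rfl; exact h (by simpa using cross_smul 0 u 0)

theorem inner_self_pos {u : Vec} (h : u ≠ 0) : 0 < inner ℝ u u :=
  real_inner_self_pos.2 h

/-- Two vectors with vanishing cross product are proportional. -/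
theorem exists_smul_of_cross_eq_zero {u v : Vec} (hu : u ≠ 0) (h : cross u v = 0) :
    v = (inner ℝ u v / inner ℝ u u) • u := by
  have h1 := cross_cross u u v
  rw [h, show cross u 0 = 0 by simpa using cross_smul 0 u 0] at h1
  rw [div_eq_inv_mul, mul_smul, sub_eq_zero.1 h1.symm, smul_smul,
    inv_mul_cancel₀ (inner_self_pos hu).ne', one_smul]

@[fun_prop] theorem ContDiff.cross {E : Type*} [NormedAddCommGroup E] [NormedSpace ℝ E]
    {m : WithTop ℕ∞} {f g : E → Vec} (hf : ContDiff ℝ m f) (hg : ContDiff ℝ m g) :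
    ContDiff ℝ m fun x => cross (f x) (g x) := by
  rw [contDiff_euclidean]
  intro i
  fin_cases i
  · change ContDiff ℝ m fun x => f x 1 * g x 2 - f x 2 * g x 1
    fun_prop
  · change ContDiff ℝ m fun x => f x 2 * g x 0 - f x 0 * g x 2
    fun_prop
  · change ContDiff ℝ m fun x => f x 0 * g x 1 - f x 1 * g x 0
    fun_prop

/-! ### Rotations -/

theorem cross_rotation {g : Vec ≃ₗᵢ[ℝ] Vec} (hg : IsRotation g) (u v : Vec) :
    cross (g u) (g v) = g (cross u v) := by
  refine ext_inner_left ℝ fun w => ?_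
  obtain ⟨w, rfl⟩ := g.surjective w
  rw [← triple_eq_inner_cross, triple_rotation hg, LinearIsometryEquiv.inner_map_map,
    triple_eq_inner_cross]

theorem IsRotation.symm {g : Vec ≃ₗᵢ[ℝ] Vec} (hg : IsRotation g) : IsRotation g.symm := by
  have h1 := LinearEquiv.det_mul_det_symm g.toLinearEquiv
  rw [show LinearMap.det (g.toLinearEquiv : Vec →ₗ[ℝ] Vec) = 1 from hg, one_mul] at h1
  exact h1

/-- The coordinates with respect to an oriented orthonormal frame are given by a rotation. -/
theorem exists_rotation_of_frame {f : Fin 3 → Vec} (hf : Orthonormal ℝ f)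
    (hdet : triple (f 0) (f 1) (f 2) = 1) :
    ∃ g : Vec ≃ₗᵢ[ℝ] Vec, IsRotation g ∧
      ∀ w, g w = !₂[inner ℝ (f 0) w, inner ℝ (f 1) w, inner ℝ (f 2) w] := by
  have hcard : Fintype.card (Fin 3) = Module.finrank ℝ Vec := by simp
  let b := (basisOfOrthonormalOfCardEqFinrank hf hcard).toOrthonormalBasis (by simpa using hf)
  have hb : ∀ i, b i = f i := fun i => by simp [b]
  refine ⟨b.repr, ?_, fun w => ?_⟩
  · have h : IsRotation b.repr.symm := by
      have h := (EuclideanSpace.basisFun (Fin 3) ℝ).toBasis.det_comp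
        (b.repr.symm.toLinearEquiv : Vec →ₗ[ℝ] Vec) (EuclideanSpace.basisFun (Fin 3) ℝ).toBasis
      rw [Module.Basis.det_self, mul_one] at h
      rw [IsRotation, ← h, ← hdet, triple]
      congr 1
      funext i
      fin_cases i <;> simp [← hb]
    simpa using h.symm
  · ext i
    rw [OrthonormalBasis.repr_apply_apply, hb]
    fin_cases i <;> rfl

end

section

variable {n : ℕ}

/-! ### Linear algebra at a non-collinear polygon -/

/-- The vectors of the tuple do not all lie on one line. -/
def NonCollinear (x : Fin n → Vec) : Prop := ¬ ∃ w : Vec, ∀ i, ∃ c : ℝ, x i = c • w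

/-- The linearized constraints on closed polygons. -/
def constraintMap (x : Fin n → Vec) : (Fin n → Vec) →ₗ[ℝ] (Fin n → ℝ) × Vec :=
  LinearMap.prod (LinearMap.pi fun i => innerₗ Vec (x i) ∘ₗ LinearMap.proj i)
    (∑ i, LinearMap.proj i)

theorem constraintMap_apply (x u : Fin n → Vec) :
    constraintMap x u = (fun i => inner ℝ (x i) (u i), ∑ i, u i) := by
  simp [constraintMap]; rfl

/-- The tangent space of the space of closed polygons. -/
def tangentVectors (x : Fin n → Vec) : Submodule ℝ (Fin n → Vec) :=
  LinearMap.ker (constraintMap x)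

theorem mem_tangentVectors {x u : Fin n → Vec} : u ∈ tangentVectors x ↔ IsTangent x u := by
  rw [tangentVectors, LinearMap.mem_ker, constraintMap_apply, Prod.mk_eq_zero, funext_iff]
  rfl

/-- Lagrange multipliers: α belongs to the length constraints and β to the closing condition. Both
the surjectivity of the constraints and the kernel of the product form are read off from these. -/
theorem exists_dual_constraint (ψ : Module.Dual ℝ ((Fin n → ℝ) × Vec)) (x : Fin n → Vec) :
    ∃ (α : Fin n → ℝ) (β : Vec), (∀ c w, ψ (c, w) = ∑ i, c i * α i + inner ℝ β w) ∧
      ∀ u, ψ (constraintMap x u) = ∑ i, inner ℝ (α i • x i + β) (u i) := by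
  have key : ∃ (α : Fin n → ℝ) (β : Vec), ∀ c w, ψ (c, w) = ∑ i, c i * α i + inner ℝ β w := by
    refine ⟨fun i => ψ (Pi.single i 1, 0), (InnerProductSpace.toDual ℝ Vec).symm
      (LinearMap.toContinuousLinearMap (ψ ∘ₗ LinearMap.inr ℝ (Fin n → ℝ) Vec)), fun c w => ?_⟩
    rw [InnerProductSpace.toDual_symm_apply]
    have h1 : (c, w) = LinearMap.inl ℝ (Fin n → ℝ) Vec c + LinearMap.inr ℝ (Fin n → ℝ) Vec w := by
      simp
    rw [h1, map_add]
    congr 1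
    change (ψ ∘ₗ LinearMap.inl ℝ (Fin n → ℝ) Vec) c = _
    rw [LinearMap.pi_apply_eq_sum_univ (ψ ∘ₗ LinearMap.inl ℝ (Fin n → ℝ) Vec) c]
    refine Finset.sum_congr rfl fun i _ => ?_
    rw [smul_eq_mul]
    congr 1
    change ψ (_, _) = _
    congr 2
    funext j
    simp [Pi.single_apply, eq_comm]
  obtain ⟨α, β, h⟩ := key
  refine ⟨α, β, h, fun u => ?_⟩
  rw [constraintMap_apply, h, inner_sum, ← Finset.sum_add_distrib]
  refine Finset.sum_congr rfl fun i _ => ?_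
  rw [inner_add_left, real_inner_smul_left]; ring

/-- A functional vanishing on the range satisfies α i • x i + β = 0 for all i. If β ≠ 0, every x i
lies on the line of β. If β = 0, every α i vanishes because x i ≠ 0. -/
theorem constraintMap_surjective {x : Fin n → Vec} (hx : NonCollinear x) (h0 : ∀ i, x i ≠ 0) :
    Function.Surjective (constraintMap x) := by
  rw [← LinearMap.range_eq_top]
  by_contra hne
  obtain ⟨ψ, hψ, hle⟩ := Submodule.exists_le_ker_of_lt_top _ (lt_top_iff_ne_top.2 hne)
  obtain ⟨α, β, h, h'⟩ := exists_dual_constraint ψ x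
  have hz : ∀ i, α i • x i + β = 0 := fun i => by
    have h1 : ψ (constraintMap x (Pi.single i (α i • x i + β))) = 0 :=
      hle (LinearMap.mem_range_self _ _)
    rw [h', Finset.sum_eq_single i (fun j _ hj => by simp [Pi.single_eq_of_ne hj])
      (by simp)] at h1
    simpa using h1
  have hβ : β = 0 := by
    by_contra hβ
    refine hx ⟨β, fun i => ⟨-(α i)⁻¹, ?_⟩⟩
    have hα : α i ≠ 0 := by
      intro hα
      apply hβ
      simpa [hα] using hz i
    rw [neg_smul, ← smul_neg, ← eq_neg_of_add_eq_zero_left (hz i), smul_smul,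
      inv_mul_cancel₀ hα, one_smul]
  have hα : ∀ i, α i = 0 := fun i => by
    have := hz i
    rw [hβ, add_zero, smul_eq_zero] at this
    exact this.resolve_right (h0 i)
  apply hψ
  ext p
  · simp [h, hα, hβ]
  · simp [h, hα, hβ]

theorem finrank_tuples (n : ℕ) : Module.finrank ℝ (Fin n → Vec) = 3 * n := by
  rw [Module.finrank_pi_fintype]; simp [mul_comm]

theorem finrank_tangentVectors {x : Fin n → Vec} (hx : NonCollinear x) (h0 : ∀ i, x i ≠ 0) :
    Module.finrank ℝ (tangentVectors x) + (n + 3) = 3 * n := by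
  have h := LinearMap.finrank_range_add_finrank_ker (constraintMap x)
  rw [LinearMap.range_eq_top.2 (constraintMap_surjective hx h0), finrank_top,
    Module.finrank_prod, finrank_tuples, Module.finrank_fin_fun, finrank_euclideanSpace_fin] at h
  rw [tangentVectors]; omega

/-- The infinitesimal rotation of a tuple with a given angular velocity. -/
def rotationVector (x : Fin n → Vec) : Vec →ₗ[ℝ] (Fin n → Vec) where
  toFun w i := cross w (x i)
  map_add' u v := funext fun i => add_cross u v (x i)
  map_smul' c u := funext fun i => smul_cross c u (x i)

@[simp] theorem rotationVector_apply (x : Fin n → Vec) (w : Vec) (i : Fin n) :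
    rotationVector x w i = cross w (x i) := rfl

/-- A nonzero angular velocity that moves no vector is an axis containing all of them. -/
theorem rotationVector_injective {x : Fin n → Vec} (hx : NonCollinear x) :
    Function.Injective (rotationVector x) := by
  rw [injective_iff_map_eq_zero]
  intro w hw
  by_contra hne
  exact hx ⟨w, fun i => ⟨_, exists_smul_of_cross_eq_zero hne (congrFun hw i)⟩⟩

theorem range_rotationVector_le {x : Fin n → Vec} (hsum : ∑ i, x i = 0) :
    LinearMap.range (rotationVector x) ≤ tangentVectors x := by
  rintro _ ⟨w, rfl⟩
  rw [mem_tangentVectors]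
  refine ⟨fun i => by simp, ?_⟩
  simp only [rotationVector_apply]
  rw [← cross_sum, hsum]
  simpa using cross_smul 0 w 0

theorem finrank_range_rotationVector {x : Fin n → Vec} (hx : NonCollinear x) :
    Module.finrank ℝ (LinearMap.range (rotationVector x)) = 3 := by
  rw [LinearMap.finrank_range_of_inj (rotationVector_injective hx)]; simp

theorem orbitForm_eq_sum (ℓ : Fin n → ℝ) (x u v : Fin n → Vec) :
    orbitForm ℓ x u v = ∑ i, inner ℝ ((-(1 / (2 * ℓ i ^ 2))) • cross (x i) (u i)) (v i) := by
  refine Finset.sum_congr rfl fun i _ => ?_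
  rw [real_inner_smul_left, triple_coord, inner_coord]
  simp only [cross_apply_zero, cross_apply_one, cross_apply_two]
  ring

/-- The kernel of the product form on tangent vectors consists of infinitesimal rotations. -/
theorem mem_range_rotationVector_of_orbitForm_eq_zero {ℓ : Fin n → ℝ} (hpos : ∀ j, 0 < ℓ j)
    {x u : Fin n → Vec} (hx : ∀ i, ‖x i‖ = ℓ i) (hu : IsTangent x u)
    (h : ∀ v, IsTangent x v → orbitForm ℓ x u v = 0) :
    u ∈ LinearMap.range (rotationVector x) := by
  let f : Module.Dual ℝ (Fin n → Vec) :=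
    ∑ i, innerₗ Vec ((-(1 / (2 * ℓ i ^ 2))) • cross (x i) (u i)) ∘ₗ LinearMap.proj i
  have hf : ∀ v, f v = orbitForm ℓ x u v := fun v => by
    rw [orbitForm_eq_sum]; simp [f, real_inner_smul_left]
  -- A functional that vanishes on the kernel of the constraints factors through them, which
  -- produces the multipliers α and β.
  have hmem : f ∈ (LinearMap.ker (constraintMap x)).dualAnnihilator := by
    rw [Submodule.mem_dualAnnihilator]
    intro v hv
    rw [hf]
    exact h v (mem_tangentVectors.1 hv)
  rw [← LinearMap.range_dualMap_eq_dualAnnihilator_ker] at hmem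
  obtain ⟨ψ, hψ⟩ := hmem
  obtain ⟨α, β, -, h'⟩ := exists_dual_constraint ψ x
  have hz : ∀ i, (-(1 / (2 * ℓ i ^ 2))) • cross (x i) (u i) = α i • x i + β := fun i => by
    refine ext_inner_right ℝ fun w => ?_
    have h1 := congrArg (fun φ => φ (Pi.single i w)) hψ
    simp only [LinearMap.dualMap_apply, h', hf, orbitForm_eq_sum] at h1
    rw [Finset.sum_eq_single i (fun j _ hj => by simp [Pi.single_eq_of_ne hj]) (by simp),
      Finset.sum_eq_single i (fun j _ hj => by simp [Pi.single_eq_of_ne hj]) (by simp)] at h1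
    simpa using h1.symm
  -- Taking the cross product with x i removes α i, and since u i is orthogonal to x i the double
  -- cross product on the left becomes u i / 2. Thus u i / 2 = x i × β, that is, u i = (-2β) × x i.
  refine ⟨(-2 : ℝ) • β, funext fun i => ?_⟩
  have h2 := congrArg (cross (x i)) (hz i)
  have hl : inner ℝ (x i) (x i) = ℓ i ^ 2 := by rw [real_inner_self_eq_norm_sq, hx]
  rw [cross_smul, cross_cross, hu.1 i, hl, cross_add, cross_smul, cross_self, smul_zero, zero_add,
    zero_smul, zero_sub, smul_neg, neg_smul, neg_neg, smul_smul, one_div, mul_inv,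
    mul_assoc, inv_mul_cancel₀ (pow_pos (hpos i) 2).ne', mul_one] at h2
  rw [rotationVector_apply, smul_cross, cross_swap, ← h2, neg_smul, smul_neg, neg_neg, smul_smul]
  norm_num

/-- The product form vanishes between tangent vectors and infinitesimal rotations. -/
theorem orbitForm_rotationVector {ℓ : Fin n → ℝ} (hpos : ∀ j, 0 < ℓ j)
    {x v : Fin n → Vec} (hx : ∀ i, ‖x i‖ = ℓ i) (hv : IsTangent x v) (w : Vec) :
    orbitForm ℓ x (rotationVector x w) v = 0 := by
  rw [orbitForm_eq_sum]
  -- Each sphere contributes -w·v i / 2, independently of x i. This is the momentum map identity,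
  -- and the closing condition on v then kills the sum.
  have h1 : ∀ i, inner ℝ ((-(1 / (2 * ℓ i ^ 2))) • cross (x i) (rotationVector x w i)) (v i)
      = inner ℝ ((-1 / 2 : ℝ) • w) (v i) := fun i => by
    have hl : inner ℝ (x i) (x i) = ℓ i ^ 2 := by rw [real_inner_self_eq_norm_sq, hx]
    have := (hpos i).ne'
    rw [rotationVector_apply, cross_cross, hl, real_inner_smul_left, inner_sub_left,
      real_inner_smul_left, real_inner_smul_left, hv.1 i, real_inner_smul_left]
    field_simp
    ring
  simp only [h1]
  rw [← inner_sum, hv.2, inner_zero_right]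

theorem orbitForm_swap (ℓ : Fin n → ℝ) (x u v : Fin n → Vec) :
    orbitForm ℓ x u v = -orbitForm ℓ x v u := by
  rw [orbitForm, orbitForm, ← Finset.sum_neg_distrib]
  refine Finset.sum_congr rfl fun i _ => ?_
  rw [triple_coord, triple_coord]; ring

theorem orbitForm_rotation {g : Vec ≃ₗᵢ[ℝ] Vec} (hg : IsRotation g) (ℓ : Fin n → ℝ)
    (x u v : Fin n → Vec) :
    orbitForm ℓ (fun i => g (x i)) (fun i => g (u i)) (fun i => g (v i)) = orbitForm ℓ x u v := by
  simp only [orbitForm, triple_rotation hg]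

theorem orbitForm_add_left (ℓ : Fin n → ℝ) (x u u' v : Fin n → Vec) :
    orbitForm ℓ x (u + u') v = orbitForm ℓ x u v + orbitForm ℓ x u' v := by
  simp only [orbitForm_eq_sum, Pi.add_apply, cross_add, smul_add, inner_add_left,
    Finset.sum_add_distrib]

theorem orbitForm_add_right (ℓ : Fin n → ℝ) (x u v v' : Fin n → Vec) :
    orbitForm ℓ x u (v + v') = orbitForm ℓ x u v + orbitForm ℓ x u v' := by
  simp only [orbitForm_eq_sum, Pi.add_apply, inner_add_right, Finset.sum_add_distrib]

/-- The product form on tangent vectors depends only on their classes modulo infinitesimal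
rotations. -/
theorem orbitForm_add_rotationVector {ℓ : Fin n → ℝ} (hpos : ∀ j, 0 < ℓ j)
    {x u v : Fin n → Vec} (hx : ∀ i, ‖x i‖ = ℓ i) (hsum : ∑ i, x i = 0) (hu : IsTangent x u)
    (hv : IsTangent x v) (w z : Vec) :
    orbitForm ℓ x (u + rotationVector x w) (v + rotationVector x z) = orbitForm ℓ x u v := by
  have hz : IsTangent x (rotationVector x z) :=
    mem_tangentVectors.1 (range_rotationVector_le hsum ⟨z, rfl⟩)
  rw [orbitForm_add_left, orbitForm_add_right, orbitForm_add_right,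
    orbitForm_rotationVector hpos hx hv, orbitForm_rotationVector hpos hx hz,
    orbitForm_swap ℓ x u (rotationVector x z), orbitForm_rotationVector hpos hx hu]
  ring

end

section

variable {n : ℕ}

/-! ### Moving frames -/

theorem ContDiffOn.cross {E : Type*} [NormedAddCommGroup E] [NormedSpace ℝ E]
    {m : WithTop ℕ∞} {s : Set E} {f g : E → Vec} (hf : ContDiffOn ℝ m f s)
    (hg : ContDiffOn ℝ m g s) : ContDiffOn ℝ m (fun x => cross (f x) (g x)) s := by
  have h : ContDiff ℝ m fun p : Vec × Vec => PolygonSpaces.cross p.1 p.2 :=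
    ContDiff.cross contDiff_fst contDiff_snd
  exact h.comp_contDiffOn (hf.prodMk hg)

/-- The oriented orthonormal frame obtained from two independent vectors. -/
def frame (p q : Vec) : Fin 3 → Vec :=
  ![‖p‖⁻¹ • p, cross (‖cross p q‖⁻¹ • cross p q) (‖p‖⁻¹ • p), ‖cross p q‖⁻¹ • cross p q]

theorem frame_rotation {g : Vec ≃ₗᵢ[ℝ] Vec} (hg : IsRotation g) (p q : Vec) (k : Fin 3) :
    frame (g p) (g q) k = g (frame p q k) := by
  fin_cases k <;>
    simp [frame, cross_rotation hg, smul_cross, cross_smul]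

theorem inner_inv_norm_smul_self {p : Vec} (hp : p ≠ 0) :
    inner ℝ (‖p‖⁻¹ • p) (‖p‖⁻¹ • p) = (1 : ℝ) := by
  rw [real_inner_self_eq_norm_sq, norm_smul, norm_inv, norm_norm,
    inv_mul_cancel₀ (norm_ne_zero_iff.2 hp), one_pow]

theorem frame_spec {p q : Vec} (h : cross p q ≠ 0) :
    Orthonormal ℝ (frame p q) ∧ triple (frame p q 0) (frame p q 1) (frame p q 2) = 1 := by
  have h00 := inner_inv_norm_smul_self (cross_ne_zero_left h)
  have h22 := inner_inv_norm_smul_self h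
  have h02 : inner ℝ (‖p‖⁻¹ • p) (‖cross p q‖⁻¹ • cross p q) = (0 : ℝ) := by
    simp [real_inner_smul_left, real_inner_smul_right]
  set f0 := ‖p‖⁻¹ • p with hf0
  set f2 := ‖cross p q‖⁻¹ • cross p q with hf2
  have h20 : inner ℝ f2 f0 = (0 : ℝ) := by rw [real_inner_comm]; exact h02
  have hf : frame p q = ![f0, cross f2 f0, f2] := by simp [frame, hf0, hf2]
  rw [hf]
  refine ⟨?_, ?_⟩
  · rw [orthonormal_iff_ite]
    intro i j
    have h11 : inner ℝ (cross f2 f0) (cross f2 f0) = (1 : ℝ) := by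
      rw [inner_cross_cross, h00, h22, h20]; ring
    fin_cases i <;> fin_cases j <;>
      simp [-inner_self_eq_norm_sq_to_K, h00, h22, h02, h20, h11,
        real_inner_comm f2, real_inner_comm f0]
  · change triple f0 (cross f2 f0) f2 = 1
    rw [triple_eq_inner_cross, cross_swap, cross_cross, h20, h22]
    simp [-inner_self_eq_norm_sq_to_K, h00]

/-- The tuples whose vectors `a` and `b` are independent. -/
def pairDomain (a b : Fin n) : Set (Fin n → Vec) := {y | cross (y a) (y b) ≠ 0}

/-- The coordinates of a tuple in the frame of its vectors `a` and `b`. -/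
def normalize (a b : Fin n) (y : Fin n → Vec) : Fin n → Vec := fun i =>
  !₂[inner ℝ (frame (y a) (y b) 0) (y i), inner ℝ (frame (y a) (y b) 1) (y i),
    inner ℝ (frame (y a) (y b) 2) (y i)]

theorem isOpen_pairDomain (a b : Fin n) : IsOpen (pairDomain a b) := by
  have h : Continuous fun y : Fin n → Vec => cross (y a) (y b) :=
    (ContDiff.cross (m := 0) (contDiff_apply ℝ Vec a) (contDiff_apply ℝ Vec b)).continuous
  exact isOpen_ne_fun h continuous_const

/-- The frame turns with the tuple, so coordinates in it are rotation invariants. Smooth functions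
of `normalize` therefore descend to the quotient. -/
theorem normalize_rotation {g : Vec ≃ₗᵢ[ℝ] Vec} (hg : IsRotation g) (a b : Fin n)
    (y : Fin n → Vec) : normalize a b (fun i => g (y i)) = normalize a b y := by
  funext i
  simp only [normalize, frame_rotation hg, LinearIsometryEquiv.inner_map_map]

theorem exists_rotation_normalize {a b : Fin n} {y : Fin n → Vec} (hy : y ∈ pairDomain a b) :
    ∃ g : Vec ≃ₗᵢ[ℝ] Vec, IsRotation g ∧ ∀ i, normalize a b y i = g (y i) := by
  obtain ⟨g, hg, h⟩ := exists_rotation_of_frame (frame_spec hy).1 (frame_spec hy).2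
  exact ⟨g, hg, fun i => (h (y i)).symm⟩

theorem contDiffOn_normalize {m : WithTop ℕ∞} (a b : Fin n) :
    ContDiffOn ℝ m (normalize a b) (pairDomain a b) := by
  have hi : ∀ i, ContDiffOn ℝ m (fun y : Fin n → Vec => y i) (pairDomain a b) := fun i =>
    (contDiff_apply ℝ Vec i).contDiffOn
  have hc := ContDiffOn.cross (hi a) (hi b)
  have h0 : ContDiffOn ℝ m (fun y : Fin n → Vec => ‖y a‖⁻¹ • y a) (pairDomain a b) :=
    (((hi a).norm ℝ fun y hy => cross_ne_zero_left hy).inv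
      fun y hy => norm_ne_zero_iff.2 (cross_ne_zero_left hy)).smul (hi a)
  have h2 : ContDiffOn ℝ m (fun y : Fin n → Vec => ‖cross (y a) (y b)‖⁻¹ • cross (y a) (y b))
      (pairDomain a b) :=
    ((hc.norm ℝ fun y hy => hy).inv fun y hy => norm_ne_zero_iff.2 hy).smul hc
  have h1 := ContDiffOn.cross h2 h0
  rw [contDiffOn_pi]
  intro i
  rw [contDiffOn_euclidean]
  intro k
  fin_cases k
  · exact h0.inner ℝ (hi i)
  · exact h1.inner ℝ (hi i)
  · exact h2.inner ℝ (hi i)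

/-- The tuples whose frame of the vectors `a` and `b` is the standard one. -/
def StandardPosition (a b : Fin n) (y : Fin n → Vec) : Prop :=
  y a 1 = 0 ∧ y a 2 = 0 ∧ y b 2 = 0 ∧ 0 < y a 0 ∧ 0 < y b 1

theorem StandardPosition.cross_eq {a b : Fin n} {y : Fin n → Vec} (h : StandardPosition a b y) :
    cross (y a) (y b) = !₂[0, 0, y a 0 * y b 1] := by
  obtain ⟨h1, h2, h3, -, -⟩ := h
  apply vec_ext <;> simp [h1, h2, h3]

theorem StandardPosition.mem_pairDomain {a b : Fin n} {y : Fin n → Vec}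
    (h : StandardPosition a b y) : y ∈ pairDomain a b := by
  intro h0
  have := congrArg (fun v : Vec => v 2) (h.cross_eq.symm.trans h0)
  exact (mul_pos h.2.2.2.1 h.2.2.2.2).ne' (by simpa using this)

theorem norm_eq_of_coord {v : Vec} {c : ℝ} (hc : 0 ≤ c) (h : inner ℝ v v = c ^ 2) : ‖v‖ = c := by
  rw [real_inner_self_eq_norm_sq] at h
  exact (sq_eq_sq₀ (norm_nonneg v) hc).1 h

theorem StandardPosition.normalize_eq {a b : Fin n} {y : Fin n → Vec}
    (h : StandardPosition a b y) : normalize a b y = y := by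
  have hc := h.cross_eq
  obtain ⟨h1, h2, h3, h4, h5⟩ := h
  have hna : ‖y a‖ = y a 0 := norm_eq_of_coord h4.le (by rw [inner_coord, h1, h2]; ring)
  have hnc : ‖cross (y a) (y b)‖ = y a 0 * y b 1 :=
    norm_eq_of_coord (mul_pos h4 h5).le (by rw [hc, inner_coord]; simp; ring)
  have h6 : y b 1 ≠ 0 := h5.ne'
  have h7 : y a 0 ≠ 0 := h4.ne'
  have f0 : ‖y a‖⁻¹ • y a = !₂[1, 0, 0] := by
    apply vec_ext <;> simp [hna, h1, h2, h7]
  have f2 : ‖cross (y a) (y b)‖⁻¹ • cross (y a) (y b) = !₂[0, 0, 1] := by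
    rw [hnc, hc]
    apply vec_ext <;> simp
    field_simp
  have f1 : cross (!₂[0, 0, 1] : Vec) !₂[1, 0, 0] = !₂[0, 1, 0] := by
    apply vec_ext <;> simp
  funext i
  apply vec_ext <;> simp [normalize, frame, f0, f2, f1, inner_coord]

theorem standardPosition_normalize {a b : Fin n} {y : Fin n → Vec} (hy : y ∈ pairDomain a b) :
    StandardPosition a b (normalize a b y) := by
  have hp : y a ≠ 0 := cross_ne_zero_left hy
  have h02 : inner ℝ (y a) (cross (y a) (y b)) = (0 : ℝ) := inner_cross_self_left _ _
  refine ⟨?_, ?_, ?_, ?_, ?_⟩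
  · change inner ℝ (cross (_ • cross (y a) (y b)) (_ • y a)) (y a) = (0 : ℝ)
    rw [cross_smul, real_inner_smul_left, real_inner_comm, inner_cross_self_right, mul_zero]
  · change inner ℝ (_ • cross (y a) (y b)) (y a) = (0 : ℝ)
    rw [real_inner_smul_left, real_inner_comm, inner_cross_self_left, mul_zero]
  · change inner ℝ (_ • cross (y a) (y b)) (y b) = (0 : ℝ)
    rw [real_inner_smul_left, real_inner_comm, inner_cross_self_right, mul_zero]
  · change 0 < inner ℝ (‖y a‖⁻¹ • y a) (y a)
    rw [real_inner_smul_left]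
    exact mul_pos (inv_pos.2 (norm_pos_iff.2 hp)) (inner_self_pos hp)
  · change 0 < inner ℝ (cross (_ • cross (y a) (y b)) (_ • y a)) (y b)
    rw [cross_smul, smul_cross, real_inner_smul_left, real_inner_smul_left]
    have h : inner ℝ (cross (cross (y a) (y b)) (y a)) (y b)
        = inner ℝ (cross (y a) (y b)) (cross (y a) (y b)) := by
      simp only [inner_coord, cross_apply_zero, cross_apply_one, cross_apply_two]; ring
    rw [h]
    exact mul_pos (inv_pos.2 (norm_pos_iff.2 hp))
      (mul_pos (inv_pos.2 (norm_pos_iff.2 hy)) (inner_self_pos hy))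

theorem NonCollinear.exists_mem_pairDomain {y : Fin n → Vec} (h : NonCollinear y)
    (h0 : ∀ i, y i ≠ 0) : ∃ a b, y ∈ pairDomain a b := by
  by_contra! hc
  have hn : Nonempty (Fin n) := by
    by_contra hn
    rw [not_nonempty_iff] at hn
    exact h ⟨0, fun i => hn.elim i⟩
  obtain ⟨a⟩ := hn
  exact h ⟨y a, fun b => ⟨_, exists_smul_of_cross_eq_zero (h0 a) (not_not.1 (hc a b))⟩⟩

theorem nonCollinear_of_mem_pairDomain {a b : Fin n} {y : Fin n → Vec} (h : y ∈ pairDomain a b) :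
    NonCollinear y := by
  rintro ⟨w, hw⟩
  obtain ⟨c, hc⟩ := hw a
  obtain ⟨d, hd⟩ := hw b
  apply h
  rw [hc, hd, smul_cross, cross_smul, cross_self, smul_zero, smul_zero]

theorem mem_pairDomain_rotation {g : Vec ≃ₗᵢ[ℝ] Vec} (hg : IsRotation g) {a b : Fin n}
    {y : Fin n → Vec} (hy : y ∈ pairDomain a b) : (fun i => g (y i)) ∈ pairDomain a b := by
  change cross (g (y a)) (g (y b)) ≠ 0
  rw [cross_rotation hg]
  simpa [pairDomain] using hy

theorem NonCollinear.rotation {y : Fin n → Vec} (h : NonCollinear y) (g : Vec ≃ₗᵢ[ℝ] Vec) :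
    NonCollinear fun i => g (y i) := by
  rintro ⟨w, hw⟩
  refine h ⟨g.symm w, fun i => ?_⟩
  obtain ⟨c, hc⟩ := hw i
  exact ⟨c, by rw [← map_smul, ← hc, LinearIsometryEquiv.symm_apply_apply]⟩

end

section

variable {n : ℕ}

/-! ### Slices for the rotation group -/

/-- The model space of the smooth part of the polygon space. -/
abbrev Model (n : ℕ) := EuclideanSpace ℝ (Fin (2 * (n - 3)))

/-- A local slice: smooth rotation-invariant functions `proj` on an open set of tuples and a smooth
family `sec` of closed polygons, which are inverse to each other up to rotations. -/
structure Slice (ℓ : Fin n → ℝ) where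
  proj : (Fin n → Vec) → Model n
  sec : Model n → Fin n → Vec
  dom : Set (Fin n → Vec)
  tgt : Set (Model n)
  isOpen_dom : IsOpen dom
  isOpen_tgt : IsOpen tgt
  nonCollinear : ∀ y ∈ dom, NonCollinear y
  contDiffOn_proj : ContDiffOn ℝ ∞ proj dom
  contDiffOn_sec : ContDiffOn ℝ ∞ sec tgt
  sec_mem : ∀ v, sec v ∈ closedPolygons ℓ
  sec_dom : ∀ v, sec v ∈ dom
  proj_sec : ∀ v ∈ tgt, proj (sec v) = v
  dom_rotation : ∀ g : Vec ≃ₗᵢ[ℝ] Vec, IsRotation g → ∀ y ∈ dom, (fun i => g (y i)) ∈ dom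
  proj_rotation : ∀ g : Vec ≃ₗᵢ[ℝ] Vec, IsRotation g → ∀ y ∈ dom,
    proj (fun i => g (y i)) = proj y
  proj_mem : ∀ y ∈ dom, y ∈ closedPolygons ℓ → proj y ∈ tgt
  sec_proj : ∀ y ∈ dom, y ∈ closedPolygons ℓ →
    ∃ g : Vec ≃ₗᵢ[ℝ] Vec, IsRotation g ∧ ∀ i, sec (proj y) i = g (y i)

/-- The functions which vanish on the tuples in standard position. -/
def gauge (a b : Fin n) : (Fin n → Vec) →ₗ[ℝ] ℝ × ℝ × ℝ where
  toFun u := (u a 1, u a 2, u b 2)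
  map_add' _ _ := rfl
  map_smul' _ _ := rfl

theorem gauge_apply (a b : Fin n) (u : Fin n → Vec) : gauge a b u = (u a 1, u a 2, u b 2) := rfl

/-- The tangent vectors which keep a tuple in standard position. -/
def gaugeKernel (a b : Fin n) (x : Fin n → Vec) : Submodule ℝ (Fin n → Vec) :=
  tangentVectors x ⊓ LinearMap.ker (gauge a b)

/-- The constraints on closed polygons, the gauge condition and linear coordinates. -/
def sliceMap (a b : Fin n) (P : (Fin n → Vec) →L[ℝ] Model n) (y : Fin n → Vec) :
    (((Fin n → ℝ) × Vec) × (ℝ × ℝ × ℝ)) × Model n :=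
  (((fun i => inner ℝ (y i) (y i), ∑ i, y i), (y a 1, y a 2, y b 2)), P y)

theorem contDiff_sliceMap {m : WithTop ℕ∞} (a b : Fin n) (P : (Fin n → Vec) →L[ℝ] Model n) :
    ContDiff ℝ m (sliceMap a b P) := by
  have hi : ∀ i, ContDiff ℝ m (fun y : Fin n → Vec => y i) := fun i => contDiff_apply ℝ Vec i
  have hik : ∀ i k, ContDiff ℝ m (fun y : Fin n → Vec => y i k) := fun i k => by fun_prop
  exact (((contDiff_pi.2 fun i => (hi i).inner ℝ (hi i)).prodMk
    (ContDiff.sum fun i _ => hi i)).prodMk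
      ((hik a 1).prodMk ((hik a 2).prodMk (hik b 2)))).prodMk P.contDiff

theorem hasFDerivAt_vertexCoord (i : Fin n) (k : Fin 3) (y : Fin n → Vec) :
    HasFDerivAt (fun y : Fin n → Vec => y i k)
      ((EuclideanSpace.proj k : Vec →L[ℝ] ℝ) ∘L
        (ContinuousLinearMap.proj i : (Fin n → Vec) →L[ℝ] Vec)) y :=
  ((EuclideanSpace.proj k : Vec →L[ℝ] ℝ) ∘L
        (ContinuousLinearMap.proj i : (Fin n → Vec) →L[ℝ] Vec)).hasFDerivAt

theorem fderiv_sliceMap_apply (a b : Fin n) (P : (Fin n → Vec) →L[ℝ] Model n)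
    (x u : Fin n → Vec) : fderiv ℝ (sliceMap a b P) x u =
      (((fun i => 2 * inner ℝ (x i) (u i), ∑ i, u i), (u a 1, u a 2, u b 2)), P u) := by
  have hi : ∀ i, HasFDerivAt (fun y : Fin n → Vec => y i)
      (ContinuousLinearMap.proj i : (Fin n → Vec) →L[ℝ] Vec) x := fun i =>
    (ContinuousLinearMap.proj i : (Fin n → Vec) →L[ℝ] Vec).hasFDerivAt
  have h1 := hasFDerivAt_pi.2 fun i => (hi i).inner ℝ (hi i)
  have h2 := HasFDerivAt.fun_sum (u := Finset.univ) fun i _ => hi i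
  have h := ((h1.prodMk h2).prodMk ((hasFDerivAt_vertexCoord a 1 x).prodMk
    ((hasFDerivAt_vertexCoord a 2 x).prodMk (hasFDerivAt_vertexCoord b 2 x)))).prodMk
      (P.hasFDerivAt (x := x))
  have h' : HasFDerivAt (sliceMap a b P) _ x := h
  rw [h'.fderiv]
  ext i <;> simp [real_inner_comm, two_mul]

theorem finrank_sliceTarget (hn : 3 ≤ n) :
    Module.finrank ℝ (Fin n → Vec) =
      Module.finrank ℝ ((((Fin n → ℝ) × Vec) × (ℝ × ℝ × ℝ)) × Model n) := by
  rw [finrank_tuples]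
  simp only [Module.finrank_prod, Module.finrank_fin_fun, finrank_euclideanSpace_fin,
    Module.finrank_self]
  omega

/-- The inverse function theorem applies to `sliceMap`: its derivative is injective because the
kernel of constraints and gauge is `gaugeKernel`, on which P is injective, and both sides have
dimension 3n = n + 3 + 3 + 2(n-3). Fixing the values of the constraints and of the gauge leaves the
coordinates P. -/
theorem exists_slice (hn : 3 ≤ n) {ℓ : Fin n → ℝ} (hpos : ∀ j, 0 < ℓ j) {a b : Fin n}
    {x : Fin n → Vec} (hx : x ∈ closedPolygons ℓ) (hs : StandardPosition a b x)
    (P : (Fin n → Vec) →L[ℝ] Model n) (hP : ∀ u ∈ gaugeKernel a b x, P u = 0 → u = 0) :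
    ∃ S : Slice ℓ, x ∈ S.dom ∧ (∀ y ∈ S.dom, y ∈ pairDomain a b) ∧
      (∀ y, S.proj y = P (normalize a b y)) ∧ ∀ v, StandardPosition a b (S.sec v) := by
  -- the derivative is an isomorphism
  have hinj : Function.Injective (fderiv ℝ (sliceMap a b P) x) := by
    rw [injective_iff_map_eq_zero]
    intro u hu
    rw [fderiv_sliceMap_apply] at hu
    simp only [Prod.mk_eq_zero, funext_iff, Pi.zero_apply] at hu
    obtain ⟨⟨⟨h1, h2⟩, h3, h4, h5⟩, h6⟩ := hu
    refine hP u ⟨mem_tangentVectors.2 ⟨fun i => by simpa using h1 i, h2⟩, ?_⟩ h6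
    rw [SetLike.mem_coe, LinearMap.mem_ker, gauge_apply, h3, h4, h5]; rfl
  let L : (Fin n → Vec) ≃L[ℝ] (((Fin n → ℝ) × Vec) × (ℝ × ℝ × ℝ)) × Model n :=
    (LinearEquiv.ofInjectiveOfFinrankEq (fderiv ℝ (sliceMap a b P) x : _ →ₗ[ℝ] _) hinj
      (finrank_sliceTarget hn)).toContinuousLinearEquiv
  have hL : HasFDerivAt (sliceMap a b P) (L : (Fin n → Vec) →L[ℝ] _) x := by
    have h := ((contDiff_sliceMap (m := ω) a b P).differentiable (by simp) x).hasFDerivAt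
    have hLe : (L : (Fin n → Vec) →L[ℝ] _) = fderiv ℝ (sliceMap a b P) x :=
      ContinuousLinearMap.ext fun u => rfl
    rw [hLe]
    exact h
  -- At order `ω`, unlike `∞`, regularity at a point extends to a neighbourhood. This gives the open
  -- set O on which the inverse is smooth.
  have hcd : ContDiffAt ℝ ω (sliceMap a b P) x := (contDiff_sliceMap a b P).contDiffAt
  let e := hcd.toOpenPartialHomeomorph (sliceMap a b P) hL (by simp)
  have he : ∀ y, e y = sliceMap a b P y := fun y => rfl
  have hxe : x ∈ e.source := hcd.mem_toOpenPartialHomeomorph_source hL (by simp)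
  have hsymm : ContDiffAt ℝ ω e.symm (e x) := hcd.to_localInverse hL (by simp)
  obtain ⟨O, hO, hOo, hOx⟩ := eventually_nhds_iff.1 (hsymm.eventually (by simp))
  -- the neighbourhood of `x` where everything is fine
  have hposo : IsOpen {y : Fin n → Vec | 0 < y a 0 ∧ 0 < y b 1} := by
    have hik : ∀ (i : Fin n) (k : Fin 3), Continuous (fun y : Fin n → Vec => y i k) :=
      fun i k => by fun_prop
    exact (isOpen_lt continuous_const (hik a 0)).inter (isOpen_lt continuous_const (hik b 1))
  let W : Set (Fin n → Vec) := (e.source ∩ e ⁻¹' O) ∩ {y | 0 < y a 0 ∧ 0 < y b 1}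
  have hW : IsOpen W := (e.isOpen_inter_preimage hOo).inter hposo
  have hxW : x ∈ W := ⟨⟨hxe, hOx⟩, hs.2.2.2⟩
  -- The values of `sliceMap` at closed polygons in standard position: squared lengths ℓ i ^ 2, zero
  -- sum, zero gauge, free coordinates v.
  let c : Model n → (((Fin n → ℝ) × Vec) × (ℝ × ℝ × ℝ)) × Model n :=
    fun v => (((fun i => ℓ i ^ 2, 0), 0), v)
  have hc : ContDiff ℝ ∞ c := contDiff_const.prodMk contDiff_id
  let V : Set (Model n) := c ⁻¹' (e.target ∩ e.symm ⁻¹' W)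
  have hV : IsOpen V := (e.symm.isOpen_inter_preimage hW).preimage hc.continuous
  have hew : ∀ y ∈ closedPolygons ℓ, StandardPosition a b y → e y = c (P y) := by
    intro y hy hsy
    rw [he]
    simp [sliceMap, c, hy.1, hy.2, hsy.1, hsy.2.1, hsy.2.2.1]
  have hmem : ∀ v ∈ V, e.symm (c v) ∈ closedPolygons ℓ ∧ StandardPosition a b (e.symm (c v)) ∧
      P (e.symm (c v)) = v := by
    intro v hv
    have h := e.right_inv hv.1
    rw [he] at h
    simp only [sliceMap, c, Prod.mk.injEq, funext_iff, Prod.mk_eq_zero] at h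
    obtain ⟨⟨⟨h1, h2⟩, h3, h4, h5⟩, h6⟩ := h
    exact ⟨⟨fun i => norm_eq_of_coord (hpos i).le (h1 i), h2⟩,
      ⟨h3, h4, h5, hv.2.2⟩, h6⟩
  classical
  -- Outside V the section takes the constant value x, so that it always yields a closed polygon of
  -- the domain.
  let s : Model n → Fin n → Vec := fun v => if v ∈ V then e.symm (c v) else x
  have hs1 : ∀ v ∈ V, s v = e.symm (c v) := fun v hv => if_pos hv
  have hs2 : ∀ v, s v ∈ closedPolygons ℓ ∧ StandardPosition a b (s v) ∧ s v ∈ W := by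
    intro v
    by_cases hv : v ∈ V
    · rw [hs1 v hv]
      exact ⟨(hmem v hv).1, (hmem v hv).2.1, hv.2⟩
    · rw [show s v = x from if_neg hv]
      exact ⟨hx, hs, hxW⟩
  have hrot : ∀ y ∈ pairDomain a b, y ∈ closedPolygons ℓ → normalize a b y ∈ closedPolygons ℓ := by
    intro y hy hyc
    obtain ⟨g, -, h⟩ := exists_rotation_normalize hy
    refine ⟨fun i => by rw [h, LinearIsometryEquiv.norm_map, hyc.1], ?_⟩
    simp only [h]
    rw [← map_sum, hyc.2, map_zero]
  have hpW : ∀ y ∈ closedPolygons ℓ, StandardPosition a b y → y ∈ W →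
      P y ∈ V ∧ e.symm (c (P y)) = y := by
    intro y hy hsy hyW
    have h1 : e.symm (c (P y)) = y := by rw [← hew y hy hsy, e.left_inv hyW.1.1]
    refine ⟨⟨?_, ?_⟩, h1⟩
    · rw [← hew y hy hsy]; exact e.map_source hyW.1.1
    · rw [Set.mem_preimage, h1]; exact hyW
  refine ⟨{
    proj := fun y => P (normalize a b y)
    sec := s
    dom := pairDomain a b ∩ normalize a b ⁻¹' W
    tgt := V
    isOpen_dom := (contDiffOn_normalize (m := 0) a b).continuousOn.isOpen_inter_preimage
      (isOpen_pairDomain a b) hW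
    isOpen_tgt := hV
    nonCollinear := fun y hy => nonCollinear_of_mem_pairDomain hy.1
    contDiffOn_proj := P.contDiff.comp_contDiffOn
      ((contDiffOn_normalize a b).mono Set.inter_subset_left)
    contDiffOn_sec := ?_
    sec_mem := fun v => (hs2 v).1
    sec_dom := fun v => ⟨(hs2 v).2.1.mem_pairDomain, by
      rw [Set.mem_preimage, (hs2 v).2.1.normalize_eq]; exact (hs2 v).2.2⟩
    proj_sec := fun v hv => by
      rw [(hs2 v).2.1.normalize_eq, hs1 v hv, (hmem v hv).2.2]
    dom_rotation := fun g hg y hy => ⟨mem_pairDomain_rotation hg hy.1, by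
      rw [Set.mem_preimage, normalize_rotation hg]; exact hy.2⟩
    proj_rotation := fun g hg y hy => by rw [normalize_rotation hg]
    proj_mem := fun y hy hyc =>
      (hpW _ (hrot y hy.1 hyc) (standardPosition_normalize hy.1) hy.2).1
    sec_proj := fun y hy hyc => ?_ }, ?_, fun y hy => hy.1, fun y => rfl, fun v => (hs2 v).2.1⟩
  · have h1 : ContDiffOn ℝ ∞ (fun v => e.symm (c v)) V := by
      intro v hv
      have h2 : c v ∈ O := by
        have := hv.2.1.2
        rwa [Set.mem_preimage, e.right_inv hv.1] at this
      exact (((hO _ h2).of_le (by simp)).comp v hc.contDiffAt).contDiffWithinAt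
    exact h1.congr hs1
  · obtain ⟨h1, h2⟩ := hpW _ (hrot y hy.1 hyc) (standardPosition_normalize hy.1) hy.2
    obtain ⟨g, hg, h⟩ := exists_rotation_normalize hy.1
    exact ⟨g, hg, fun i => by rw [hs1 _ h1, h2, h]⟩
  · exact ⟨hs.mem_pairDomain, by rw [Set.mem_preimage, hs.normalize_eq]; exact hxW⟩

end

/-! ### Linear coordinates for slices -/

section

variable {n : ℕ}

/-- An infinitesimal rotation that respects the gauge is zero, so `gaugeKernel` meets the
3-dimensional space of rotations trivially inside a tangent space of dimension 2n - 3. -/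
theorem finrank_gaugeKernel_le (hn : 3 ≤ n) {ℓ : Fin n → ℝ} (hpos : ∀ j, 0 < ℓ j) {a b : Fin n}
    {x : Fin n → Vec} (hx : x ∈ closedPolygons ℓ) (hs : StandardPosition a b x) :
    Module.finrank ℝ (gaugeKernel a b x) ≤ 2 * (n - 3) := by
  have h0 : ∀ i, x i ≠ 0 := fun i => norm_pos_iff.1 (by rw [hx.1]; exact hpos i)
  have hnc := nonCollinear_of_mem_pairDomain hs.mem_pairDomain
  have h1 := finrank_tangentVectors hnc h0
  have h2 := finrank_range_rotationVector hnc
  have hinf : LinearMap.range (rotationVector x) ⊓ gaugeKernel a b x = ⊥ := by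
    rw [eq_bot_iff]
    rintro _ ⟨⟨w, rfl⟩, -, hg⟩
    rw [SetLike.mem_coe, LinearMap.mem_ker, gauge_apply] at hg
    obtain ⟨s1, s2, s3, s4, s5⟩ := hs
    simp only [rotationVector_apply, cross_apply_one, cross_apply_two, s1, s2, mul_zero, sub_zero,
      zero_sub, Prod.mk_eq_zero, mul_eq_zero, neg_eq_zero, s4.ne', or_false] at hg
    obtain ⟨g1, g2, g3⟩ := hg
    rw [g2, zero_mul, sub_zero, mul_eq_zero, or_iff_left s5.ne'] at g3
    have hw : w = 0 := vec_ext g3 g2 g1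
    simp [hw]
  have h3 := Submodule.finrank_sup_add_finrank_inf_eq (LinearMap.range (rotationVector x))
    (gaugeKernel a b x)
  rw [hinf, finrank_bot, h2] at h3
  have h4 : Module.finrank ℝ (LinearMap.range (rotationVector x) ⊔ gaugeKernel a b x :
      Submodule ℝ (Fin n → Vec)) ≤ Module.finrank ℝ (tangentVectors x) :=
    Submodule.finrank_mono (sup_le (range_rotationVector_le hx.2) inf_le_left)
  omega

theorem exists_injectiveOn_of_finrank_le {V W : Type} [AddCommGroup V] [Module ℝ V]
    [FiniteDimensional ℝ V] [AddCommGroup W] [Module ℝ W] [FiniteDimensional ℝ W]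
    (K : Submodule ℝ V) (h : Module.finrank ℝ K ≤ Module.finrank ℝ W) :
    ∃ f : V →ₗ[ℝ] W, ∀ u ∈ K, f u = 0 → u = 0 := by
  have h' : Module.rank ℝ K ≤ Module.rank ℝ W := by
    rw [← Module.finrank_eq_rank, ← Module.finrank_eq_rank]; exact_mod_cast h
  obtain ⟨g, hg⟩ := rank_le_iff_exists_linearMap.1 h'
  obtain ⟨f, hf⟩ := LinearMap.exists_extend g
  refine ⟨f, fun u hu h0 => ?_⟩
  have : g ⟨u, hu⟩ = 0 := by rw [← hf]; exact h0
  exact congrArg Subtype.val ((injective_iff_map_eq_zero g).1 hg _ this)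

theorem exists_slice_coordinates (hn : 3 ≤ n) {ℓ : Fin n → ℝ} (hpos : ∀ j, 0 < ℓ j) {a b : Fin n}
    {x : Fin n → Vec} (hx : x ∈ closedPolygons ℓ) (hs : StandardPosition a b x) :
    ∃ P : (Fin n → Vec) →L[ℝ] Model n, ∀ u ∈ gaugeKernel a b x, P u = 0 → u = 0 := by
  obtain ⟨f, hf⟩ := exists_injectiveOn_of_finrank_le (W := Model n) (gaugeKernel a b x)
    (by simpa using finrank_gaugeKernel_le hn hpos hx hs)
  exact ⟨LinearMap.toContinuousLinearMap f, hf⟩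

/-- At a planar polygon one can choose the coordinates in such a way that the last half of them
vanishes exactly on the planar tuples. -/
theorem exists_planar_slice_coordinates (hn : 3 ≤ n) {ℓ : Fin n → ℝ} (hpos : ∀ j, 0 < ℓ j)
    {a b : Fin n} {x : Fin n → Vec} (hx : x ∈ closedPolygons ℓ) (hs : StandardPosition a b x)
    (hpl : ∀ i, x i 2 = 0) :
    ∃ P : (Fin n → Vec) →L[ℝ] Model n, (∀ u ∈ gaugeKernel a b x, P u = 0 → u = 0) ∧
      ∀ y : Fin n → Vec, y a 2 = 0 → y b 2 = 0 → ∑ i, y i = 0 →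
        ((∀ i, y i 2 = 0) ↔ ∀ i : Fin (2 * (n - 3)), n - 3 ≤ (i : ℕ) → P y i = 0) := by
  classical
  have hab : a ≠ b := by
    rintro rfl
    exact hs.mem_pairDomain (cross_self _)
  -- The heights of the vectors a and b vanish by the gauge and the height of a third vector c is
  -- forced by the closing condition. The other n - 3 heights are the planar coordinates.
  obtain ⟨c, hc⟩ : ∃ c, c ∉ ({a, b} : Finset (Fin n)) := by
    by_contra! h
    have h1 := Finset.card_le_card (fun i _ => h i : Finset.univ ⊆ ({a, b} : Finset (Fin n)))
    rw [Finset.card_univ, Fintype.card_fin] at h1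
    have := Finset.card_le_two (a := a) (b := b)
    omega
  simp only [Finset.mem_insert, Finset.mem_singleton, not_or] at hc
  obtain ⟨hca, hcb⟩ := hc
  let s : Finset (Fin n) := {a, b, c}
  have hs3 : s.card = 3 := Finset.card_eq_three.2 ⟨a, b, c, hab, Ne.symm hca, Ne.symm hcb, rfl⟩
  have hcard : Fintype.card {i // i ∉ s} = n - 3 := by
    rw [Fintype.card_subtype_compl, Fintype.card_fin, Fintype.card_coe, hs3]
  let ι : Fin (n - 3) ≃ {i // i ∉ s} := (Fintype.equivFinOfCardEq hcard).symm
  have hι : ∀ i ∉ s, ∃ j, (ι j : Fin n) = i := fun i hi => ⟨ι.symm ⟨i, hi⟩, by simp⟩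
  let Z : (Fin n → Vec) →ₗ[ℝ] (Fin (n - 3) → ℝ) :=
    LinearMap.pi fun j => (EuclideanSpace.proj (2 : Fin 3) : Vec →L[ℝ] ℝ).toLinearMap ∘ₗ
      LinearMap.proj (ι j : Fin n)
  have hZ : ∀ u j, Z u j = u (ι j) 2 := fun u j => rfl
  let K := gaugeKernel a b x
  -- At a planar polygon vertical velocities are orthogonal to all vectors, so arbitrary heights are
  -- realized by a tangent vector, the vector c compensating the sum.
  have hsurj : Function.Surjective (Z ∘ₗ K.subtype) := by
    intro z
    let e : Vec := !₂[0, 0, 1]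
    let w : Fin n → ℝ := fun i => if h : i ∉ s then z (ι.symm ⟨i, h⟩) else 0
    let u : Fin n → Vec := fun i => (w i - if i = c then ∑ j, w j else 0) • e
    have hu0 : ∀ i, u i 0 = 0 := fun i => by simp [u, e]
    have hu1 : ∀ i, u i 1 = 0 := fun i => by simp [u, e]
    have hu2 : ∀ i, u i 2 = w i - if i = c then ∑ j, w j else 0 := fun i => by simp [u, e]
    have hw : ∀ i ∈ s, w i = 0 := fun i hi => dif_neg (not_not.2 hi)
    refine ⟨⟨u, mem_tangentVectors.2 ⟨fun i => ?_, ?_⟩, ?_⟩, ?_⟩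
    · rw [inner_coord, hu0, hu1, hpl]; ring
    · simp only [u, ← Finset.sum_smul, Finset.sum_sub_distrib]
      simp
    · rw [SetLike.mem_coe, LinearMap.mem_ker, gauge_apply, hu1, hu2, hu2, hw a (by simp [s]),
        hw b (by simp [s]), if_neg (Ne.symm hca), if_neg (Ne.symm hcb)]
      simp
    · funext j
      have hj : (ι j : Fin n) ∉ s := (ι j).2
      have hjc : (ι j : Fin n) ≠ c := by rintro h; exact hj (by simp [s, h])
      change u (ι j) 2 = z j
      rw [hu2, if_neg hjc, sub_zero]
      simp only [w, dif_pos hj, Subtype.coe_eta, Equiv.symm_apply_apply]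
  have hrank := LinearMap.finrank_range_add_finrank_ker (Z ∘ₗ K.subtype)
  rw [LinearMap.range_eq_top.2 hsurj, finrank_top, Module.finrank_fin_fun] at hrank
  have hle : Module.finrank ℝ K ≤ 2 * (n - 3) := finrank_gaugeKernel_le hn hpos hx hs
  -- The n - 3 heights being independent on K, at most n - 3 dimensions remain. The map f below
  -- separates them and supplies the first half of the coordinates.
  have hker : Module.finrank ℝ (K ⊓ LinearMap.ker Z : Submodule ℝ (Fin n → Vec)) ≤ n - 3 := by
    have h1 : (LinearMap.ker (Z ∘ₗ K.subtype)).map K.subtype = K ⊓ LinearMap.ker Z := by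
      rw [LinearMap.ker_comp, Submodule.map_comap_subtype]
    rw [← h1, ← (Submodule.equivMapOfInjective K.subtype K.injective_subtype _).finrank_eq]
    omega
  obtain ⟨f, hf⟩ := exists_injectiveOn_of_finrank_le (W := Fin (n - 3) → ℝ)
    (K ⊓ LinearMap.ker Z) (by simpa using hker)
  let P : (Fin n → Vec) →ₗ[ℝ] Model n :=
    (WithLp.linearEquiv 2 ℝ (Fin (2 * (n - 3)) → ℝ)).symm.toLinearMap ∘ₗ
      LinearMap.pi fun i : Fin (2 * (n - 3)) =>
        if h : (i : ℕ) < n - 3 then LinearMap.proj (⟨i, h⟩ : Fin (n - 3)) ∘ₗ f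
        else LinearMap.proj (⟨i - (n - 3), by omega⟩ : Fin (n - 3)) ∘ₗ Z
  have hP1 : ∀ u (j : Fin (n - 3)), P u ⟨j, by omega⟩ = f u j := fun u j => by
    simp [P]
  have hP2 : ∀ u (j : Fin (n - 3)), P u ⟨n - 3 + j, by omega⟩ = Z u j := fun u j => by
    simp [P]
  refine ⟨LinearMap.toContinuousLinearMap P, fun u hu h0 => ?_, fun y ha hb hsum => ?_⟩
  · have h0' : P u = 0 := h0
    refine hf u ⟨hu, ?_⟩ ?_
    · rw [SetLike.mem_coe, LinearMap.mem_ker]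
      funext j; rw [← hP2, h0']; rfl
    · funext j; rw [← hP1, h0']; rfl
  · change _ ↔ ∀ i : Fin (2 * (n - 3)), n - 3 ≤ (i : ℕ) → P y i = 0
    constructor
    · intro h i hi
      have h1 := hP2 y ⟨i - (n - 3), by omega⟩
      rw [hZ, h] at h1
      convert h1
      simp; omega
    · intro h
      have h1 : ∀ i, i ≠ c → y i 2 = 0 := by
        intro i hic
        by_cases hi : i ∈ s
        · simp only [s, Finset.mem_insert, Finset.mem_singleton] at hi
          rcases hi with rfl | rfl | rfl
          · exact ha
          · exact hb
          · exact absurd rfl hic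
        · obtain ⟨j, rfl⟩ := hι i hi
          rw [← hZ, ← hP2]
          exact h _ (by simp)
      intro i
      by_cases hic : i = c
      · have h2 := congrArg (fun v : Vec => v 2) hsum
        simp only [WithLp.ofLp_sum, Finset.sum_apply] at h2
        rw [Finset.sum_eq_single c (fun i _ hi => h1 i hi) (by simp)] at h2
        rw [hic]; simpa using h2
      · exact h1 i hic

/-! ### Slices at the points of the smooth part -/

theorem polygonClass_eq_iff {ℓ : Fin n → ℝ} {x y : closedPolygons ℓ} :
    polygonClass x = polygonClass y ↔
      ∃ g : Vec ≃ₗᵢ[ℝ] Vec, IsRotation g ∧ ∀ i, y.1 i = g (x.1 i) :=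
  Quotient.eq (r := rotationSetoid ℓ)

/-- Collinearity is invariant under rotations, so it can be tested on any representative. -/
theorem polygonClass_notMem_singularSet {ℓ : Fin n → ℝ} {x : closedPolygons ℓ} :
    polygonClass x ∉ singularSet ℓ ↔ NonCollinear x.1 := by
  constructor
  · intro h hc
    exact h ⟨x, rfl, hc⟩
  · rintro h ⟨y, hy, hc⟩
    obtain ⟨g, -, hg⟩ := polygonClass_eq_iff.1 hy.symm
    have h1 := h.rotation g
    rw [show (fun i => g (x.1 i)) = y.1 from funext fun i => (hg i).symm] at h1
    exact h1 hc

/-- The class of a non-collinear closed polygon. -/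
def smoothClass {ℓ : Fin n → ℝ} (x : closedPolygons ℓ) (hx : NonCollinear x.1) : SmoothPart ℓ :=
  ⟨polygonClass x, polygonClass_notMem_singularSet.2 hx⟩

theorem exists_smoothClass_eq {ℓ : Fin n → ℝ} (p : SmoothPart ℓ) :
    ∃ (x : closedPolygons ℓ) (hx : NonCollinear x.1), smoothClass x hx = p := by
  obtain ⟨p, hp⟩ := p
  obtain ⟨x, rfl⟩ := Quotient.exists_rep p
  exact ⟨x, polygonClass_notMem_singularSet.1 hp, rfl⟩

/-- Every class in the smooth part contains a polygon in standard position. -/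
theorem exists_standardPosition {ℓ : Fin n → ℝ} (hpos : ∀ j, 0 < ℓ j) (y : closedPolygons ℓ)
    (hy : NonCollinear y.1) :
    ∃ (a b : Fin n) (x : closedPolygons ℓ), StandardPosition a b x.1 ∧
      polygonClass x = polygonClass y := by
  have h0 : ∀ i, y.1 i ≠ 0 := fun i => norm_pos_iff.1 (by rw [y.2.1]; exact hpos i)
  obtain ⟨a, b, hab⟩ := hy.exists_mem_pairDomain h0
  obtain ⟨g, hg, h⟩ := exists_rotation_normalize hab
  refine ⟨a, b, ⟨normalize a b y.1, fun i => ?_, ?_⟩, standardPosition_normalize hab, ?_⟩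
  · rw [h, LinearIsometryEquiv.norm_map, y.2.1]
  · simp only [h]
    rw [← map_sum, y.2.2, map_zero]
  · exact (polygonClass_eq_iff.2 ⟨g, hg, h⟩).symm

theorem exists_slice_at (hn : 3 ≤ n) {ℓ : Fin n → ℝ} (hpos : ∀ j, 0 < ℓ j) (p : SmoothPart ℓ) :
    ∃ S : Slice ℓ, ∃ x : closedPolygons ℓ, x.1 ∈ S.dom ∧ polygonClass x = p.1 := by
  obtain ⟨y, hy, rfl⟩ := exists_smoothClass_eq p
  obtain ⟨a, b, x, hs, hxy⟩ := exists_standardPosition hpos y hy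
  obtain ⟨P, hP⟩ := exists_slice_coordinates hn hpos x.2 hs
  obtain ⟨S, hS, -⟩ := exists_slice hn hpos x.2 hs P hP
  exact ⟨S, x, hS, hxy⟩

end

section

variable {n : ℕ} {ℓ : Fin n → ℝ}

/-! ### Charts of the smooth part -/

namespace Slice

variable (S : Slice ℓ)

/-- The point of the smooth part with given slice coordinates. -/
def toPoint (v : Model n) : SmoothPart ℓ :=
  smoothClass ⟨S.sec v, S.sec_mem v⟩ (S.nonCollinear _ (S.sec_dom v))

/-- The slice coordinates of a class of polygons. -/
def coord (p : PolygonSpace ℓ) : Model n := S.proj p.out.1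

/-- Coordinates of a class are defined through the chosen representative `Quotient.out`. This lemma
replaces it by any other one. -/
theorem out_rotation (x : closedPolygons ℓ) :
    ∃ g : Vec ≃ₗᵢ[ℝ] Vec, IsRotation g ∧ (polygonClass x).out.1 = fun i => g (x.1 i) := by
  obtain ⟨g, hg, h⟩ := polygonClass_eq_iff.1
    (show polygonClass x = polygonClass (polygonClass x).out from (Quotient.out_eq _).symm)
  exact ⟨g, hg, funext h⟩

theorem dom_rotation_iff {g : Vec ≃ₗᵢ[ℝ] Vec} (hg : IsRotation g) (y : Fin n → Vec) :
    (fun i => g (y i)) ∈ S.dom ↔ y ∈ S.dom := by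
  refine ⟨fun h => ?_, S.dom_rotation g hg y⟩
  simpa using S.dom_rotation g.symm hg.symm _ h

theorem out_mem_dom (x : closedPolygons ℓ) : (polygonClass x).out.1 ∈ S.dom ↔ x.1 ∈ S.dom := by
  obtain ⟨g, hg, h⟩ := out_rotation x
  rw [h, S.dom_rotation_iff hg]

theorem coord_polygonClass (x : closedPolygons ℓ) (hx : x.1 ∈ S.dom) :
    S.coord (polygonClass x) = S.proj x.1 := by
  obtain ⟨g, hg, h⟩ := out_rotation x
  rw [coord, h, S.proj_rotation g hg _ hx]

theorem polygonClass_sec_proj (x : closedPolygons ℓ) (hx : x.1 ∈ S.dom) :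
    (S.toPoint (S.proj x.1)).1 = polygonClass x := by
  obtain ⟨g, hg, h⟩ := S.sec_proj x.1 hx x.2
  exact (polygonClass_eq_iff.2 ⟨g, hg, h⟩).symm

theorem isQuotientMap_polygonClass :
    Topology.IsQuotientMap (polygonClass : closedPolygons ℓ → PolygonSpace ℓ) :=
  @isQuotientMap_quotient_mk' _ _ (rotationSetoid ℓ)

theorem isOpen_saturation : IsOpen {p : PolygonSpace ℓ | p.out.1 ∈ S.dom} := by
  rw [← isQuotientMap_polygonClass.isOpen_preimage]
  have h : (polygonClass : closedPolygons ℓ → PolygonSpace ℓ) ⁻¹' {p | p.out.1 ∈ S.dom} =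
      Subtype.val ⁻¹' S.dom := Set.ext fun x => S.out_mem_dom x
  rw [h]
  exact S.isOpen_dom.preimage continuous_subtype_val

theorem continuousOn_coord : ContinuousOn S.coord {p : PolygonSpace ℓ | p.out.1 ∈ S.dom} := by
  rw [isQuotientMap_polygonClass.continuousOn_isOpen_iff S.isOpen_saturation]
  have h : ContinuousOn (fun x : closedPolygons ℓ => S.proj x.1) (Subtype.val ⁻¹' S.dom) :=
    S.contDiffOn_proj.continuousOn.comp continuous_subtype_val.continuousOn fun x hx => hx
  have h' : (polygonClass : closedPolygons ℓ → PolygonSpace ℓ) ⁻¹' {p | p.out.1 ∈ S.dom} =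
      Subtype.val ⁻¹' S.dom := Set.ext fun x => S.out_mem_dom x
  rw [h']
  exact h.congr fun x hx => S.coord_polygonClass x hx

theorem continuousOn_toPoint : ContinuousOn S.toPoint S.tgt := by
  rw [continuousOn_iff_continuous_domRestrict]
  refine Continuous.subtype_mk (isQuotientMap_polygonClass.continuous.comp (Continuous.subtype_mk ?_ _)) _
  exact continuousOn_iff_continuous_domRestrict.1 S.contDiffOn_sec.continuousOn

/-- The chart given by a slice. -/
def chart : OpenPartialHomeomorph (SmoothPart ℓ) (Model n) where
  toFun p := S.coord p.1
  invFun := S.toPoint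
  source := {p | p.1.out.1 ∈ S.dom}
  target := S.tgt
  map_source' p hp := S.proj_mem _ hp p.1.out.2
  map_target' v _ := (S.out_mem_dom _).2 (S.sec_dom v)
  left_inv' p hp := Subtype.ext <|
    (S.polygonClass_sec_proj p.1.out hp).trans (Quotient.out_eq _)
  right_inv' v hv := (S.coord_polygonClass _ (S.sec_dom v)).trans (S.proj_sec v hv)
  open_source := S.isOpen_saturation.preimage continuous_subtype_val
  open_target := S.isOpen_tgt
  continuousOn_toFun := S.continuousOn_coord.comp continuous_subtype_val.continuousOn fun _ hp => hp
  continuousOn_invFun := S.continuousOn_toPoint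

theorem mem_chart_source {p : SmoothPart ℓ} {x : closedPolygons ℓ} (h : polygonClass x = p.1) :
    p ∈ S.chart.source ↔ x.1 ∈ S.dom := by
  rw [← S.out_mem_dom, h]; rfl

theorem chart_smoothClass (x : closedPolygons ℓ) (hx : NonCollinear x.1) (hd : x.1 ∈ S.dom) :
    S.chart (smoothClass x hx) = S.proj x.1 := S.coord_polygonClass x hd

theorem toPoint_mem_source (v : Model n) (S' : Slice ℓ) :
    S.toPoint v ∈ S'.chart.source ↔ S.sec v ∈ S'.dom := S'.out_mem_dom _

theorem chart_toPoint {v : Model n} {S' : Slice ℓ} (h : S.sec v ∈ S'.dom) :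
    S'.chart (S.toPoint v) = S'.proj (S.sec v) := S'.coord_polygonClass _ h

end Slice

/-! ### The smooth structure -/

section Manifold

variable [hn : Fact (3 ≤ n)] [hpos : Fact (∀ j, 0 < ℓ j)]

/-- A slice at a point of the smooth part. -/
def sliceAt (p : SmoothPart ℓ) : Slice ℓ := (exists_slice_at hn.1 hpos.1 p).choose

theorem mem_sliceAt_source (p : SmoothPart ℓ) : p ∈ (sliceAt p).chart.source := by
  obtain ⟨x, hx, h⟩ := (exists_slice_at hn.1 hpos.1 p).choose_spec
  exact ((sliceAt p).mem_chart_source h).2 hx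

instance instChartedSpaceSmoothPart : ChartedSpace (Model n) (SmoothPart ℓ) where
  atlas := Set.range Slice.chart
  chartAt p := (sliceAt p).chart
  mem_chart_source := mem_sliceAt_source
  chart_mem_atlas _ := ⟨_, rfl⟩

theorem chartAt_eq (p : SmoothPart ℓ) : chartAt (Model n) p = (sliceAt p).chart := rfl

/-- A change of charts is the projection of one slice after the section of the other, defined where
the section meets the other domain. -/
instance instIsManifoldSmoothPart : IsManifold 𝓘(ℝ, Model n) ∞ (SmoothPart ℓ) := by
  refine isManifold_of_contDiffOn _ _ _ ?_
  rintro _ _ ⟨S, rfl⟩ ⟨S', rfl⟩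
  simp only [modelWithCornersSelf_coe, modelWithCornersSelf_coe_symm, Function.id_comp,
    Function.comp_id, Set.preimage_id, Set.range_id, Set.inter_univ]
  have h1 : (S.chart.symm.trans S'.chart).source = S.tgt ∩ S.sec ⁻¹' S'.dom := by
    rw [OpenPartialHomeomorph.trans_source]
    exact Set.ext fun v => and_congr_right fun _ => S.toPoint_mem_source v S'
  rw [h1]
  refine ((S'.contDiffOn_proj.comp (S.contDiffOn_sec.mono Set.inter_subset_left)
    fun v hv => hv.2).congr fun v hv => ?_)
  exact S.chart_toPoint hv.2

theorem Slice.chart_mem_maximalAtlas (S : Slice ℓ) :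
    S.chart ∈ IsManifold.maximalAtlas 𝓘(ℝ, Model n) ∞ (SmoothPart ℓ) :=
  IsManifold.subset_maximalAtlas ⟨S, rfl⟩

end Manifold

end

section

variable {n : ℕ} {ℓ : Fin n → ℝ}

/-! ### The derivative of a rotation-invariant function along an infinitesimal rotation -/

/-- The rotation of a vector by an angle `-t` around the first axis. -/
def axisRotation (t : ℝ) (v : Vec) : Vec :=
  !₂[v 0, Real.cos t * v 1 + Real.sin t * v 2, -Real.sin t * v 1 + Real.cos t * v 2]

theorem exists_rotation_axisRotation (t : ℝ) :
    ∃ g : Vec ≃ₗᵢ[ℝ] Vec, IsRotation g ∧ ∀ v, g v = axisRotation t v := by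
  let f : Fin 3 → Vec :=
    ![!₂[1, 0, 0], !₂[0, Real.cos t, Real.sin t], !₂[0, -Real.sin t, Real.cos t]]
  have h1 := Real.sin_sq_add_cos_sq t
  have hf : Orthonormal ℝ f := by
    rw [orthonormal_iff_ite]
    intro i j
    fin_cases i <;> fin_cases j <;>
      simp [-inner_self_eq_norm_sq_to_K, f, inner_coord] <;> linarith
  have hd : triple (f 0) (f 1) (f 2) = 1 := by
    simp [f, triple_coord]; linarith
  obtain ⟨g, hg, h⟩ := exists_rotation_of_frame hf hd
  refine ⟨g, hg, fun v => ?_⟩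
  rw [h]
  apply vec_ext <;> simp [f, inner_coord, axisRotation]

theorem hasDerivAt_axisRotation (v : Vec) :
    HasDerivAt (fun t => axisRotation t v) (-cross !₂[1, 0, 0] v) 0 := by
  have h := (((Real.hasDerivAt_cos 0).smul_const (!₂[0, v 1, v 2] : Vec)).fun_add
    ((Real.hasDerivAt_sin 0).smul_const (!₂[0, v 2, -v 1] : Vec))).const_add (!₂[v 0, 0, 0] : Vec)
  have h1 : (fun t => (!₂[v 0, 0, 0] : Vec) + (Real.cos t • (!₂[0, v 1, v 2] : Vec) +
      Real.sin t • (!₂[0, v 2, -v 1] : Vec))) = fun t => axisRotation t v := by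
    funext t
    apply vec_ext <;> (simp [axisRotation]; try ring)
  rw [h1] at h
  have h2 : -cross !₂[1, 0, 0] v = -Real.sin 0 • (!₂[0, v 1, v 2] : Vec) +
      Real.cos 0 • (!₂[0, v 2, -v 1] : Vec) := by
    apply vec_ext <;> simp
  rw [h2]
  exact h

theorem axisRotation_zero (v : Vec) : axisRotation 0 v = v := by
  apply vec_ext <;> simp [axisRotation]

/-- The action of a linear isometry on tuples of vectors. -/
def tupleMap (n : ℕ) (g : Vec ≃ₗᵢ[ℝ] Vec) : (Fin n → Vec) →L[ℝ] (Fin n → Vec) :=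
  ContinuousLinearMap.pi fun i => (g.toContinuousLinearEquiv : Vec →L[ℝ] Vec) ∘L
    ContinuousLinearMap.proj i

@[simp] theorem tupleMap_apply (g : Vec ≃ₗᵢ[ℝ] Vec) (y : Fin n → Vec) :
    tupleMap n g y = fun i => g (y i) := rfl

section Invariant

variable {V : Type*} [NormedAddCommGroup V] [NormedSpace ℝ V] {f : (Fin n → Vec) → V}
  {U : Set (Fin n → Vec)}

/-- Differentiate the invariance of f along the linear map `tupleMap n g`. -/
theorem fderiv_rotation (hU : IsOpen U) (hf : DifferentiableOn ℝ f U)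
    (hinv : ∀ g : Vec ≃ₗᵢ[ℝ] Vec, IsRotation g → ∀ y ∈ U,
      (fun i => g (y i)) ∈ U ∧ f (fun i => g (y i)) = f y)
    {g : Vec ≃ₗᵢ[ℝ] Vec} (hg : IsRotation g) {y : Fin n → Vec} (hy : y ∈ U) (u : Fin n → Vec) :
    fderiv ℝ f (fun i => g (y i)) (fun i => g (u i)) = fderiv ℝ f y u := by
  have h1 : HasFDerivAt f (fderiv ℝ f (fun i => g (y i))) (tupleMap n g y) :=
    (hf.differentiableAt (hU.mem_nhds (hinv g hg y hy).1)).hasFDerivAt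
  have h2 := h1.comp y (tupleMap n g).hasFDerivAt
  have h3 : f ∘ tupleMap n g =ᶠ[𝓝 y] f := by
    filter_upwards [hU.mem_nhds hy] with z hz using (hinv g hg z hz).2
  have h4 := (h2.congr_of_eventuallyEq h3.symm).fderiv
  rw [h4]; rfl

/-- f is constant along the rotations about an axis. For the first axis this is differentiated
explicitly, and any other axis is conjugated to it. -/
theorem fderiv_rotationVector (hU : IsOpen U) (hf : DifferentiableOn ℝ f U)
    (hinv : ∀ g : Vec ≃ₗᵢ[ℝ] Vec, IsRotation g → ∀ y ∈ U,
      (fun i => g (y i)) ∈ U ∧ f (fun i => g (y i)) = f y)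
    {y : Fin n → Vec} (hy : y ∈ U) (w : Vec) : fderiv ℝ f y (rotationVector y w) = 0 := by
  have key : ∀ z ∈ U, fderiv ℝ f z (rotationVector z !₂[1, 0, 0]) = 0 := by
    intro z hz
    have h1 : HasDerivAt (fun t => fun i => axisRotation t (z i))
        (fun i => -cross !₂[1, 0, 0] (z i)) 0 :=
      hasDerivAt_pi.2 fun i => hasDerivAt_axisRotation (z i)
    have h2 : (fun i => axisRotation 0 (z i)) = z := funext fun i => axisRotation_zero (z i)
    have h3 : HasFDerivAt f (fderiv ℝ f z) (fun i => axisRotation 0 (z i)) := by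
      rw [h2]; exact (hf.differentiableAt (hU.mem_nhds hz)).hasFDerivAt
    have h4 := h3.comp_hasDerivAt 0 h1
    have h5 : (f ∘ fun t => fun i => axisRotation t (z i)) = fun _ => f z := by
      funext t
      obtain ⟨g, hg, h⟩ := exists_rotation_axisRotation t
      simp only [Function.comp_apply, ← h]
      exact (hinv g hg z hz).2
    rw [h5] at h4
    have h6 := h4.unique (hasDerivAt_const 0 (f z))
    rw [show (fun i => -cross !₂[1, 0, 0] (z i)) = -rotationVector z !₂[1, 0, 0] from rfl,
      map_neg, neg_eq_zero] at h6
    exact h6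
  -- If some y i is not parallel to w, the frame of w and y i gives a rotation carrying w to a
  -- multiple of the first basis vector. Otherwise the infinitesimal rotation vanishes.
  by_cases hq : ∃ i, cross w (y i) ≠ 0
  · obtain ⟨i, hi⟩ := hq
    obtain ⟨g, hg, h⟩ := exists_rotation_of_frame (frame_spec hi).1 (frame_spec hi).2
    have ho := (orthonormal_iff_ite.1 (frame_spec hi).1)
    have hw : w = ‖w‖ • frame w (y i) 0 := by
      rw [frame, Matrix.cons_val_zero, smul_smul,
        mul_inv_cancel₀ (norm_ne_zero_iff.2 (cross_ne_zero_left hi)), one_smul]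
    have hgw : g w = ‖w‖ • !₂[1, 0, 0] := by
      nth_rw 1 [hw]
      rw [map_smul, h, ho, ho, ho]
      simp
    rw [← fderiv_rotation hU hf hinv hg hy]
    have h1 : (fun j => g (rotationVector y w j)) =
        ‖w‖ • rotationVector (fun j => g (y j)) !₂[1, 0, 0] := by
      funext j
      rw [rotationVector_apply, ← cross_rotation hg, hgw, smul_cross]; rfl
    rw [h1, map_smul, key _ (hinv g hg y hy).1, smul_zero]
  · push Not at hq
    rw [show rotationVector y w = 0 from funext hq, map_zero]

end Invariant

/-! ### Derivatives of sections and projections -/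

namespace Slice

variable (S : Slice ℓ)

theorem differentiableAt_sec {v : Model n} (hv : v ∈ S.tgt) : DifferentiableAt ℝ S.sec v :=
  (S.contDiffOn_sec.differentiableOn (by simp)).differentiableAt (S.isOpen_tgt.mem_nhds hv)

theorem differentiableAt_proj {y : Fin n → Vec} (hy : y ∈ S.dom) : DifferentiableAt ℝ S.proj y :=
  (S.contDiffOn_proj.differentiableOn (by simp)).differentiableAt (S.isOpen_dom.mem_nhds hy)

/-- The derivative of the section is tangent to the space of closed polygons. -/
theorem isTangent_fderiv_sec {v : Model n} (hv : v ∈ S.tgt) (u : Model n) :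
    IsTangent (S.sec v) (fderiv ℝ S.sec v u) := by
  have h := (S.differentiableAt_sec hv).hasFDerivAt
  have hi := hasFDerivAt_pi'.1 h
  refine ⟨fun i => ?_, ?_⟩
  · have h1 := (hi i).inner ℝ (hi i)
    have h2 : (fun w => inner ℝ (S.sec w i) (S.sec w i)) = fun _ => ℓ i ^ 2 := by
      funext w
      rw [real_inner_self_eq_norm_sq, (S.sec_mem w).1]
    rw [h2] at h1
    have h3 := congrArg (fun A => A u) (h1.unique (hasFDerivAt_const _ _))
    simp only [ContinuousLinearMap.coe_comp, Function.comp_apply, ContinuousLinearMap.prod_apply,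
      fderivInnerCLM_apply, ContinuousLinearMap.proj_apply, zero_apply] at h3
    rw [real_inner_comm (S.sec v i)] at h3
    linarith
  · have h1 := HasFDerivAt.fun_sum (u := Finset.univ) fun i _ => hi i
    have h2 : (fun w => ∑ i, S.sec w i) = fun _ => 0 := funext fun w => (S.sec_mem w).2
    rw [h2] at h1
    have h3 := congrArg (fun A => A u) (h1.unique (hasFDerivAt_const _ _))
    simpa using h3

theorem fderiv_proj_fderiv_sec {v : Model n} (hv : v ∈ S.tgt) (u : Model n) :
    fderiv ℝ S.proj (S.sec v) (fderiv ℝ S.sec v u) = u := by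
  have h := (S.differentiableAt_proj (S.sec_dom v)).hasFDerivAt.comp v
    (S.differentiableAt_sec hv).hasFDerivAt
  have h1 : S.proj ∘ S.sec =ᶠ[𝓝 v] id := by
    filter_upwards [S.isOpen_tgt.mem_nhds hv] with w hw using S.proj_sec w hw
  have h2 := (h.congr_of_eventuallyEq h1.symm).unique (hasFDerivAt_id v)
  exact congrArg (fun A => A u) h2

theorem rotation_invariance (g : Vec ≃ₗᵢ[ℝ] Vec) (hg : IsRotation g) (y : Fin n → Vec)
    (hy : y ∈ S.dom) : (fun i => g (y i)) ∈ S.dom ∧ S.proj (fun i => g (y i)) = S.proj y :=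
  ⟨S.dom_rotation g hg y hy, S.proj_rotation g hg y hy⟩

theorem fderiv_proj_rotation {g : Vec ≃ₗᵢ[ℝ] Vec} (hg : IsRotation g) {y : Fin n → Vec}
    (hy : y ∈ S.dom) (u : Fin n → Vec) :
    fderiv ℝ S.proj (fun i => g (y i)) (fun i => g (u i)) = fderiv ℝ S.proj y u :=
  fderiv_rotation S.isOpen_dom (S.contDiffOn_proj.differentiableOn (by simp))
    S.rotation_invariance hg hy u

theorem fderiv_proj_rotationVector {y : Fin n → Vec} (hy : y ∈ S.dom) (w : Vec) :
    fderiv ℝ S.proj y (rotationVector y w) = 0 :=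
  fderiv_rotationVector S.isOpen_dom (S.contDiffOn_proj.differentiableOn (by simp))
    S.rotation_invariance hy w

/-- The tangent vectors on which the derivative of the projection vanishes are the infinitesimal
rotations. -/
theorem exists_rotationVector_of_fderiv_proj_eq_zero (hn : 3 ≤ n) (hpos : ∀ j, 0 < ℓ j)
    {v : Model n} (hv : v ∈ S.tgt) {u : Fin n → Vec} (hu : IsTangent (S.sec v) u)
    (h : fderiv ℝ S.proj (S.sec v) u = 0) : ∃ w, u = rotationVector (S.sec v) w := by
  set x := S.sec v with hx
  have hxc : x ∈ closedPolygons ℓ := S.sec_mem v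
  have hnc : NonCollinear x := S.nonCollinear _ (S.sec_dom v)
  have h0 : ∀ i, x i ≠ 0 := fun i => norm_pos_iff.1 (by rw [hxc.1]; exact hpos i)
  let D : (Fin n → Vec) →ₗ[ℝ] Model n := (fderiv ℝ S.proj x).toLinearMap
  let K := tangentVectors x
  have hsurj : Function.Surjective (D ∘ₗ K.subtype) := fun z =>
    ⟨⟨fderiv ℝ S.sec v z, mem_tangentVectors.2 (S.isTangent_fderiv_sec hv z)⟩,
      S.fderiv_proj_fderiv_sec hv z⟩
  have hrank := LinearMap.finrank_range_add_finrank_ker (D ∘ₗ K.subtype)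
  rw [LinearMap.range_eq_top.2 hsurj, finrank_top, finrank_euclideanSpace_fin] at hrank
  have hT : Module.finrank ℝ K + (n + 3) = 3 * n := finrank_tangentVectors hnc h0
  -- The projection is onto from a space of dimension 2n - 3 to one of dimension 2(n - 3). Its
  -- kernel has dimension 3, which the rotations already fill.
  have hker : LinearMap.range (rotationVector x) = K ⊓ LinearMap.ker D := by
    refine Submodule.eq_of_le_of_finrank_le (le_inf (range_rotationVector_le hxc.2) ?_) ?_
    · rintro _ ⟨w, rfl⟩
      exact S.fderiv_proj_rotationVector (S.sec_dom v) w
    · rw [finrank_range_rotationVector hnc, ← Submodule.map_comap_subtype, ← LinearMap.ker_comp,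
        ← (Submodule.equivMapOfInjective K.subtype K.injective_subtype _).finrank_eq]
      omega
  have hmem : u ∈ K ⊓ LinearMap.ker D := ⟨mem_tangentVectors.2 hu, h⟩
  rw [← hker] at hmem
  obtain ⟨w, hw⟩ := hmem
  exact ⟨w, hw.symm⟩

/-- The derivative of the section composed with the projection is the rotation to the slice, up to
infinitesimal rotations. -/
theorem fderiv_sec_fderiv_proj (hn : 3 ≤ n) (hpos : ∀ j, 0 < ℓ j) {x : Fin n → Vec}
    (hx : x ∈ S.dom) (hxc : x ∈ closedPolygons ℓ) :
    ∃ g : Vec ≃ₗᵢ[ℝ] Vec, IsRotation g ∧ S.sec (S.proj x) = (fun i => g (x i)) ∧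
      ∀ u, IsTangent x u → ∃ w, fderiv ℝ S.sec (S.proj x) (fderiv ℝ S.proj x u) =
        (fun i => g (u i)) + rotationVector (S.sec (S.proj x)) w := by
  obtain ⟨g, hg, h⟩ := S.sec_proj x hx hxc
  have hv := S.proj_mem x hx hxc
  have hgx : S.sec (S.proj x) = fun i => g (x i) := funext h
  refine ⟨g, hg, hgx, fun u hu => ?_⟩
  have hgu : IsTangent (S.sec (S.proj x)) (fun i => g (u i)) := by
    rw [hgx]
    exact ⟨fun i => by rw [LinearIsometryEquiv.inner_map_map]; exact hu.1 i,
      by rw [← map_sum, hu.2, map_zero]⟩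
  have ht : IsTangent (S.sec (S.proj x))
      (fderiv ℝ S.sec (S.proj x) (fderiv ℝ S.proj x u) - fun i => g (u i)) :=
    mem_tangentVectors.1 (sub_mem (mem_tangentVectors.2 (S.isTangent_fderiv_sec hv _))
      (mem_tangentVectors.2 hgu))
  obtain ⟨w, hw⟩ := S.exists_rotationVector_of_fderiv_proj_eq_zero hn hpos hv ht (by
    rw [map_sub, S.fderiv_proj_fderiv_sec hv, hgx, S.fderiv_proj_rotation hg hx, sub_self])
  exact ⟨w, sub_eq_iff_eq_add'.1 hw⟩

/-- The pullback of the product form by the section is compatible with the projection. -/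
theorem orbitForm_fderiv_sec_proj (hn : 3 ≤ n) (hpos : ∀ j, 0 < ℓ j) {x : Fin n → Vec}
    (hx : x ∈ S.dom) (hxc : x ∈ closedPolygons ℓ) {u v : Fin n → Vec} (hu : IsTangent x u)
    (hv : IsTangent x v) :
    orbitForm ℓ (S.sec (S.proj x)) (fderiv ℝ S.sec (S.proj x) (fderiv ℝ S.proj x u))
      (fderiv ℝ S.sec (S.proj x) (fderiv ℝ S.proj x v)) = orbitForm ℓ x u v := by
  obtain ⟨g, hg, hgx, h⟩ := S.fderiv_sec_fderiv_proj hn hpos hx hxc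
  obtain ⟨w, hw⟩ := h u hu
  obtain ⟨z, hz⟩ := h v hv
  have ht : ∀ u, IsTangent x u → IsTangent (S.sec (S.proj x)) (fun i => g (u i)) := by
    intro u hu
    rw [hgx]
    exact ⟨fun i => by rw [LinearIsometryEquiv.inner_map_map]; exact hu.1 i,
      by rw [← map_sum, hu.2, map_zero]⟩
  rw [hw, hz, orbitForm_add_rotationVector hpos (S.sec_mem _).1 (S.sec_mem _).2 (ht u hu)
    (ht v hv), hgx, orbitForm_rotation hg]

end Slice

end

section

variable {n : ℕ} {ℓ : Fin n → ℝ}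

/-! ### Two-forms -/

section TwoForms

variable (V : Type*) [NormedAddCommGroup V] [NormedSpace ℝ V]

/-- The alternating form `(u, v) ↦ (B u v - B v u) / 2` obtained from a bilinear form. -/
def alternate : (V →L[ℝ] V →L[ℝ] ℝ) →L[ℝ] V [⋀^Fin 2]→L[ℝ] ℝ :=
  (1 / 2 : ℝ) • (ContinuousAlternatingMap.alternatizeUncurryFinCLM (n := 1) ℝ V ℝ ∘L
    ContinuousLinearMap.compL ℝ V (V →L[ℝ] ℝ) (V [⋀^Fin 1]→L[ℝ] ℝ)
      ((ContinuousAlternatingMap.ofSubsingletonLIE (𝕜 := ℝ) (E := V) (F := ℝ) (0 : Fin 1)).toContinuousLinearEquiv :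
        (V →L[ℝ] ℝ) →L[ℝ] V [⋀^Fin 1]→L[ℝ] ℝ))

theorem alternate_apply (B : V →L[ℝ] V →L[ℝ] ℝ) (w : Fin 2 → V) :
    alternate V B w = (B (w 0) (w 1) - B (w 1) (w 0)) / 2 := by
  simp [alternate, ContinuousAlternatingMap.alternatizeUncurryFin_apply, Fin.sum_univ_two,
    Fin.removeNth]
  ring

end TwoForms

/-- The product form as a bilinear form. -/
def orbitBilin (ℓ : Fin n → ℝ) (x : Fin n → Vec) : (Fin n → Vec) →L[ℝ] (Fin n → Vec) →L[ℝ] ℝ :=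
  (LinearMap.mk₂ ℝ (orbitForm ℓ x) (orbitForm_add_left ℓ x)
    (fun c u v => by
      simp only [orbitForm_eq_sum, Pi.smul_apply, cross_smul, smul_eq_mul, Finset.mul_sum,
        real_inner_smul_left]
      exact Finset.sum_congr rfl fun i _ => by ring)
    (orbitForm_add_right ℓ x)
    (fun c u v => by
      simp only [orbitForm_eq_sum, Pi.smul_apply, smul_eq_mul, Finset.mul_sum,
        real_inner_smul_right])).toContinuousBilinearMap

theorem orbitBilin_apply (ℓ : Fin n → ℝ) (x u v : Fin n → Vec) :
    orbitBilin ℓ x u v = orbitForm ℓ x u v := rfl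

/-- The product form as a differential 2-form. -/
def orbitTwoForm (ℓ : Fin n → ℝ) (x : Fin n → Vec) : (Fin n → Vec) [⋀^Fin 2]→L[ℝ] ℝ :=
  alternate _ (orbitBilin ℓ x)

theorem orbitTwoForm_apply (ℓ : Fin n → ℝ) (x : Fin n → Vec) (w : Fin 2 → Fin n → Vec) :
    orbitTwoForm ℓ x w = orbitForm ℓ x (w 0) (w 1) := by
  rw [orbitTwoForm, alternate_apply, orbitBilin_apply, orbitBilin_apply,
    orbitForm_swap ℓ x (w 1) (w 0)]
  ring

/-- The product form as a linear function of the tuple of vectors. -/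
def orbitFormLinear (ℓ : Fin n → ℝ) (u v : Fin n → Vec) : (Fin n → Vec) →L[ℝ] ℝ :=
  ∑ i, (-(1 / (2 * ℓ i ^ 2))) • innerSL ℝ (cross (u i) (v i)) ∘L ContinuousLinearMap.proj i

theorem orbitFormLinear_apply (ℓ : Fin n → ℝ) (u v x : Fin n → Vec) :
    orbitFormLinear ℓ u v x = orbitForm ℓ x u v := by
  simp only [orbitFormLinear, orbitForm, sum_apply,
    smul_apply, ContinuousLinearMap.coe_comp, Function.comp_apply,
    ContinuousLinearMap.proj_apply, innerSL_apply_apply, smul_eq_mul]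
  refine Finset.sum_congr rfl fun i _ => ?_
  rw [triple_eq_inner_cross, real_inner_comm]
  ring

theorem contDiffOn_orbitForm {E : Type*} [NormedAddCommGroup E] [NormedSpace ℝ E] {s : Set E}
    {m : WithTop ℕ∞} {x u v : E → Fin n → Vec} (hx : ContDiffOn ℝ m x s)
    (hu : ContDiffOn ℝ m u s) (hv : ContDiffOn ℝ m v s) :
    ContDiffOn ℝ m (fun y => orbitForm ℓ (x y) (u y) (v y)) s := by
  have hx' := fun i => contDiffOn_pi.1 hx i
  have hu' := fun i => contDiffOn_pi.1 hu i
  have hv' := fun i => contDiffOn_pi.1 hv i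
  simp only [orbitForm_eq_sum, real_inner_smul_left]
  exact ContDiffOn.sum fun i _ =>
    contDiffOn_const.mul ((ContDiffOn.cross (hx' i) (hu' i)).inner ℝ (hv' i))

theorem contDiff_orbitTwoForm : ContDiff ℝ ∞ (orbitTwoForm ℓ) := by
  have h : ContDiff ℝ ∞ (orbitBilin ℓ) := by
    refine contDiff_clm_apply_iff.2 fun u => contDiff_clm_apply_iff.2 fun v => ?_
    exact contDiffOn_univ.1
      (contDiffOn_orbitForm contDiffOn_id contDiffOn_const contDiffOn_const)
  exact (alternate _).contDiff.comp h

/-- Used twice: for the closedness of the form, where p is a point of a sphere, and for planar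
polygons, where p is the normal of the plane. -/
theorem triple_eq_zero_of_orthogonal {p u v w : Vec} (hp : p ≠ 0) (hu : inner ℝ p u = 0)
    (hv : inner ℝ p v = 0) (hw : inner ℝ p w = 0) : triple u v w = 0 := by
  have h : triple u v w • p =
      inner ℝ p u • cross v w + inner ℝ p v • cross w u + inner ℝ p w • cross u v := by
    apply vec_ext <;> simp [triple_coord, inner_coord] <;> ring
  rw [hu, hv, hw] at h
  simpa [hp] using h

/-- The exterior derivative of the product form vanishes on tangent vectors. -/
theorem extDeriv_orbitTwoForm {x : Fin n → Vec} (hx : ∀ i, x i ≠ 0) (w : Fin 3 → Fin n → Vec)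
    (hw : ∀ k, IsTangent x (w k)) : extDeriv (orbitTwoForm ℓ) x w = 0 := by
  have hd : DifferentiableAt ℝ (orbitTwoForm ℓ) x :=
    (contDiff_orbitTwoForm.differentiable (by simp)) x
  rw [extDeriv_apply hd]
  refine Finset.sum_eq_zero fun k _ => ?_
  -- With constant arguments the form is linear in the base point. Its derivative in the direction w
  -- k is thus a sum of triple products of three vectors tangent to the same sphere at x i.
  have h1 : (fun y => orbitTwoForm ℓ y (k.removeNth w)) =
      orbitFormLinear ℓ (k.removeNth w 0) (k.removeNth w 1) := by
    funext y
    rw [orbitTwoForm_apply, orbitFormLinear_apply]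
  rw [h1, ContinuousLinearMap.fderiv, orbitFormLinear_apply, orbitForm,
    Finset.sum_eq_zero, smul_zero]
  intro i _
  have h : triple (w k i) (k.removeNth w 0 i) (k.removeNth w 1 i) = 0 :=
    triple_eq_zero_of_orthogonal (hx i) ((hw k).1 i) ((hw _).1 i) ((hw _).1 i)
  rw [h]
  simp

/-! ### The symplectic form of the smooth part -/

namespace Slice

variable (S : Slice ℓ)

/-- The pullback of the product form by the section of a slice. -/
def form (v : Model n) : Model n [⋀^Fin 2]→L[ℝ] ℝ :=
  (orbitTwoForm ℓ (S.sec v)).compContinuousLinearMap (fderiv ℝ S.sec v)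

theorem form_apply (v : Model n) (w : Fin 2 → Model n) :
    S.form v w = orbitForm ℓ (S.sec v) (fderiv ℝ S.sec v (w 0)) (fderiv ℝ S.sec v (w 1)) := by
  rw [form, ContinuousAlternatingMap.compContinuousLinearMap_apply, orbitTwoForm_apply]; rfl

theorem contDiffOn_form : ContDiffOn ℝ ∞ S.form S.tgt := by
  let B : Model n → Model n →L[ℝ] Model n →L[ℝ] ℝ := fun v =>
    ((orbitBilin ℓ (S.sec v)).bilinearComp (fderiv ℝ S.sec v) (fderiv ℝ S.sec v))
  have hd : ContDiffOn ℝ ∞ (fderiv ℝ S.sec) S.tgt :=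
    S.contDiffOn_sec.fderiv_of_isOpen S.isOpen_tgt (by simp)
  have hB : ContDiffOn ℝ ∞ B S.tgt := by
    refine contDiffOn_clm_apply.2 fun u => contDiffOn_clm_apply.2 fun v => ?_
    exact contDiffOn_orbitForm S.contDiffOn_sec (hd.clm_apply contDiffOn_const)
      (hd.clm_apply contDiffOn_const)
  refine ((alternate _).contDiff.comp_contDiffOn hB).congr fun v _ => ?_
  ext w
  rw [form_apply, Function.comp_apply, alternate_apply]
  simp only [B, ContinuousLinearMap.bilinearComp_apply, orbitBilin_apply]
  rw [orbitForm_swap ℓ _ (fderiv ℝ S.sec v (w 1))]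
  ring

/-- The exterior derivative commutes with pullback, and the derivative of the section takes values
in tangent vectors, where the derivative of the product form vanishes. -/
theorem extDeriv_form (hpos : ∀ j, 0 < ℓ j) {v : Model n} (hv : v ∈ S.tgt) :
    extDeriv S.form v = 0 := by
  have h : extDeriv S.form v = _ := extDeriv_pullback (r := ∞)
    ((contDiff_orbitTwoForm (ℓ := ℓ)).differentiable (by simp) (S.sec v))
    (S.contDiffOn_sec.contDiffAt (S.isOpen_tgt.mem_nhds hv))
    (by rw [minSmoothness_of_isRCLikeNormedField]; exact WithTop.coe_le_coe.2 (le_top : (2 : ℕ∞) ≤ ⊤))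
  rw [h]
  ext w
  rw [ContinuousAlternatingMap.compContinuousLinearMap_apply, extDeriv_orbitTwoForm]
  · rfl
  · intro i
    exact norm_pos_iff.1 (by rw [(S.sec_mem v).1]; exact hpos i)
  · exact fun k => S.isTangent_fderiv_sec hv _

end Slice

/-! ### The global symplectic form -/

section Manifold

variable [hn : Fact (3 ≤ n)] [hpos : Fact (∀ j, 0 < ℓ j)]

/-- The symplectic form of the smooth part of the polygon space. -/
def symplecticForm : TwoForm (2 * (n - 3)) (SmoothPart ℓ) := fun p =>
  (sliceAt p).form ((sliceAt p).chart p)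

theorem mem_tgt (p : SmoothPart ℓ) : (sliceAt p).chart p ∈ (sliceAt p).tgt :=
  (sliceAt p).chart.map_source (mem_sliceAt_source p)

/-- The derivative of the inverse of a chart. -/
theorem mfderiv_chartAt_symm (p : SmoothPart ℓ) {y : Model n} (hy : y ∈ (sliceAt p).tgt)
    (u : Model n) : mfderiv 𝓘(ℝ, Model n) 𝓘(ℝ, Model n) (sliceAt p).chart.symm y u =
      fderiv ℝ (sliceAt ((sliceAt p).chart.symm y)).proj ((sliceAt p).sec y)
        (fderiv ℝ (sliceAt p).sec y u) := by
  set q := (sliceAt p).chart.symm y with hq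
  have h2 : (sliceAt p).sec y ∈ (sliceAt q).dom :=
    ((sliceAt p).toPoint_mem_source y _).1 (mem_sliceAt_source q)
  have h3 := ((sliceAt p).differentiableAt_sec hy).continuousAt.preimage_mem_nhds
    ((sliceAt q).isOpen_dom.mem_nhds h2)
  -- The tangent space at q is read in the preferred chart of q, not of p. The derivative is
  -- therefore that of the transition map.
  have h4 : HasFDerivAt ((sliceAt q).chart ∘ (sliceAt p).chart.symm)
      (fderiv ℝ (sliceAt q).proj ((sliceAt p).sec y) ∘L fderiv ℝ (sliceAt p).sec y) y := by
    refine HasFDerivAt.congr_of_eventuallyEq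
      (((sliceAt q).differentiableAt_proj h2).hasFDerivAt.comp y
        ((sliceAt p).differentiableAt_sec hy).hasFDerivAt) ?_
    filter_upwards [h3] with z hz
    exact (sliceAt p).chart_toPoint hz
  have h5 : HasMFDerivAt 𝓘(ℝ, Model n) 𝓘(ℝ, Model n) (sliceAt p).chart.symm y
      (fderiv ℝ (sliceAt q).proj ((sliceAt p).sec y) ∘L fderiv ℝ (sliceAt p).sec y) := by
    refine ⟨(sliceAt p).chart.continuousAt_symm hy, ?_⟩
    simp only [mfld_simps, writtenInExtChartAt, chartAt_eq]
    exact hasFDerivWithinAt_univ.2 h4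
  exact DFunLike.congr_fun h5.mfderiv u

/-- By `Slice.orbitForm_fderiv_sec_proj` the forms of two slices agree, so the form chosen pointwise
is, on the whole chart at p, that of the single slice there. Smoothness and closedness follow from
this. -/
theorem chartForm_symplecticForm (p : SmoothPart ℓ) {y : Model n} (hy : y ∈ (sliceAt p).tgt) :
    chartForm symplecticForm p y = (sliceAt p).form y := by
  ext w
  set q := (sliceAt p).chart.symm y with hq
  have hd : (sliceAt p).sec y ∈ (sliceAt q).dom :=
    ((sliceAt p).toPoint_mem_source y _).1 (mem_sliceAt_source q)
  have hc : (sliceAt q).chart q = (sliceAt q).proj ((sliceAt p).sec y) :=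
    (sliceAt p).chart_toPoint hd
  refine ((sliceAt q).form_apply ((sliceAt q).chart q)
    (fun k => mfderiv 𝓘(ℝ, Model n) 𝓘(ℝ, Model n) (sliceAt p).chart.symm y (w k))).trans ?_
  refine (congrArg₂ (fun a b => orbitForm ℓ ((sliceAt q).sec ((sliceAt q).chart q))
    (fderiv ℝ (sliceAt q).sec ((sliceAt q).chart q) a)
    (fderiv ℝ (sliceAt q).sec ((sliceAt q).chart q) b))
    (mfderiv_chartAt_symm p hy (w 0)) (mfderiv_chartAt_symm p hy (w 1))).trans ?_
  rw [Slice.form_apply, hc]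
  exact (sliceAt q).orbitForm_fderiv_sec_proj hn.1 hpos.1 hd ((sliceAt p).sec_mem y)
    ((sliceAt p).isTangent_fderiv_sec hy _) ((sliceAt p).isTangent_fderiv_sec hy _)

/-- Every tangent vector upstairs pairs with the lift of u as its projection does. So the lift lies
in the kernel of the product form, is an infinitesimal rotation, and projects to zero. -/
theorem symplecticForm_nondegenerate (p : SmoothPart ℓ)
    (u : Model n) (h : ∀ v : Model n, (sliceAt p).form ((sliceAt p).chart p) ![u, v] = 0) :
    u = 0 := by
  set S := sliceAt p
  set y := S.chart p with hy
  have hyt : y ∈ S.tgt := mem_tgt p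
  have hps : S.proj (S.sec y) = y := S.proj_sec y hyt
  have hz : ∀ v, IsTangent (S.sec y) v → orbitForm ℓ (S.sec y) (fderiv ℝ S.sec y u) v = 0 := by
    intro v hv
    have h1 := S.orbitForm_fderiv_sec_proj hn.1 hpos.1 (S.sec_dom y) (S.sec_mem y)
      (S.isTangent_fderiv_sec hyt u) hv
    rw [hps, S.fderiv_proj_fderiv_sec hyt] at h1
    have h2 := h (fderiv ℝ S.proj (S.sec y) v)
    rw [Slice.form_apply] at h2
    exact h1.symm.trans h2
  obtain ⟨w, hw⟩ := mem_range_rotationVector_of_orbitForm_eq_zero hpos.1 (S.sec_mem y).1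
    (S.isTangent_fderiv_sec hyt u) hz
  rw [← S.fderiv_proj_fderiv_sec hyt u, ← hw, S.fderiv_proj_rotationVector (S.sec_dom y)]

theorem isSymplecticForm_symplecticForm : IsSymplecticForm (symplecticForm (ℓ := ℓ)) where
  smooth p := (sliceAt p).contDiffOn_form.congr fun _ hy => chartForm_symplecticForm p hy
  closed p y hy := by
    have h : chartForm symplecticForm p =ᶠ[𝓝 y] (sliceAt p).form := by
      filter_upwards [(sliceAt p).isOpen_tgt.mem_nhds hy] with z hz
      exact chartForm_symplecticForm p hz
    rw [h.extDeriv_eq]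
    exact (sliceAt p).extDeriv_form hpos.1 hy
  nondegenerate p u h := symplecticForm_nondegenerate p u h

theorem isSymplecticQuotient_symplecticForm :
    IsSymplecticQuotient ℓ (symplecticForm (ℓ := ℓ)) := by
  intro x hx
  have hnc := polygonClass_notMem_singularSet.1 hx
  set p := smoothClass x hnc with hp
  let S := sliceAt p
  have hxd : x.1 ∈ S.dom := (S.mem_chart_source (p := p) rfl).1 (mem_sliceAt_source p)
  let F : (Fin n → Vec) → SmoothPart ℓ := fun y => S.toPoint (S.proj y)
  let U : Set (Fin n → Vec) := S.dom ∩ S.proj ⁻¹' S.tgt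
  have hU : IsOpen U := S.contDiffOn_proj.continuousOn.isOpen_inter_preimage S.isOpen_dom
    S.isOpen_tgt
  have hxU : x.1 ∈ U := ⟨hxd, S.proj_mem _ hxd x.2⟩
  have hF : ContMDiffOn 𝓘(ℝ, Fin n → Vec) 𝓘(ℝ, Model n) ∞ F U :=
    (contMDiffOn_symm_of_mem_maximalAtlas S.chart_mem_maximalAtlas).comp
      (S.contDiffOn_proj.contMDiffOn.mono Set.inter_subset_left) fun y hy => hy.2
  have hFx : F x.1 = p := Subtype.ext (S.polygonClass_sec_proj x hxd)
  have hderiv : ∀ u : Fin n → Vec, mfderiv 𝓘(ℝ, Fin n → Vec) 𝓘(ℝ, Model n) F x.1 u =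
      fderiv ℝ S.proj x.1 u := by
    intro u
    have h1 : HasFDerivAt ((sliceAt (F x.1)).chart ∘ F) (fderiv ℝ S.proj x.1) x.1 := by
      refine HasFDerivAt.congr_of_eventuallyEq (S.differentiableAt_proj hxd).hasFDerivAt ?_
      rw [hFx]
      filter_upwards [hU.mem_nhds hxU] with y hy
      exact S.chart.right_inv hy.2
    have h2 : HasMFDerivAt 𝓘(ℝ, Fin n → Vec) 𝓘(ℝ, Model n) F x.1 (fderiv ℝ S.proj x.1) := by
      refine ⟨(hF.continuousOn).continuousAt (hU.mem_nhds hxU), ?_⟩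
      simp only [mfld_simps, writtenInExtChartAt, chartAt_eq]
      exact hasFDerivWithinAt_univ.2 h1
    exact DFunLike.congr_fun h2.mfderiv u
  have hpx : S.chart p = S.proj x.1 := S.chart_smoothClass x hnc hxd
  refine ⟨U, hU, hxU, F, hF, fun y hy => S.polygonClass_sec_proj y hy.1, fun w => ?_,
    fun u v hu hv => ?_⟩
  · obtain ⟨g, hg, h⟩ := S.sec_proj x.1 hxd x.2
    have hv := hxU.2
    have hgx : S.sec (S.proj x.1) = fun i => g (x.1 i) := funext h
    have ht := S.isTangent_fderiv_sec hv w
    -- The derivative of the section lifts w at the slice polygon. Rotating back by g moves the lift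
    -- to x.
    refine ⟨fun i => g.symm (fderiv ℝ S.sec (S.proj x.1) w i), ⟨fun i => ?_, ?_⟩, ?_⟩
    · have := ht.1 i
      rw [hgx] at this
      rw [← this, ← g.inner_map_map]
      simp
    · rw [← map_sum, ht.2, map_zero]
    · refine (hderiv _).trans ?_
      rw [← S.fderiv_proj_rotation hg hxd]
      simp only [LinearIsometryEquiv.apply_symm_apply]
      rw [← hgx]
      exact S.fderiv_proj_fderiv_sec hv w
  · have h1 : (sliceAt (F x.1)).form ((sliceAt (F x.1)).chart (F x.1))
        ![fderiv ℝ S.proj x.1 u, fderiv ℝ S.proj x.1 v] = orbitForm ℓ x.1 u v := by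
      rw [hFx, ← S.orbitForm_fderiv_sec_proj hn.1 hpos.1 hxd x.2 hu hv, ← hpx]
      exact S.form_apply _ _
    refine Eq.trans ?_ h1
    exact congrArg₂ (fun a b => (sliceAt (F x.1)).form ((sliceAt (F x.1)).chart (F x.1)) ![a, b])
      (hderiv u) (hderiv v)

end Manifold

end

section

variable {n : ℕ} {ℓ : Fin n → ℝ}

/-! ### Planar polygons -/

/-- The vectors of the tuple are coplanar. -/
def Planar (y : Fin n → Vec) : Prop := ∃ w : Vec, w ≠ 0 ∧ ∀ i, inner ℝ w (y i) = 0

theorem Planar.rotation {y : Fin n → Vec} (h : Planar y) (g : Vec ≃ₗᵢ[ℝ] Vec) :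
    Planar fun i => g (y i) := by
  obtain ⟨w, hw, h⟩ := h
  exact ⟨g w, by simpa using hw, fun i => by rw [LinearIsometryEquiv.inner_map_map, h]⟩

/-- This turns planarity into closed, rotation-invariant equations, which makes the planar set
closed in the quotient. -/
theorem planar_iff_triple {y : Fin n → Vec} (hy : NonCollinear y) (h0 : ∀ i, y i ≠ 0) :
    Planar y ↔ ∀ i j k, triple (y i) (y j) (y k) = 0 := by
  constructor
  · rintro ⟨w, hw, h⟩ i j k
    exact triple_eq_zero_of_orthogonal hw (h i) (h j) (h k)
  · intro h
    obtain ⟨a, b, hab⟩ := hy.exists_mem_pairDomain h0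
    refine ⟨cross (y a) (y b), hab, fun i => ?_⟩
    rw [real_inner_comm, ← triple_eq_inner_cross, h]

theorem mem_planarSet_iff {p : SmoothPart ℓ} {x : closedPolygons ℓ} (h : polygonClass x = p.1) :
    p ∈ planarSet ℓ ↔ Planar x.1 := by
  constructor
  · rintro ⟨y, hy, hp⟩
    obtain ⟨g, -, hg⟩ := polygonClass_eq_iff.1 (hy.trans h.symm)
    rw [show x.1 = fun i => g (y.1 i) from funext hg]
    exact Planar.rotation hp g
  · exact fun hp => ⟨x, h, hp⟩

theorem isClosed_planarSet (hpos : ∀ j, 0 < ℓ j) : IsClosed (planarSet ℓ) := by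
  let A : Set (PolygonSpace ℓ) :=
    {p | ∀ i j k, triple (p.out.1 i) (p.out.1 j) (p.out.1 k) = 0}
  have h0 : ∀ (x : closedPolygons ℓ) i, x.1 i ≠ 0 := fun x i =>
    norm_pos_iff.1 (by rw [x.2.1]; exact hpos i)
  have hA : IsClosed A := by
    rw [← Slice.isQuotientMap_polygonClass.isClosed_preimage]
    have h1 : (polygonClass : closedPolygons ℓ → PolygonSpace ℓ) ⁻¹' A =
        {x | ∀ i j k, triple (x.1 i) (x.1 j) (x.1 k) = 0} := by
      ext x
      obtain ⟨g, hg, h⟩ := Slice.out_rotation x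
      simp only [A, Set.mem_preimage, Set.mem_ofPred_eq, h, triple_rotation hg]
    rw [h1]
    simp only [Set.ofPred_forall]
    refine isClosed_iInter fun i => isClosed_iInter fun j => isClosed_iInter fun k => ?_
    refine isClosed_eq ?_ continuous_const
    have hc : Continuous fun y : Fin n → Vec => triple (y i) (y j) (y k) := by
      simp only [triple_eq_inner_cross]
      exact ((contDiff_apply ℝ Vec i).inner ℝ (ContDiff.cross (m := 0)
        (contDiff_apply ℝ Vec j) (contDiff_apply ℝ Vec k))).continuous
    exact hc.comp continuous_subtype_val
  have h2 : planarSet ℓ = Subtype.val ⁻¹' A := by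
    ext p
    have hout : polygonClass p.1.out = p.1 := Quotient.out_eq _
    have hnc : NonCollinear p.1.out.1 :=
      polygonClass_notMem_singularSet.1 (by rw [hout]; exact p.2)
    rw [mem_planarSet_iff hout, planar_iff_triple hnc (h0 _)]
    rfl
  rw [h2]
  exact hA.preimage continuous_subtype_val

theorem StandardPosition.planar_iff {a b : Fin n} {y : Fin n → Vec}
    (h : StandardPosition a b y) : Planar y ↔ ∀ i, y i 2 = 0 := by
  obtain ⟨h1, h2, h3, h4, h5⟩ := h
  constructor
  · rintro ⟨w, hw, h⟩ i
    have ha := h a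
    rw [inner_coord, h1, h2, mul_zero, mul_zero, add_zero, add_zero, mul_eq_zero,
      or_iff_left h4.ne'] at ha
    have hb := h b
    rw [inner_coord, h3, ha, zero_mul, mul_zero, zero_add, add_zero, mul_eq_zero,
      or_iff_left h5.ne'] at hb
    have hw2 : w 2 ≠ 0 := fun h2 => hw (vec_ext ha hb h2)
    have hi := h i
    rw [inner_coord, ha, hb, zero_mul, zero_mul, zero_add, zero_add, mul_eq_zero] at hi
    exact hi.resolve_left hw2
  · intro h
    refine ⟨!₂[0, 0, 1], fun h => ?_, fun i => ?_⟩
    · simpa using congrArg (fun v : Vec => v 2) h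
    · rw [inner_coord, h i]; simp

/-! ### Derivatives computed on lifts, and the Lagrangian property -/

section Manifold

variable [hn : Fact (3 ≤ n)] [hpos : Fact (∀ j, 0 < ℓ j)]

/-- The polygon which represents a class in the preferred slice. -/
def basePolygon (p : SmoothPart ℓ) : Fin n → Vec := (sliceAt p).sec ((sliceAt p).chart p)

/-- The lift of tangent vectors to the base polygon. -/
def tangentLift (p : SmoothPart ℓ) : Model n →L[ℝ] (Fin n → Vec) :=
  fderiv ℝ (sliceAt p).sec ((sliceAt p).chart p)

theorem basePolygon_mem (p : SmoothPart ℓ) : basePolygon p ∈ closedPolygons ℓ :=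
  (sliceAt p).sec_mem _

theorem nonCollinear_basePolygon (p : SmoothPart ℓ) : NonCollinear (basePolygon p) :=
  (sliceAt p).nonCollinear _ ((sliceAt p).sec_dom _)

theorem smoothClass_basePolygon (p : SmoothPart ℓ) :
    smoothClass ⟨basePolygon p, basePolygon_mem p⟩ (nonCollinear_basePolygon p) = p :=
  (sliceAt p).chart.left_inv (mem_sliceAt_source p)

theorem isTangent_tangentLift (p : SmoothPart ℓ) (u : Model n) :
    IsTangent (basePolygon p) (tangentLift p u) :=
  (sliceAt p).isTangent_fderiv_sec (mem_tgt p) u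

theorem symplecticForm_apply (p : SmoothPart ℓ) (u v : Model n) :
    symplecticForm p ![u, v] = orbitForm ℓ (basePolygon p) (tangentLift p u) (tangentLift p v) :=
  (sliceAt p).form_apply _ _

theorem eventually_eq_lift {V : Type*} {p : SmoothPart ℓ}
    {f : SmoothPart ℓ → V} {F : (Fin n → Vec) → V}
    (hf : ∀ᶠ y in 𝓝 (basePolygon p), ∀ (hy : y ∈ closedPolygons ℓ) (hc : NonCollinear y),
      f (smoothClass ⟨y, hy⟩ hc) = F y) :
    f ∘ (sliceAt p).chart.symm =ᶠ[𝓝 ((sliceAt p).chart p)] F ∘ (sliceAt p).sec := by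
  have h := ((sliceAt p).differentiableAt_sec (mem_tgt p)).continuousAt.eventually hf
  filter_upwards [h] with z hz
  exact hz ((sliceAt p).sec_mem z) ((sliceAt p).nonCollinear _ ((sliceAt p).sec_dom z))

/-- Functions on the quotient are differentiated through formulas for polygons: F need only agree
with f on closed polygons, because f is read along the section. -/
theorem hasMFDerivAt_of_lift {V : Type*} [NormedAddCommGroup V] [NormedSpace ℝ V]
    {p : SmoothPart ℓ} {f : SmoothPart ℓ → V} {F : (Fin n → Vec) → V}
    {F' : (Fin n → Vec) →L[ℝ] V}
    (hf : ∀ᶠ y in 𝓝 (basePolygon p), ∀ (hy : y ∈ closedPolygons ℓ) (hc : NonCollinear y),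
      f (smoothClass ⟨y, hy⟩ hc) = F y) (hF : HasFDerivAt F F' (basePolygon p)) :
    HasMFDerivAt 𝓘(ℝ, Model n) 𝓘(ℝ, V) f p (F' ∘L tangentLift p) := by
  have hF' : HasFDerivAt F F' ((sliceAt p).sec ((sliceAt p).chart p)) := hF
  have h1 : HasFDerivAt (f ∘ (sliceAt p).chart.symm) (F' ∘L tangentLift p)
      ((sliceAt p).chart p) :=
    HasFDerivAt.congr_of_eventuallyEq
      (hF'.comp _ ((sliceAt p).differentiableAt_sec (mem_tgt p)).hasFDerivAt)
      (eventually_eq_lift hf)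
  refine ⟨?_, ?_⟩
  · have h2 : ContinuousAt ((f ∘ (sliceAt p).chart.symm) ∘ (sliceAt p).chart) p :=
      h1.continuousAt.comp ((sliceAt p).chart.continuousAt (mem_sliceAt_source p))
    refine h2.congr ?_
    filter_upwards [(sliceAt p).chart.open_source.mem_nhds (mem_sliceAt_source p)] with q hq
    simp only [Function.comp_apply, (sliceAt p).chart.left_inv hq]
  · simp only [mfld_simps, writtenInExtChartAt, chartAt_eq]
    exact hasFDerivWithinAt_univ.2 h1

theorem mvfderiv_of_lift {V : Type*} [NormedAddCommGroup V] [NormedSpace ℝ V]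
    {p : SmoothPart ℓ} {f : SmoothPart ℓ → V} {F : (Fin n → Vec) → V}
    {F' : (Fin n → Vec) →L[ℝ] V}
    (hf : ∀ᶠ y in 𝓝 (basePolygon p), ∀ (hy : y ∈ closedPolygons ℓ) (hc : NonCollinear y),
      f (smoothClass ⟨y, hy⟩ hc) = F y) (hF : HasFDerivAt F F' (basePolygon p)) (u : Model n) :
    mvfderiv 𝓘(ℝ, Model n) f p u = F' (tangentLift p u) :=
  DFunLike.congr_fun (hasMFDerivAt_of_lift hf hF).mfderiv u

/-- In a slice whose last n - 3 coordinates are heights, the planar set is where these vanish. A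
vector tangent to it lifts to velocities in the plane of the polygon, so all triple products in the
form are zero. -/
theorem isLagrangianSubmanifold_planarSet :
    IsLagrangianSubmanifold (k := n - 3) (symplecticForm (ℓ := ℓ)) (planarSet ℓ) := by
  intro p hp
  obtain ⟨y, hy, rfl⟩ := exists_smoothClass_eq p
  obtain ⟨a, b, x, hs, hxy⟩ := exists_standardPosition hpos.1 y hy
  have hpl := (hs.planar_iff).1
    ((mem_planarSet_iff (p := smoothClass y hy) (x := x) hxy).1 hp)
  obtain ⟨P, hP, hPl⟩ := exists_planar_slice_coordinates hn.1 hpos.1 x.2 hs hpl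
  obtain ⟨S, hS, hSd, hSp, hSs⟩ := exists_slice hn.1 hpos.1 x.2 hs P hP
  set p := smoothClass y hy with hpdef
  have hps : p ∈ S.chart.source := (S.mem_chart_source (p := p) hxy).2 hS
  have hPv : ∀ v ∈ S.tgt, P (S.sec v) = v := fun v hv => by
    rw [← (hSs v).normalize_eq, ← hSp]
    exact S.proj_sec v hv
  refine ⟨S.chart, S.chart_mem_maximalAtlas, hps, fun q hq => ?_, fun u v hu hv => ?_⟩
  · have hv : S.chart q ∈ S.tgt := S.chart.map_source hq
    have hq' : polygonClass ⟨S.sec (S.chart q), S.sec_mem _⟩ = q.1 :=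
      congrArg Subtype.val (S.chart.left_inv hq)
    rw [mem_planarSet_iff hq', (hSs _).planar_iff,
      hPl _ (hSs _).2.1 (hSs _).2.2.1 (S.sec_mem _).2, hPv _ hv]
  · have hxd : basePolygon p ∈ S.dom :=
      (S.mem_chart_source (p := p) (x := ⟨basePolygon p, basePolygon_mem p⟩)
        (congrArg Subtype.val (smoothClass_basePolygon p))).1 hps
    have hd : ∀ u : Model n, mvfderiv 𝓘(ℝ, Model n) S.chart p u =
        fderiv ℝ S.proj (basePolygon p) (tangentLift p u) := by
      refine mvfderiv_of_lift ?_ (S.differentiableAt_proj hxd).hasFDerivAt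
      filter_upwards [S.isOpen_dom.mem_nhds hxd] with z hz hzc hzn
      exact S.chart_smoothClass ⟨z, hzc⟩ hzn hz
    have hvt := S.proj_mem _ hxd (basePolygon_mem p)
    -- The gauge keeps the heights of the vectors a and b zero along the section. With the last half
    -- of the coordinates and the closing condition, this makes all heights of the velocity vanish.
    have hflat : ∀ u : Model n, (∀ i : Fin (2 * (n - 3)), n - 3 ≤ (i : ℕ) →
        mvfderiv 𝓘(ℝ, Model n) S.chart p u i = 0) →
        ∀ i, fderiv ℝ S.sec (S.proj (basePolygon p))
          (fderiv ℝ S.proj (basePolygon p) (tangentLift p u)) i 2 = 0 := by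
      intro u hu
      set c := fderiv ℝ S.proj (basePolygon p) (tangentLift p u) with hc
      have hc0 : ∀ i : Fin (2 * (n - 3)), n - 3 ≤ (i : ℕ) → c i = 0 := fun i hi =>
        (congrArg (fun w : Model n => w i) (hd u)).symm.trans (hu i hi)
      have hsec := (S.differentiableAt_sec hvt).hasFDerivAt
      have hcoord : ∀ i : Fin n, (∀ v, S.sec v i 2 = 0) →
          fderiv ℝ S.sec (S.proj (basePolygon p)) c i 2 = 0 := by
        intro i hi
        have h1 := (hasFDerivAt_vertexCoord i 2 (S.sec (S.proj (basePolygon p)))).comp _ hsec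
        rw [show (fun y : Fin n → Vec => y i 2) ∘ S.sec = fun _ => 0 from funext hi] at h1
        exact DFunLike.congr_fun (h1.unique (hasFDerivAt_const _ _)) c
      have hPc : P (fderiv ℝ S.sec (S.proj (basePolygon p)) c) = c := by
        have h1 := P.hasFDerivAt.comp _ hsec
        have h2 : P ∘ S.sec =ᶠ[𝓝 (S.proj (basePolygon p))] id := by
          filter_upwards [S.isOpen_tgt.mem_nhds hvt] with z hz using hPv z hz
        exact DFunLike.congr_fun ((h1.congr_of_eventuallyEq h2.symm).unique (hasFDerivAt_id _)) c
      refine (hPl _ (hcoord a fun v => (hSs v).2.1) (hcoord b fun v => (hSs v).2.2.1)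
        (S.isTangent_fderiv_sec hvt c).2).2 fun i hi => ?_
      rw [hPc]
      exact hc0 i hi
    refine (symplecticForm_apply p u v).trans ?_
    rw [← S.orbitForm_fderiv_sec_proj hn.1 hpos.1 hxd (basePolygon_mem p)
      (isTangent_tangentLift p u) (isTangent_tangentLift p v)]
    refine Finset.sum_eq_zero fun i _ => ?_
    rw [triple_coord, hflat u hu, hflat v hv]
    have hx2 : S.sec (S.proj (basePolygon p)) i 2 = 0 := by
      have hbp : Planar (basePolygon p) := (mem_planarSet_iff
        (x := ⟨basePolygon p, basePolygon_mem p⟩)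
        (congrArg Subtype.val (smoothClass_basePolygon p))).1 hp
      obtain ⟨g, -, hg⟩ := S.sec_proj _ hxd (basePolygon_mem p)
      have h1 : Planar (S.sec (S.proj (basePolygon p))) := by
        rw [show S.sec (S.proj (basePolygon p)) = fun i => g (basePolygon p i) from funext hg]
        exact hbp.rotation g
      exact (hSs _).planar_iff.1 h1 i
    rw [hx2]
    ring

end Manifold

end

section

variable {n : ℕ}

/-! ### Combinatorics of triangulations -/

namespace Triangulation

variable (T : Triangulation n)

/-- The diagonals with both ends between `i` and `j`. -/
def within (i j : Fin n) : Finset (Fin n × Fin n) :=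
  T.diagonals.filter fun a => i ≤ a.1 ∧ a.2 ≤ j

theorem mem_within {i j : Fin n} {a : Fin n × Fin n} :
    a ∈ T.within i j ↔ a ∈ T.diagonals ∧ i ≤ a.1 ∧ a.2 ≤ j := by
  simp [within]

theorem within_eq_empty {i j : Fin n} (h : (j : ℕ) = i + 1) : T.within i j = ∅ := by
  rw [Finset.eq_empty_iff_forall_notMem]
  intro a ha
  rw [mem_within] at ha
  have := (T.isDiagonal a ha.1).1
  have h1 : (i : ℕ) ≤ a.1 := ha.2.1
  have h2 : (a.2 : ℕ) ≤ j := ha.2.2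
  omega

/-- The diagonals inside an interval are separated by a suitable vertex. -/
theorem exists_split {i j : Fin n} (hij : (i : ℕ) + 1 < j) :
    ∃ k : Fin n, i < k ∧ k < j ∧ (T.within i j).erase (i, j) = T.within i k ∪ T.within k j ∧
      Disjoint (T.within i k) (T.within k j) := by
  classical
  -- The splitting vertex k is the last vertex before j joined to i by an edge. The vertex i + 1
  -- ensures that there is one.
  let s : Finset (Fin n) := Finset.univ.filter fun k =>
    i < k ∧ k < j ∧ ((k : ℕ) = i + 1 ∨ (i, k) ∈ T.diagonals)
  have hs : s.Nonempty := ⟨⟨i + 1, by omega⟩, Finset.mem_filter.2 ⟨Finset.mem_univ _,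
    Fin.lt_def.2 (Nat.lt_succ_self _), Fin.lt_def.2 hij, Or.inl rfl⟩⟩
  obtain ⟨k, hk, hmax⟩ := s.exists_max_image id hs
  simp only [s, Finset.mem_filter, Finset.mem_univ, true_and, id] at hk hmax
  obtain ⟨hik, hkj, hke⟩ := hk
  refine ⟨k, hik, hkj, ?_, ?_⟩
  · ext a
    simp only [Finset.mem_erase, Finset.mem_union, mem_within]
    constructor
    · rintro ⟨hne, ha, h1, h2⟩
      have hd := (T.isDiagonal a ha).1
      by_cases h3 : a.2 ≤ k
      · exact Or.inl ⟨ha, h1, h3⟩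
      by_cases h4 : k ≤ a.1
      · exact Or.inr ⟨ha, h4, h2⟩
      exfalso
      -- A diagonal passing over k either starts at i, against the maximality of k, or crosses the
      -- edge (i, k).
      rcases h1.eq_or_lt with h5 | h5
      · have h6 : a.2 < j := lt_of_le_of_ne h2 fun h => hne (Prod.ext h5.symm h)
        have h7 := hmax a.2 ⟨h5 ▸ (Fin.lt_def.2 (by omega)), h6, Or.inr (by rw [h5]; exact ha)⟩
        exact h3 h7
      · rcases hke with h6 | h6
        · simp only [Fin.le_def, Fin.lt_def] at *
          omega
        · exact T.noncrossing _ h6 a ha ⟨h5, not_le.1 h4, not_le.1 h3⟩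
    · rintro (⟨ha, h1, h2⟩ | ⟨ha, h1, h2⟩)
      · refine ⟨fun h => ?_, ha, h1, h2.trans hkj.le⟩
        rw [h] at h2
        exact absurd h2 (not_le.2 hkj)
      · refine ⟨fun h => ?_, ha, hik.le.trans h1, h2⟩
        rw [h] at h1
        exact absurd h1 (not_le.2 hik)
  · rw [Finset.disjoint_left]
    intro a h1 h2
    rw [mem_within] at h1 h2
    have := (T.isDiagonal a h1.1).1
    have h3 : (a.2 : ℕ) ≤ k := h1.2.2
    have h4 : (k : ℕ) ≤ a.1 := h2.2.1
    omega

/-- Splitting at k leaves at most (k-i-1) + (j-k-1) diagonals, and the chord (i, j) itself adds at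
most one. -/
theorem card_within_le : ∀ (m : ℕ) (i j : Fin n), (j : ℕ) - i = m → i < j →
    (T.within i j).card + 1 ≤ (j : ℕ) - i := by
  intro m
  induction m using Nat.strong_induction_on with
  | _ m ih =>
    intro i j hm hij
    rw [Fin.lt_def] at hij
    by_cases h : (j : ℕ) = i + 1
    · rw [T.within_eq_empty h, Finset.card_empty]; omega
    · obtain ⟨k, hik, hkj, hsplit, hdisj⟩ := T.exists_split (i := i) (j := j) (by omega)
      have h1 := ih (k - i) (by rw [Fin.lt_def] at hik hkj; omega) i k rfl hik
      have h2 := ih (j - k) (by rw [Fin.lt_def] at hik hkj; omega) k j rfl hkj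
      have h3 := Finset.card_union_of_disjoint hdisj
      rw [← hsplit] at h3
      have h4 := Finset.pred_card_le_card_erase (s := T.within i j) (a := (i, j))
      rw [Fin.lt_def] at hik hkj
      omega

/-- An interval which contains as many diagonals as possible. -/
def Full (i j : Fin n) : Prop :=
  i < j ∧ ((T.within i j).erase (i, j)).card + 2 = (j : ℕ) - i

/-- Equality in the count forces equality in both halves. A half that is not a side must then
contain its own chord, for otherwise splitting it again would lose one diagonal. -/
theorem Full.exists_split {T : Triangulation n} {i j : Fin n} (h : T.Full i j) :
    ∃ k : Fin n, i < k ∧ k < j ∧ (T.within i j).erase (i, j) = T.within i k ∪ T.within k j ∧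
      Disjoint (T.within i k) (T.within k j) ∧
      ((k : ℕ) = i + 1 ∨ ((i, k) ∈ T.diagonals ∧ T.Full i k)) ∧
      ((j : ℕ) = k + 1 ∨ ((k, j) ∈ T.diagonals ∧ T.Full k j)) := by
  obtain ⟨hij, hc⟩ := h
  obtain ⟨k, hik, hkj, hsplit, hdisj⟩ := T.exists_split (i := i) (j := j) (by omega)
  have h3 := Finset.card_union_of_disjoint hdisj
  rw [← hsplit] at h3
  have h1 := T.card_within_le _ i k rfl hik
  have h2 := T.card_within_le _ k j rfl hkj
  have aux : ∀ p q : Fin n, p < q → (T.within p q).card + 1 = (q : ℕ) - p →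
      (q : ℕ) = p + 1 ∨ ((p, q) ∈ T.diagonals ∧ T.Full p q) := by
    intro p q hpq hcard
    by_cases h : (q : ℕ) = p + 1
    · exact Or.inl h
    right
    rw [Fin.lt_def] at hpq
    have hmem : (p, q) ∈ T.within p q := by
      by_contra hmem
      obtain ⟨r, hpr, hrq, hs, hd⟩ := T.exists_split (i := p) (j := q) (by omega)
      rw [Finset.erase_eq_of_notMem hmem] at hs
      rw [hs, Finset.card_union_of_disjoint hd] at hcard
      have h4 := T.card_within_le _ p r rfl hpr
      have h5 := T.card_within_le _ r q rfl hrq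
      rw [Fin.lt_def] at hpr hrq
      omega
    refine ⟨(T.mem_within.1 hmem).1, hpq, ?_⟩
    rw [Finset.card_erase_of_mem hmem]
    have := Finset.card_pos.2 ⟨_, hmem⟩
    omega
  refine ⟨k, hik, hkj, hsplit, hdisj, aux i k hik ?_, aux k j hkj ?_⟩ <;>
  · rw [Fin.lt_def] at hik hkj
    omega

/-- A full interval has an apex, which divides it into a face and two full intervals. -/
theorem Full.exists_face {T : Triangulation n} {i j : Fin n} (h : T.Full i j)
    (he : T.IsEdge i j) :
    ∃ k : Fin n, T.IsFace i k j ∧ (T.within i j).erase (i, j) = T.within i k ∪ T.within k j ∧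
      Disjoint (T.within i k) (T.within k j) ∧
      ((k : ℕ) = i + 1 ∨ ((i, k) ∈ T.diagonals ∧ T.Full i k)) ∧
      ((j : ℕ) = k + 1 ∨ ((k, j) ∈ T.diagonals ∧ T.Full k j)) := by
  obtain ⟨k, hik, hkj, h1, h2, h3, h4⟩ := h.exists_split
  refine ⟨k, ⟨hik, hkj, ?_, ?_, he⟩, h1, h2, h3, h4⟩
  · exact h3.imp id fun h => Or.inr h.1
  · exact h4.imp id fun h => Or.inr h.1

/-- Every diagonal inside a full interval is adjacent to two faces. -/
theorem Full.exists_apexes {T : Triangulation n} : ∀ (m : ℕ) (i j : Fin n), (j : ℕ) - i = m →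
    T.Full i j → T.IsEdge i j → ∀ a ∈ (T.within i j).erase (i, j),
      (∃ k, T.IsFace a.1 k a.2) ∧ ∃ k, T.IsFace k a.1 a.2 ∨ T.IsFace a.1 a.2 k := by
  intro m
  induction m using Nat.strong_induction_on with
  | _ m ih =>
    intro i j hm hf he a ha
    obtain ⟨k, hface, hsplit, -, hl, hr⟩ := hf.exists_face he
    have hik : (i : ℕ) < k := hface.1
    have hkj : (k : ℕ) < j := hface.2.1
    rw [hsplit, Finset.mem_union] at ha
    rcases ha with ha | ha
    · rcases hl with hl | ⟨hl, hfl⟩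
      · rw [T.within_eq_empty hl] at ha
        exact absurd ha (Finset.notMem_empty a)
      · by_cases hak : a = (i, k)
        · rw [hak]
          obtain ⟨k', hk', -⟩ := hfl.exists_face hface.2.2.1
          exact ⟨⟨k', hk'⟩, j, Or.inr hface⟩
        · exact ih _ (by omega) i k rfl hfl hface.2.2.1 a (Finset.mem_erase.2 ⟨hak, ha⟩)
    · rcases hr with hr | ⟨hr, hfr⟩
      · rw [T.within_eq_empty hr] at ha
        exact absurd ha (Finset.notMem_empty a)
      · by_cases hak : a = (k, j)
        · rw [hak]
          obtain ⟨k', hk', -⟩ := hfr.exists_face hface.2.2.2.1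
          exact ⟨⟨k', hk'⟩, i, Or.inl hface⟩
        · exact ih _ (by omega) k j rfl hfr hface.2.2.2.1 a (Finset.mem_erase.2 ⟨hak, ha⟩)

/-- Summation over the faces inside a full interval. -/
theorem Full.sum_faces {T : Triangulation n} {A : Type*} [AddCommGroup A] {h : Fin n → A}
    {Hin Hout : Fin n × Fin n → A}
    (hface : ∀ i k j, T.IsFace i k j → Hin (i, j) = Hout (i, k) + Hout (k, j))
    (hside : ∀ i k : Fin n, (k : ℕ) = i + 1 → Hout (i, k) = h i) :
    ∀ (m : ℕ) (i j : Fin n), (j : ℕ) - i = m → T.Full i j → T.IsEdge i j →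
      Hin (i, j) = ∑ m ∈ Finset.Ico i j, h m +
        ∑ a ∈ (T.within i j).erase (i, j), (Hout a - Hin a) := by
  intro m
  induction m using Nat.strong_induction_on with
  | _ m ih =>
    intro i j hm hf he
    obtain ⟨k, hf', hsplit, hdisj, hl, hr⟩ := hf.exists_face he
    have hik : (i : ℕ) < k := hf'.1
    have hkj : (k : ℕ) < j := hf'.2.1
    -- Passing from the inner to the outer value at a diagonal (p, q) adds the jump at (p, q), so
    -- the sum now runs over all of `within p q`.
    have aux : ∀ p q : Fin n, (q : ℕ) - p < m → T.IsEdge p q →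
        ((q : ℕ) = p + 1 ∨ ((p, q) ∈ T.diagonals ∧ T.Full p q)) →
        Hout (p, q) = ∑ m ∈ Finset.Ico p q, h m + ∑ a ∈ T.within p q, (Hout a - Hin a) := by
      rintro p q hlt hpq (hs | ⟨hd, hfull⟩)
      · rw [T.within_eq_empty hs, Finset.sum_empty, add_zero, hside p q hs]
        have : Finset.Ico p q = {p} := by
          ext r
          simp only [Finset.mem_Ico, Finset.mem_singleton, Fin.le_def, Fin.lt_def, Fin.ext_iff]
          omega
        rw [this, Finset.sum_singleton]
      · have hmem : (p, q) ∈ T.within p q := T.mem_within.2 ⟨hd, le_rfl, le_rfl⟩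
        rw [← Finset.add_sum_erase _ _ hmem, ← add_sub_cancel (Hin (p, q)) (Hout (p, q)),
          add_sub_cancel (Hin (p, q)) (Hout (p, q))]
        have := ih _ hlt p q rfl hfull hpq
        nth_rw 1 [← add_sub_cancel (Hin (p, q)) (Hout (p, q))]
        nth_rw 1 [this]
        abel
    rw [hface i k j hf', aux i k (by omega) hf'.2.2.1 hl, aux k j (by omega) hf'.2.2.2.1 hr,
      hsplit, Finset.sum_union hdisj,
      ← Finset.Ico_union_Ico_eq_Ico hf'.1.le hf'.2.1.le,
      Finset.sum_union (Finset.Ico_disjoint_Ico_consecutive i k j)]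
    abel

/-- The recursion over faces starts at the side from vertex 0 to vertex n - 1: its interval contains
all n - 3 diagonals and is therefore full. -/
theorem root_spec (hn : 3 ≤ n) : ∃ i j : Fin n, (i : ℕ) = 0 ∧ (j : ℕ) + 1 = n ∧ T.Full i j ∧
    T.IsEdge i j ∧ (T.within i j).erase (i, j) = T.diagonals := by
  have h0 : ((⟨0, by omega⟩ : Fin n), (⟨n - 1, by omega⟩ : Fin n)) ∉ T.diagonals := fun h =>
    (T.isDiagonal _ h).2 ⟨rfl, by simp only; omega⟩
  have h1 : (T.within ⟨0, by omega⟩ ⟨n - 1, by omega⟩).erase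
      (⟨0, by omega⟩, ⟨n - 1, by omega⟩) = T.diagonals := by
    ext a
    rw [Finset.mem_erase, mem_within]
    refine ⟨fun h => h.2.1, fun h => ⟨fun h' => h0 (h' ▸ h), h, ?_, ?_⟩⟩
    · rw [Fin.le_def]; simp
    · rw [Fin.le_def]; simp only; omega
  refine ⟨⟨0, by omega⟩, ⟨n - 1, by omega⟩, rfl, by simp only; omega, ⟨?_, ?_⟩, ?_, h1⟩
  · rw [Fin.lt_def]; simp only; omega
  · rw [h1]
    have := T.card_diagonals
    simp only
    omega
  · exact Or.inr (Or.inl ⟨rfl, by simp only; omega⟩)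

theorem innerApex_spec (hn : 3 ≤ n) (a : T.Internal) :
    T.IsFace a.1.1 (T.innerApex a) a.1.2 := by
  obtain ⟨i, j, -, -, hf, he, hD⟩ := T.root_spec hn
  exact @Classical.epsilon_spec (Fin n) _
    (Full.exists_apexes _ i j rfl hf he a.1 (by rw [hD]; exact a.2)).1

theorem outerApex_spec (hn : 3 ≤ n) (a : T.Internal) :
    T.IsFace (T.outerApex a) a.1.1 a.1.2 ∨ T.IsFace a.1.1 a.1.2 (T.outerApex a) := by
  obtain ⟨i, j, -, -, hf, he, hD⟩ := T.root_spec hn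
  exact @Classical.epsilon_spec (Fin n) _
    (Full.exists_apexes _ i j rfl hf he a.1 (by rw [hD]; exact a.2)).2

/-- Two edges do not cross. -/
theorem IsEdge.noncrossing {T : Triangulation n} {i j k l : Fin n} (h : T.IsEdge i k)
    (h' : T.IsEdge j l) (hij : i < j) (hjk : j < k) (hkl : k < l) : False := by
  rw [Fin.lt_def] at hij hjk hkl
  have hd : (i, k) ∈ T.diagonals := by
    rcases h with h | h | h
    · omega
    · omega
    · exact h
  have hd' : (j, l) ∈ T.diagonals := by
    rcases h' with h | h | h
    · omega
    · omega
    · exact h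
  exact T.noncrossing _ hd _ hd' ⟨hij, hjk, hkl⟩

/-- Two apexes on the same side of an edge would give crossing edges. Thus the apexes chosen by
`epsilon` are those met in the recursion. -/
theorem IsFace.inner_unique {T : Triangulation n} {i j k k' : Fin n} (h : T.IsFace i k j)
    (h' : T.IsFace i k' j) : k = k' := by
  obtain ⟨h1, h2, h3, h4, -⟩ := h
  obtain ⟨h1', h2', h3', h4', -⟩ := h'
  rcases lt_trichotomy k k' with hlt | heq | hlt
  · exact (h3'.noncrossing h4 h1 hlt h2').elim
  · exact heq
  · exact (h3.noncrossing h4' h1' hlt h2).elim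

theorem IsFace.outer_unique {T : Triangulation n} {i j k k' : Fin n}
    (h : T.IsFace k i j ∨ T.IsFace i j k) (h' : T.IsFace k' i j ∨ T.IsFace i j k') : k = k' := by
  rcases h with ⟨h1, h2, h3, h4, h5⟩ | ⟨h1, h2, h3, h4, h5⟩ <;>
  rcases h' with ⟨h1', h2', h3', h4', h5'⟩ | ⟨h1', h2', h3', h4', h5'⟩
  · rcases lt_trichotomy k k' with hlt | heq | hlt
    · exact (h3.noncrossing h5' hlt h1' h2).elim
    · exact heq
    · exact (h3'.noncrossing h5 hlt h1 h2).elim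
  · exact (h5.noncrossing h5' h1 h2 h2').elim
  · exact (h5'.noncrossing h5 h1' h2' h2).elim
  · rcases lt_trichotomy k k' with hlt | heq | hlt
    · exact (h5.noncrossing h4' h1 h2 hlt).elim
    · exact heq
    · exact (h5'.noncrossing h4 h1 h2' hlt).elim

end Triangulation

end

section

/-! ### Variations of a triangle -/

theorem cross_neg (u v : Vec) : cross u (-v) = -cross u v := by
  rw [← neg_one_smul ℝ v, cross_smul, neg_one_smul]

/-- The rate at which the half-plane bounded by `ℝ e` through `p` turns around `e`, divided by
`|e|`, when `e` and `p` vary with velocities `e'` and `p'`. -/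
def spin (e p e' p' : Vec) : ℝ :=
  inner ℝ (p' - (inner ℝ e p / inner ℝ e e) • e') (cross e p) / inner ℝ (cross e p) (cross e p)

/-- The contribution of the edge `e` to the sum over the edges of a face with third vertex `p`. -/
def edgeForm (e p e' p' e'' p'' : Vec) : ℝ :=
  triple e e' e'' / inner ℝ e e +
    (spin e p e' p' * inner ℝ e e'' - spin e p e'' p'' * inner ℝ e e')

theorem exists_coordinates {a b : Vec} (h : cross a b ≠ 0) (w : Vec) :
    ∃ r s t : ℝ, w = r • a + s • b + t • cross a b := by
  have h0 := (inner_self_pos h).ne'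
  have h1 : inner ℝ (cross a b) (cross a b) • w =
      inner ℝ w (cross b (cross a b)) • a + inner ℝ w (cross (cross a b) a) • b +
        inner ℝ w (cross a b) • cross a b := by
    apply vec_ext <;>
    · simp only [inner_coord, PiLp.add_apply, PiLp.smul_apply, smul_eq_mul, cross_apply_zero,
        cross_apply_one, cross_apply_two]
      ring
  refine ⟨inner ℝ w (cross b (cross a b)) / inner ℝ (cross a b) (cross a b),
    inner ℝ w (cross (cross a b) a) / inner ℝ (cross a b) (cross a b),
    inner ℝ w (cross a b) / inner ℝ (cross a b) (cross a b), ?_⟩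
  rw [← smul_right_injective Vec h0 |>.eq_iff, smul_add, smul_add, smul_smul, smul_smul, smul_smul,
    mul_div_cancel₀ _ h0, mul_div_cancel₀ _ h0, mul_div_cancel₀ _ h0]
  exact h1

/-- If ω is the angular velocity of a frame attached to the moving face, then e·e times the spin of
e is ω·e, and the edge form is -d(ω·e), which is linear in e. The proof checks the resulting
algebraic identity after expanding the velocities in the basis a, b, a × b. -/
theorem edgeForm_add {a b : Vec} (h : cross a b ≠ 0) (a' b' a'' b'' : Vec) :
    edgeForm (a + b) a (a' + b') a' (a'' + b'') a'' =
      edgeForm a (a + b) a' (a' + b') a'' (a'' + b'') + edgeForm b (-a) b' (-a') b'' (-a'') := by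
  obtain ⟨r1, r2, r3, hr⟩ := exists_coordinates h a'
  obtain ⟨s1, s2, s3, hs⟩ := exists_coordinates h b'
  obtain ⟨t1, t2, t3, ht⟩ := exists_coordinates h a''
  obtain ⟨w1, w2, w3, hw⟩ := exists_coordinates h b''
  have ha := (inner_self_pos (cross_ne_zero_left h)).ne'
  have hb := (inner_self_pos (cross_ne_zero_right h)).ne'
  have hc : inner ℝ (a + b) (a + b) ≠ 0 := by
    refine (inner_self_pos ?_).ne'
    refine cross_ne_zero_right (u := a) ?_
    rwa [cross_add, cross_self, zero_add]
  have hN := (inner_self_pos h).ne'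
  have hab : inner ℝ (cross a b) (cross a b) =
      inner ℝ a a * inner ℝ b b - inner ℝ a b * inner ℝ a b := by
    rw [inner_cross_cross, real_inner_comm a b]
  have e1 : cross (a + b) a = -cross a b := by
    rw [add_cross, cross_self, zero_add, cross_swap]
  have e2 : cross a (a + b) = cross a b := by rw [cross_add, cross_self, zero_add]
  have e3 : cross b (-a) = cross a b := by
    rw [← neg_one_smul ℝ a, cross_smul, neg_one_smul, cross_swap a b]
  have hba : cross b a = -cross a b := cross_swap b a
  have hNa : cross (cross a b) a = inner ℝ a a • b - inner ℝ a b • a := by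
    rw [cross_swap, cross_cross, neg_sub]
  have hNb : cross (cross a b) b = inner ℝ a b • b - inner ℝ b b • a := by
    rw [cross_swap, cross_cross, neg_sub, real_inner_comm a b]
  have haN : cross a (cross a b) = inner ℝ a b • a - inner ℝ a a • b := cross_cross a a b
  have hbN : cross b (cross a b) = inner ℝ b b • a - inner ℝ a b • b := by
    rw [cross_cross, real_inner_comm a b]
  simp only [edgeForm, spin, e1, e2, e3, hr, hs, ht, hw]
  simp only [triple_eq_inner_cross, inner_add_left, inner_add_right, inner_sub_left, inner_sub_right,
    real_inner_smul_left, real_inner_smul_right, inner_neg_left, inner_neg_right, cross_add,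
    add_cross, cross_smul, smul_cross, cross_self, hba, inner_cross_self_left,
    inner_cross_self_right, hNa, hNb, haN, hbN, real_inner_comm a b,
    inner_zero_right, mul_zero, neg_zero, add_zero, zero_add]
  simp only [inner_add_left, inner_add_right, real_inner_comm a b] at hc
  simp only [hab] at hN ⊢
  -- Only the Gram matrix of a and b and the coefficients of the velocities remain. N below is the
  -- Gram determinant |a × b|².
  generalize inner ℝ a a = x at *
  generalize inner ℝ a b = y at *
  generalize inner ℝ b b = z at *
  have f1 : y * y - x * z = -(x * z - y * y) := by ring
  have f2 : y * y - z * x = -(x * z - y * y) := by ring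
  have f3 : z * x - y * y = x * z - y * y := by ring
  have f4 : y * x - x * y = 0 := by ring
  have f5 : x * y - y * x = 0 := by ring
  have f6 : y * z - z * y = 0 := by ring
  have f7 : z * y - y * z = 0 := by ring
  simp only [f1, f2, f3, f4, f5, f6, f7, mul_zero, add_zero, zero_add]
  generalize hNd : x * z - y * y = N at *
  field_simp
  rw [← hNd]
  ring

/-- With r and s the real and imaginary parts of the dihedral angle, the left side is |e|(s'r -
sr'). The right side is |e × q|²|e × p|²|e|² times the difference of the spins of p and q. -/
theorem turning_identity (e q p e' q' p' : Vec) :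
    inner ℝ e e' * triple e q p * inner ℝ (cross e q) (cross e p) +
      inner ℝ e e * ((triple e' q p + triple e q' p + triple e q p') *
          inner ℝ (cross e q) (cross e p) -
        triple e q p * (inner ℝ (cross e' q + cross e q') (cross e p) +
          inner ℝ (cross e q) (cross e' p + cross e p'))) =
    inner ℝ (cross e q) (cross e q) *
        (inner ℝ e e * inner ℝ p' (cross e p) - inner ℝ e p * inner ℝ e' (cross e p)) -
      inner ℝ (cross e p) (cross e p) *
        (inner ℝ e e * inner ℝ q' (cross e q) - inner ℝ e q * inner ℝ e' (cross e q)) := by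
  simp only [inner_coord, triple_coord, PiLp.add_apply, cross_apply_zero, cross_apply_one, cross_apply_two]
  ring

end

section

/-! ### Lengths and dihedral angles as functions -/

/-- The cross product as a continuous bilinear map. -/
def crossL : Vec →L[ℝ] Vec →L[ℝ] Vec :=
  (LinearMap.mk₂ ℝ cross add_cross smul_cross cross_add cross_smul).toContinuousBilinearMap

theorem crossL_apply (u v : Vec) : crossL u v = cross u v := by
  rw [crossL, LinearMap.toContinuousBilinearMap_apply, LinearMap.mk₂_apply]

section Calculus

variable {E : Type*} [NormedAddCommGroup E] [NormedSpace ℝ E]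

theorem hasFDerivAt_cross (f g : E →L[ℝ] Vec) (x : E) :
    ∃ L : E →L[ℝ] Vec, HasFDerivAt (fun y => cross (f y) (g y)) L x ∧
      ∀ u, L u = cross (f u) (g x) + cross (f x) (g u) := by
  have h := crossL.hasFDerivAt_of_bilinear (f.hasFDerivAt (x := x)) (g.hasFDerivAt (x := x))
  simp only [crossL_apply] at h
  exact ⟨_, h, fun u => by simp [crossL_apply, add_comm]⟩

theorem hasFDerivAt_inner {f g : E → Vec} {f' g' : E →L[ℝ] Vec} {x : E}
    (hf : HasFDerivAt f f' x) (hg : HasFDerivAt g g' x) :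
    ∃ L : E →L[ℝ] ℝ, HasFDerivAt (fun y => inner ℝ (f y) (g y)) L x ∧
      ∀ u, L u = inner ℝ (f' u) (g x) + inner ℝ (f x) (g' u) :=
  ⟨_, hf.inner ℝ hg, fun u => by simp [fderivInnerCLM_apply, add_comm]⟩

theorem hasFDerivAt_norm (e : E →L[ℝ] Vec) {x : E} (h : e x ≠ 0) :
    ∃ L : E →L[ℝ] ℝ, HasFDerivAt (fun y => ‖e y‖) L x ∧
      ∀ u, L u = inner ℝ (e x) (e u) / ‖e x‖ := by
  have h1 := (e.hasFDerivAt (x := x)).norm_sq.sqrt (by positivity)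
  simp only [Real.sqrt_sq (norm_nonneg _)] at h1
  refine ⟨_, h1, fun u => ?_⟩
  have := norm_ne_zero_iff.2 h
  simp
  field_simp

theorem contDiffAt_norm_comp (e : E →L[ℝ] Vec) {x : E} (h : e x ≠ 0) {m : WithTop ℕ∞} :
    ContDiffAt ℝ m (fun y => ‖e y‖) x :=
  (contDiffAt_norm ℝ h).comp x e.contDiff.contDiffAt

/-- The real part of a complex number whose argument is the dihedral angle. -/
def dihedralRe (e q p : Vec) : ℝ := inner ℝ (cross e q) (cross e p)

/-- The imaginary part of a complex number whose argument is the dihedral angle. -/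
def dihedralIm (e q p : Vec) : ℝ := ‖e‖ * triple e q p

/-- Multiplication by the positive number |e|² does not change the argument. It removes the
denominators of the orthogonal components. -/
theorem dihedral_eq {e : Vec} (he : e ≠ 0) (q p : Vec) :
    dihedral e q p = (Complex.arg ⟨dihedralRe e q p, dihedralIm e q p⟩ : Real.Angle) := by
  have hn : 0 < ‖e‖ := norm_pos_iff.2 he
  rw [dihedral, ← Complex.arg_real_mul _ (pow_pos hn 2)]
  congr 3
  apply Complex.ext
  · simp only [Complex.re_ofReal_mul, dihedralRe, orthComponent, inner_cross_cross,
      inner_sub_left, inner_sub_right, real_inner_smul_left, real_inner_smul_right,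
      real_inner_self_eq_norm_sq, real_inner_comm e q]
    field_simp
    ring
  · simp only [Complex.im_ofReal_mul, dihedralIm, triple_eq_inner_cross, real_inner_smul_left]
    field_simp

theorem dihedralRe_sq_add_dihedralIm_sq (e q p : Vec) :
    dihedralRe e q p ^ 2 + dihedralIm e q p ^ 2 =
      inner ℝ (cross e q) (cross e q) * inner ℝ (cross e p) (cross e p) := by
  rw [dihedralIm, mul_pow, ← real_inner_self_eq_norm_sq, dihedralRe]
  simp only [inner_coord, triple_coord, cross_apply_zero, cross_apply_one, cross_apply_two]
  ring

/-- The product of z with the conjugate of w has the difference of the arguments as argument, and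
positive real part, so the difference is an arctangent without ambiguity. This is the smooth local
branch of the angle. -/
theorem arctan_eq_toReal_arg_sub {z w : ℂ} (h : 0 < z.re * w.re + z.im * w.im) :
    ((z.arg : Real.Angle) - w.arg).toReal =
      Real.arctan ((z.im * w.re - z.re * w.im) / (z.re * w.re + z.im * w.im)) := by
  have hz : z ≠ 0 := fun hz => by simp [hz] at h
  have hw : w ≠ 0 := fun hw => by simp [hw] at h
  have hre : (z * (starRingEnd ℂ) w).re = z.re * w.re + z.im * w.im := by simp
  have him : (z * (starRingEnd ℂ) w).im = z.im * w.re - z.re * w.im := by simp; ring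
  have habs := abs_lt.1 (Complex.abs_arg_lt_pi_div_two_iff.2
    (Or.inl (by rwa [hre] : 0 < (z * (starRingEnd ℂ) w).re)))
  rw [← hre, ← him, ← Complex.tan_arg, Real.arctan_tan habs.1 habs.2, sub_eq_add_neg,
    ← Complex.arg_conj_coe_angle, ← Complex.arg_mul_coe_angle hz
      ((map_ne_zero (starRingEnd ℂ)).2 hw), Real.Angle.toReal_coe_eq_self_iff]
  exact ⟨by linarith [Real.pi_pos], by linarith [Real.pi_pos]⟩

/-- The dihedral angle relative to a base point, as a real-valued function. -/
def relativeAngle (e q p : E →L[ℝ] Vec) (x y : E) : ℝ :=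
  Real.arctan ((dihedralIm (e y) (q y) (p y) * dihedralRe (e x) (q x) (p x) -
      dihedralRe (e y) (q y) (p y) * dihedralIm (e x) (q x) (p x)) /
    (dihedralRe (e y) (q y) (p y) * dihedralRe (e x) (q x) (p x) +
      dihedralIm (e y) (q y) (p y) * dihedralIm (e x) (q x) (p x)))

variable {e q p : E →L[ℝ] Vec} {x : E}

theorem contDiff_dihedralRe {m : WithTop ℕ∞} :
    ContDiff ℝ m fun y => dihedralRe (e y) (q y) (p y) :=
  (ContDiff.cross e.contDiff q.contDiff).inner ℝ (ContDiff.cross e.contDiff p.contDiff)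

theorem contDiffAt_dihedralIm {m : WithTop ℕ∞} (h : e x ≠ 0) :
    ContDiffAt ℝ m (fun y => dihedralIm (e y) (q y) (p y)) x := by
  simp only [dihedralIm, triple_eq_inner_cross]
  exact (contDiffAt_norm_comp e h).mul
    (e.contDiff.inner ℝ (ContDiff.cross q.contDiff p.contDiff)).contDiffAt

theorem dihedral_pos (hq : cross (e x) (q x) ≠ 0) (hp : cross (e x) (p x) ≠ 0) :
    0 < dihedralRe (e x) (q x) (p x) * dihedralRe (e x) (q x) (p x) +
      dihedralIm (e x) (q x) (p x) * dihedralIm (e x) (q x) (p x) := by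
  rw [← sq, ← sq, dihedralRe_sq_add_dihedralIm_sq]
  exact mul_pos (inner_self_pos hq) (inner_self_pos hp)

theorem eventually_dihedral_pos (hq : cross (e x) (q x) ≠ 0) (hp : cross (e x) (p x) ≠ 0) :
    ∀ᶠ y in 𝓝 x, e y ≠ 0 ∧ 0 < dihedralRe (e y) (q y) (p y) * dihedralRe (e x) (q x) (p x) +
      dihedralIm (e y) (q y) (p y) * dihedralIm (e x) (q x) (p x) := by
  have he := cross_ne_zero_left hq
  refine (e.continuous.continuousAt.eventually_ne he).and ?_
  have h1 : ContinuousAt (fun y => dihedralRe (e y) (q y) (p y)) x :=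
    (contDiff_dihedralRe (m := 0)).continuous.continuousAt
  have h2 : ContinuousAt (fun y => dihedralIm (e y) (q y) (p y)) x :=
    (contDiffAt_dihedralIm (m := 0) he).continuousAt
  exact ((h1.mul continuousAt_const).add (h2.mul continuousAt_const)).eventually_const_lt
    (dihedral_pos hq hp)

theorem eventually_contDiffAt_relativeAngle (hq : cross (e x) (q x) ≠ 0)
    (hp : cross (e x) (p x) ≠ 0) :
    ∀ᶠ y in 𝓝 x, ContDiffAt ℝ ∞ (relativeAngle e q p x) y := by
  filter_upwards [eventually_dihedral_pos hq hp] with y hy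
  have h1 : ContDiffAt ℝ ∞ (fun y => dihedralRe (e y) (q y) (p y)) y :=
    contDiff_dihedralRe.contDiffAt
  have h2 : ContDiffAt ℝ ∞ (fun y => dihedralIm (e y) (q y) (p y)) y :=
    contDiffAt_dihedralIm hy.1
  exact (((h2.mul contDiffAt_const).sub (h1.mul contDiffAt_const)).div
    ((h1.mul contDiffAt_const).add (h2.mul contDiffAt_const)) hy.2.ne').arctan

theorem eventually_toReal_dihedral_sub (hq : cross (e x) (q x) ≠ 0)
    (hp : cross (e x) (p x) ≠ 0) :
    ∀ᶠ y in 𝓝 x, (dihedral (e y) (q y) (p y) - dihedral (e x) (q x) (p x)).toReal =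
      relativeAngle e q p x y := by
  filter_upwards [eventually_dihedral_pos hq hp] with y hy
  rw [dihedral_eq hy.1, dihedral_eq (cross_ne_zero_left hq), arctan_eq_toReal_arg_sub hy.2,
    relativeAngle]

theorem hasFDerivAt_relativeAngle (hq : cross (e x) (q x) ≠ 0) (hp : cross (e x) (p x) ≠ 0) :
    ∃ L : E →L[ℝ] ℝ, HasFDerivAt (relativeAngle e q p x) L x ∧
      ∀ u, L u = ‖e x‖ * (spin (e x) (p x) (e u) (p u) - spin (e x) (q x) (e u) (q u)) := by
  have he := cross_ne_zero_left hq
  obtain ⟨Lq, hLq, hLq'⟩ := hasFDerivAt_cross e q x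
  obtain ⟨Lp, hLp, hLp'⟩ := hasFDerivAt_cross e p x
  obtain ⟨Lqp, hLqp, hLqp'⟩ := hasFDerivAt_cross q p x
  obtain ⟨R, hR, hR'⟩ := hasFDerivAt_inner hLq hLp
  obtain ⟨T, hT, hT'⟩ := hasFDerivAt_inner e.hasFDerivAt hLqp
  obtain ⟨N, hN, hN'⟩ := hasFDerivAt_norm e he
  simp only [← triple_eq_inner_cross] at hT
  have hI : HasFDerivAt (fun y => dihedralIm (e y) (q y) (p y))
      (‖e x‖ • T + triple (e x) (q x) (p x) • N) x := hN.mul hT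
  have hRe : HasFDerivAt (fun y => dihedralRe (e y) (q y) (p y)) R x := hR
  have hpos := dihedral_pos hq hp
  have hsq := dihedralRe_sq_add_dihedralIm_sq (e x) (q x) (p x)
  set r := dihedralRe (e x) (q x) (p x) with hr
  set s := dihedralIm (e x) (q x) (p x) with hs
  have hden : HasFDerivAt (fun y => dihedralRe (e y) (q y) (p y) * r +
      dihedralIm (e y) (q y) (p y) * s) _ x := (hRe.mul_const r).add (hI.mul_const s)
  have hinv := (hden.differentiableAt.fun_inv hpos.ne').hasFDerivAt
  have hnum : HasFDerivAt (fun y => dihedralIm (e y) (q y) (p y) * r -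
      dihedralRe (e y) (q y) (p y) * s) _ x := (hI.mul_const r).sub (hRe.mul_const s)
  have h := (hnum.mul hinv).arctan
  refine ⟨_, h, fun u => ?_⟩
  have hid := turning_identity (e x) (q x) (p x) (e u) (q u) (p u)
  have hn := norm_ne_zero_iff.2 he
  have hee : inner ℝ (e x) (e x) = ‖e x‖ ^ 2 := real_inner_self_eq_norm_sq _
  have hQ := (inner_self_pos hq).ne'
  have hP := (inner_self_pos hp).ne'
  -- At the base point the numerator of the arctangent's argument is zero, so only its derivative
  -- contributes.
  have h0 : s * r - r * s = 0 := by ring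
  have h1 : R u = inner ℝ (cross (e u) (q x) + cross (e x) (q u)) (cross (e x) (p x)) +
      inner ℝ (cross (e x) (q x)) (cross (e u) (p x) + cross (e x) (p u)) := by
    rw [hR', hLq', hLp']
  have h2 : T u = triple (e u) (q x) (p x) + triple (e x) (q u) (p x) +
      triple (e x) (q x) (p u) := by
    rw [hT', hLqp', inner_add_right, triple_eq_inner_cross, triple_eq_inner_cross,
      triple_eq_inner_cross, ← add_assoc]
  simp only [Pi.mul_apply, ← hr, ← hs, h0, smul_apply, add_apply, sub_apply, smul_eq_mul, hN', h1, h2, zero_mul]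
  rw [← sq r, ← sq s, hsq]
  simp only [spin, inner_sub_left, real_inner_smul_left]
  rw [show inner ℝ (cross (e x) (q x)) (cross (e x) (p x)) = r from rfl] at hid
  rw [hee] at hid ⊢
  rw [hs, dihedralIm]
  rw [zero_pow two_ne_zero, add_zero, div_one, one_mul, zero_add]
  generalize inner ℝ (cross (e u) (q x) + cross (e x) (q u)) (cross (e x) (p x)) +
      inner ℝ (cross (e x) (q x)) (cross (e u) (p x) + cross (e x) (p u)) = A at *
  generalize triple (e u) (q x) (p x) + triple (e x) (q u) (p x) +
      triple (e x) (q x) (p u) = B at *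
  field_simp
  linear_combination hid

end Calculus

end

section

variable {n : ℕ} {ℓ : Fin n → ℝ}

/-! ### The symplectic form as a sum over the faces of a triangulation -/

/-- The edge from vertex `i` to vertex `j`, as a function of the polygon. -/
def edgeL (i j : Fin n) : (Fin n → Vec) →L[ℝ] Vec :=
  ∑ m ∈ Finset.Iio j, ContinuousLinearMap.proj m - ∑ m ∈ Finset.Iio i, ContinuousLinearMap.proj m

theorem edgeL_apply (i j : Fin n) (y : Fin n → Vec) : edgeL i j y = vertex y j - vertex y i := by
  simp [edgeL, vertex]

theorem edgeL_add (i k j : Fin n) (y : Fin n → Vec) :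
    edgeL i k y + edgeL k j y = edgeL i j y := by
  simp only [edgeL_apply]; abel

theorem edgeL_swap (i j : Fin n) (y : Fin n → Vec) : edgeL j i y = -edgeL i j y := by
  simp only [edgeL_apply, neg_sub]

theorem edgeL_side {i j : Fin n} (h : (j : ℕ) = i + 1) (y : Fin n → Vec) : edgeL i j y = y i := by
  have : Finset.Iio j = insert i (Finset.Iio i) := by
    ext m
    simp only [Finset.mem_Iio, Finset.mem_insert, Fin.lt_def, Fin.ext_iff]
    omega
  rw [edgeL_apply, vertex, vertex, this, Finset.sum_insert (by simp), add_sub_cancel_right]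

theorem sum_eq_sum_Ico_add {A : Type*} [AddCommMonoid A] {i j : Fin n} (hi : (i : ℕ) = 0)
    (hj : (j : ℕ) + 1 = n) (f : Fin n → A) : ∑ m, f m = ∑ m ∈ Finset.Ico i j, f m + f j := by
  have : (Finset.univ : Finset (Fin n)) = insert j (Finset.Ico i j) := by
    ext m
    simp only [Finset.mem_univ, Finset.mem_Ico, Finset.mem_insert, Fin.le_def, Fin.lt_def,
      Fin.ext_iff, true_iff]
    omega
  rw [this, Finset.sum_insert (by simp), add_comm]

theorem edgeL_root {i j : Fin n} (hi : (i : ℕ) = 0) (hj : (j : ℕ) + 1 = n) {y : Fin n → Vec}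
    (hy : ∑ m, y m = 0) : edgeL i j y = -y j := by
  rw [sum_eq_sum_Ico_add hi hj] at hy
  have h1 : Finset.Iio i = ∅ := by
    rw [Finset.eq_empty_iff_forall_notMem]
    intro m hm
    rw [Finset.mem_Iio, Fin.lt_def] at hm
    omega
  have h2 : Finset.Iio j = Finset.Ico i j := by
    ext m
    simp only [Finset.mem_Iio, Finset.mem_Ico, Fin.le_def]
    omega
  rw [edgeL_apply, vertex, vertex, h1, h2, Finset.sum_empty, sub_zero, eq_neg_iff_add_eq_zero, hy]

namespace Triangulation

variable (T : Triangulation n)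

/-- The contribution of an edge to a sum over the edges of a face with third vertex `k`. -/
def edgeTerm (x u v : Fin n → Vec) (i j k : Fin n) : ℝ :=
  edgeForm (edgeL i j x) (edgeL i k x) (edgeL i j u) (edgeL i k u) (edgeL i j v) (edgeL i k v)

theorem edgeTerm_face {x : Fin n → Vec} {i k j : Fin n}
    (h : cross (edgeL i k x) (edgeL k j x) ≠ 0) (u v : Fin n → Vec) :
    edgeTerm x u v i j k = edgeTerm x u v i k j + edgeTerm x u v k j i := by
  have := edgeForm_add h (edgeL i k u) (edgeL k j u) (edgeL i k v) (edgeL k j v)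
  simp only [edgeL_add] at this
  simp only [edgeTerm, this, edgeL_swap i k]

variable {T}

/-- The length of a side is fixed, so its velocity is orthogonal to it. Hence the spin terms drop
out of its edge term, which no longer depends on the face. -/
theorem inner_edgeL_of_notMem {x u : Fin n → Vec} (hx : ∑ m, x m = 0) (hu : IsTangent x u)
    {i j : Fin n} (he : T.IsEdge i j) (hd : (i, j) ∉ T.diagonals) :
    inner ℝ (edgeL i j x) (edgeL i j u) = 0 := by
  rcases he with h | ⟨h, h'⟩ | h
  · rw [edgeL_side h, edgeL_side h, hu.1]
  · rw [edgeL_root h h' hx, edgeL_root h h' hu.2, inner_neg_neg, hu.1]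
  · exact absurd h hd

/-- The term of an edge which does not depend on the face. -/
def sideTerm (x u v : Fin n → Vec) (i j : Fin n) : ℝ :=
  triple (edgeL i j x) (edgeL i j u) (edgeL i j v) / inner ℝ (edgeL i j x) (edgeL i j x)

theorem edgeTerm_of_notMem {x u v : Fin n → Vec} (hx : ∑ m, x m = 0) (hu : IsTangent x u)
    (hv : IsTangent x v) {i j : Fin n} (he : T.IsEdge i j) (hd : (i, j) ∉ T.diagonals)
    (k : Fin n) : edgeTerm x u v i j k = sideTerm x u v i j := by
  rw [edgeTerm, edgeForm, inner_edgeL_of_notMem hx hu he hd, inner_edgeL_of_notMem hx hv he hd]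
  simp [sideTerm]

variable (T)

/-- The derivative of half the length of a diagonal, multiplied by twice the length. -/
def lengthRate (x u : Fin n → Vec) (a : T.Internal) : ℝ :=
  inner ℝ (edgeL a.1.1 a.1.2 x) (edgeL a.1.1 a.1.2 u)

/-- The derivative of the dihedral angle at a diagonal, divided by the length. -/
def angleRate (x u : Fin n → Vec) (a : T.Internal) : ℝ :=
  spin (edgeL a.1.1 a.1.2 x) (edgeL a.1.1 (T.innerApex a) x) (edgeL a.1.1 a.1.2 u)
      (edgeL a.1.1 (T.innerApex a) u) -
    spin (edgeL a.1.1 a.1.2 x) (edgeL a.1.1 (T.outerApex a) x) (edgeL a.1.1 a.1.2 u)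
      (edgeL a.1.1 (T.outerApex a) u)

/-- The faces of the polygon are nondegenerate triangles. -/
def NondegenerateFaces (x : Fin n → Vec) : Prop :=
  ∀ i k j, T.IsFace i k j → cross (edgeL i k x) (edgeL k j x) ≠ 0

/-- The edge terms are additive on each face. Summed over the faces they leave the sphere forms at
the sides and, at each diagonal, the jump between the terms seen from its two faces, in which the
triple products cancel. -/
theorem orbitForm_eq_sum_diagonals (hn : 3 ≤ n) {x u v : Fin n → Vec}
    (hx : x ∈ closedPolygons ℓ) (hf : T.NondegenerateFaces x) (hu : IsTangent x u)
    (hv : IsTangent x v) :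
    orbitForm ℓ x u v = ∑ a : T.Internal, 1 / 2 *
      (T.lengthRate x u a * T.angleRate x v a - T.lengthRate x v a * T.angleRate x u a) := by
  classical
  let Hin : Fin n × Fin n → ℝ := fun a => if h : a ∈ T.diagonals then
    edgeTerm x u v a.1 a.2 (T.innerApex ⟨a, h⟩) else sideTerm x u v a.1 a.2
  let Hout : Fin n × Fin n → ℝ := fun a => if h : a ∈ T.diagonals then
    edgeTerm x u v a.1 a.2 (T.outerApex ⟨a, h⟩) else sideTerm x u v a.1 a.2
  have hin : ∀ i k j, T.IsFace i k j → Hin (i, j) = edgeTerm x u v i j k := by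
    intro i k j h
    by_cases hd : (i, j) ∈ T.diagonals
    · simp only [Hin, dif_pos hd]
      rw [(T.innerApex_spec hn ⟨(i, j), hd⟩).inner_unique h]
    · simp only [Hin, dif_neg hd, edgeTerm_of_notMem hx.2 hu hv h.2.2.2.2 hd]
  have hout : ∀ i j k, T.IsEdge i j → (T.IsFace k i j ∨ T.IsFace i j k) →
      Hout (i, j) = edgeTerm x u v i j k := by
    intro i j k he h
    by_cases hd : (i, j) ∈ T.diagonals
    · simp only [Hout, dif_pos hd]
      rw [IsFace.outer_unique (T.outerApex_spec hn ⟨(i, j), hd⟩) h]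
    · simp only [Hout, dif_neg hd, edgeTerm_of_notMem hx.2 hu hv he hd]
  obtain ⟨i, j, hi, hj, hfull, he, hD⟩ := T.root_spec hn
  have hsum := Full.sum_faces (T := T) (Hin := Hin) (Hout := Hout)
    (h := fun m => triple (x m) (u m) (v m) / inner ℝ (x m) (x m)) (fun i k j h => by
      rw [hin i k j h, hout i k j h.2.2.1 (Or.inr h), hout k j i h.2.2.2.1 (Or.inl h),
        edgeTerm_face (hf i k j h)]) (fun i k h => by
      have hd : (i, k) ∉ T.diagonals := fun hd => by
        have := (T.isDiagonal _ hd).1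
        simp only at this
        omega
      simp only [Hout, dif_neg hd, sideTerm, edgeL_side h]) _ i j rfl hfull he
  rw [hD] at hsum
  -- The edge from vertex 0 to vertex n - 1 is minus the last vector. The cubic numerator changes
  -- sign, which supplies the missing summand of the orbit form.
  have hroot : Hin (i, j) = -(triple (x j) (u j) (v j) / inner ℝ (x j) (x j)) := by
    have hd : (i, j) ∉ T.diagonals := fun hd => (T.isDiagonal _ hd).2 ⟨hi, hj⟩
    simp only [Hin, dif_neg hd, sideTerm, edgeL_root hi hj hx.2, edgeL_root hi hj hu.2,
      edgeL_root hi hj hv.2, triple_coord, inner_neg_neg, PiLp.neg_apply]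
    ring
  have hdiag : ∑ a ∈ T.diagonals, (Hout a - Hin a) = ∑ a : T.Internal,
      (T.lengthRate x u a * T.angleRate x v a - T.lengthRate x v a * T.angleRate x u a) := by
    rw [← Finset.sum_coe_sort T.diagonals]
    refine Finset.sum_congr rfl fun a _ => ?_
    simp only [Hin, Hout, dif_pos a.2, edgeTerm, edgeForm, lengthRate, angleRate]
    ring
  have horb : orbitForm ℓ x u v =
      -(1 / 2) * ∑ m, triple (x m) (u m) (v m) / inner ℝ (x m) (x m) := by
    rw [orbitForm, Finset.mul_sum]
    refine Finset.sum_congr rfl fun m _ => ?_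
    rw [real_inner_self_eq_norm_sq, hx.1]
    ring
  rw [horb, sum_eq_sum_Ico_add hi hj, ← Finset.mul_sum]
  rw [hroot, hdiag] at hsum
  linarith

/-! ### Regular polygons -/

theorem edgeLength_add_single (ℓ : Fin n → ℝ) (d : T.Internal → ℝ) (a : T.Internal) (t : ℝ)
    (i j : Fin n) : T.edgeLength ℓ (d + t • Pi.single a 1) i j =
      T.edgeLength ℓ d i j + t * if (i, j) = a.1 then 1 else 0 := by
  unfold edgeLength
  by_cases h : (i, j) ∈ T.diagonals
  · simp only [dif_pos h, Pi.add_apply, Pi.smul_apply, Pi.single_apply, smul_eq_mul, Subtype.ext_iff]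
  · have h0 : (if (i, j) = a.1 then (1 : ℝ) else 0) = 0 := by
      rw [if_neg]
      rintro h'
      exact h (by rw [h']; exact a.2)
    rw [dif_neg h, dif_neg h, h0, mul_zero, add_zero]

theorem exists_diagonal_of_isFace (hn : 4 ≤ n) {i k j : Fin n} (h : T.IsFace i k j) :
    (i, k) ∈ T.diagonals ∨ (k, j) ∈ T.diagonals ∨ (i, j) ∈ T.diagonals := by
  by_contra! hd
  obtain ⟨h1, h2, h3, h4, h5⟩ := h
  rw [Fin.lt_def] at h1 h2
  have h3 := h3.imp id fun h => h.resolve_right hd.1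
  have h4 := h4.imp id fun h => h.resolve_right hd.2.1
  have h5 := h5.imp id fun h => h.resolve_right hd.2.2
  have := j.2
  omega

variable {T}

/-- The triangle inequalities are strict in the interior of the polyhedron. -/
theorem face_inequality_strict (hn : 4 ≤ n) {d : T.Internal → ℝ}
    (hd : d ∈ interior (T.polyhedron ℓ)) {i k j : Fin n} (h : T.IsFace i k j) {r s t : ℝ}
    (hr : r ≠ 0) (hs : s ≠ 0) (ht : t ≠ 0)
    (hle : ∀ d ∈ T.polyhedron ℓ, 0 ≤ r * T.edgeLength ℓ d i k + s * T.edgeLength ℓ d k j +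
      t * T.edgeLength ℓ d i j) :
    0 < r * T.edgeLength ℓ d i k + s * T.edgeLength ℓ d k j + t * T.edgeLength ℓ d i j := by
  refine lt_of_le_of_ne (hle d (interior_subset hd)) fun h0 => ?_
  have hik := h.1.ne
  have hkj := h.2.1.ne
  -- The three edges of a face are distinct and one of them is a diagonal a. Varying its length
  -- alone changes the linear expression with nonzero slope c.
  obtain ⟨a, c, hc, hac⟩ : ∃ (a : T.Internal) (c : ℝ), c ≠ 0 ∧
      r * (if (i, k) = a.1 then 1 else 0) + s * (if (k, j) = a.1 then 1 else 0) +
        t * (if (i, j) = a.1 then 1 else 0) = c := by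
    rcases T.exists_diagonal_of_isFace hn h with ha | ha | ha
    · exact ⟨⟨_, ha⟩, r, hr, by simp [hik.symm, hkj.symm]⟩
    · exact ⟨⟨_, ha⟩, s, hs, by simp [hik, hkj]⟩
    · exact ⟨⟨_, ha⟩, t, ht, by simp [hik.symm, hkj]⟩
  have hcont : Continuous fun τ : ℝ => d + τ • (Pi.single a 1 : T.Internal → ℝ) := by fun_prop
  have hev : ∀ᶠ τ : ℝ in 𝓝 0, d + τ • (Pi.single a 1 : T.Internal → ℝ) ∈ T.polyhedron ℓ := by
    refine hcont.continuousAt.eventually_mem ?_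
    rw [zero_smul, add_zero]
    exact mem_interior_iff_mem_nhds.1 hd
  have hpos : ∀ᶠ τ : ℝ in 𝓝 0, 0 ≤ τ * c := by
    filter_upwards [hev] with τ hτ
    have := hle _ hτ
    simp only [edgeLength_add_single] at this
    rw [← hac]
    linarith
  obtain ⟨ε, hε, hb⟩ := Metric.eventually_nhds_iff.1 hpos
  have hcc : 0 < |c| := abs_pos.2 hc
  -- A step of size ε/2 against the sign of c would make an expression that vanishes at d negative
  -- inside the polyhedron.
  have := @hb (-(ε / 2) * (c / |c|)) (by
    rw [dist_zero_right, Real.norm_eq_abs, abs_mul, abs_div, abs_abs, div_self hcc.ne', mul_one,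
      abs_neg, abs_of_pos (half_pos hε)]
    linarith)
  have h2 : c / |c| * c = |c| := by
    rw [div_mul_eq_mul_div, ← abs_mul_abs_self, mul_div_assoc, div_self hcc.ne', mul_one]
  rw [mul_assoc, h2] at this
  nlinarith

/-- If a × b = 0, then a·b = ±|a||b|, so one of the triangle inequalities is an equality. -/
theorem cross_ne_zero_of_norm {a b : Vec} (h1 : ‖a‖ < ‖b‖ + ‖a + b‖) (h2 : ‖b‖ < ‖a‖ + ‖a + b‖)
    (h3 : ‖a + b‖ < ‖a‖ + ‖b‖) : cross a b ≠ 0 := by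
  intro h
  have h4 := inner_cross_cross a b a b
  rw [h, inner_zero_left, real_inner_comm a b, real_inner_self_eq_norm_sq,
    real_inner_self_eq_norm_sq] at h4
  have h5 := norm_add_sq_real a b
  have h6 : (inner ℝ a b - ‖a‖ * ‖b‖) * (inner ℝ a b + ‖a‖ * ‖b‖) = 0 := by
    linear_combination h4
  rcases mul_eq_zero.1 h6 with h7 | h7
  · nlinarith [norm_nonneg a, norm_nonneg b, norm_nonneg (a + b)]
  · have h8 : (‖a + b‖ - (‖a‖ - ‖b‖)) * (‖a + b‖ + (‖a‖ - ‖b‖)) = 0 := by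
      linear_combination h5 + 2 * h7
    rcases mul_eq_zero.1 h8 with h9 | h9 <;> linarith

theorem edgeLength_eq_norm {x : closedPolygons ℓ} {i j : Fin n} (he : T.IsEdge i j) :
    T.edgeLength ℓ (fun a => T.length a (polygonClass x)) i j = ‖edgeL i j x.1‖ := by
  unfold edgeLength
  split_ifs with h1 h2
  · rw [edgeL_apply]; rfl
  · rw [edgeL_side h2, x.2.1]
  · rcases he with h | ⟨h, h'⟩ | h
    · exact absurd h h2
    · rw [edgeL_root h h' x.2.2, norm_neg, x.2.1]
    · exact absurd h h1

theorem nondegenerateFaces_of_regular (hn : 4 ≤ n) {x : closedPolygons ℓ}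
    (h : (fun a => T.length a (polygonClass x)) ∈ interior (T.polyhedron ℓ)) :
    T.NondegenerateFaces x.1 := by
  intro i k j hf
  have h1 := face_inequality_strict hn h hf (r := -1) (s := 1) (t := 1) (by norm_num) (by norm_num)
    (by norm_num) fun d hd => by
      have := (abs_le.1 (hd.2 _ _ _ hf).1).2
      linarith
  have h2 := face_inequality_strict hn h hf (r := 1) (s := -1) (t := 1) (by norm_num) (by norm_num)
    (by norm_num) fun d hd => by
      have := (abs_le.1 (hd.2 _ _ _ hf).1).1
      linarith
  have h3 := face_inequality_strict hn h hf (r := 1) (s := 1) (t := -1) (by norm_num) (by norm_num)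
    (by norm_num) fun d hd => by
      have := (hd.2 _ _ _ hf).2
      linarith
  obtain ⟨-, -, e1, e2, e3⟩ := hf
  rw [edgeLength_eq_norm e1, edgeLength_eq_norm e2, edgeLength_eq_norm e3, ← edgeL_add i k j]
    at h1 h2 h3
  exact cross_ne_zero_of_norm (by linarith) (by linarith) (by linarith)

/-- The vectors from a diagonal to its two apexes are not parallel to it. -/
theorem NondegenerateFaces.cross_apex_ne_zero (hn : 3 ≤ n) {x : Fin n → Vec}
    (h : T.NondegenerateFaces x) (a : T.Internal) :
    cross (edgeL a.1.1 a.1.2 x) (edgeL a.1.1 (T.outerApex a) x) ≠ 0 ∧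
      cross (edgeL a.1.1 a.1.2 x) (edgeL a.1.1 (T.innerApex a) x) ≠ 0 := by
  have hin := h _ _ _ (T.innerApex_spec hn a)
  refine ⟨?_, ?_⟩
  · rcases T.outerApex_spec hn a with h1 | h1
    · have := h _ _ _ h1
      rw [edgeL_swap (T.outerApex a) a.1.1, cross_neg, cross_swap, neg_neg]
      exact this
    · have := h _ _ _ h1
      rwa [← edgeL_add a.1.1 a.1.2 (T.outerApex a), cross_add, cross_self, zero_add]
  · rwa [← edgeL_add a.1.1 (T.innerApex a) a.1.2, add_cross, cross_self, zero_add, cross_swap,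
      neg_ne_zero]

end Triangulation

end

section

variable {n : ℕ} {ℓ : Fin n → ℝ}

/-! ### Action-angle coordinates -/

section InverseFunction

variable {E F : Type*} [NormedAddCommGroup E] [NormedSpace ℝ E] [FiniteDimensional ℝ E]
  [NormedAddCommGroup F] [NormedSpace ℝ F] [FiniteDimensional ℝ F]

/-- The inverse function theorem for smooth maps, as a partial diffeomorphism inside a given
neighbourhood. -/
theorem exists_partialDiffeomorph {G : E → F} {x : E} (hG : ∀ᶠ y in 𝓝 x, ContDiffAt ℝ ∞ G y)
    (hinj : Function.Injective (fderiv ℝ G x))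
    (hdim : Module.finrank ℝ E = Module.finrank ℝ F) {U : Set E} (hU : U ∈ 𝓝 x) :
    ∃ Φ : PartialDiffeomorph 𝓘(ℝ, E) 𝓘(ℝ, F) E F ∞,
      x ∈ Φ.source ∧ Φ.source ⊆ U ∧ ∀ y, Φ y = G y := by
  have hne : (∞ : WithTop ℕ∞) ≠ 0 := by simp
  have : CompleteSpace E := FiniteDimensional.complete ℝ E
  let e : E ≃L[ℝ] F :=
    (LinearEquiv.ofInjectiveOfFinrankEq (fderiv ℝ G x : E →ₗ[ℝ] F) hinj hdim).toContinuousLinearEquiv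
  have he : (e : E →L[ℝ] F) = fderiv ℝ G x := by
    ext v; rfl
  have hGx := hG.self_of_nhds
  have hd : HasFDerivAt G (e : E →L[ℝ] F) x := by
    rw [he]
    exact (hGx.differentiableAt hne).hasFDerivAt
  have hc : ContinuousAt (fderiv ℝ G) x :=
    (hGx.fderiv_right (m := 0) (by simp)).continuousAt
  -- Invertibility of the derivative is an open condition. After restriction to such a neighbourhood
  -- the inverse is smooth on its whole domain, not only at one point.
  have hinv : ∀ᶠ y in 𝓝 x, fderiv ℝ G y ∈
      Set.range ((↑) : (E ≃L[ℝ] F) → (E →L[ℝ] F)) := by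
    refine hc.eventually ?_
    rw [← he]
    exact e.nhds
  let Φ := hGx.toOpenPartialHomeomorph G hd hne
  have hxΦ : x ∈ Φ.source := hGx.mem_toOpenPartialHomeomorph_source hd hne
  obtain ⟨W, hW, hWo, hxW⟩ := eventually_nhds_iff.1 ((hG.and hinv).and hU)
  let Ψ := Φ.restrOpen W hWo
  have hsub : ∀ y ∈ Ψ.source, y ∈ W := fun y hy => by
    rw [OpenPartialHomeomorph.restrOpen_source] at hy
    exact hy.2
  have hΨ : ∀ y, Ψ y = G y := fun y => rfl
  refine ⟨⟨Ψ.toPartialEquiv, Ψ.open_source, Ψ.open_target, ?_, ?_⟩, ?_, ?_, hΨ⟩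
  · refine contMDiffOn_iff_contDiffOn.2 fun y hy => ?_
    exact (hW y (hsub y hy)).1.1.contDiffWithinAt
  · refine contMDiffOn_iff_contDiffOn.2 fun z hz => ?_
    have hy := hsub _ (Ψ.map_target hz)
    obtain ⟨e', he'⟩ := (hW _ hy).1.2
    refine (Ψ.contDiffAt_symm (f₀' := e') hz ?_ (hW _ hy).1.1).contDiffWithinAt
    rw [he']
    exact ((hW _ hy).1.1.differentiableAt hne).hasFDerivAt
  · change x ∈ Ψ.source
    rw [OpenPartialHomeomorph.restrOpen_source]
    exact ⟨hxΦ, hxW⟩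
  · exact fun y hy => (hW y (hsub y hy)).2

end InverseFunction

section Manifold

variable [hn : Fact (3 ≤ n)] [hpos : Fact (∀ j, 0 < ℓ j)]

/-- The preferred chart as a partial diffeomorphism. -/
def chartDiffeomorph (p : SmoothPart ℓ) :
    PartialDiffeomorph 𝓘(ℝ, Model n) 𝓘(ℝ, Model n) (SmoothPart ℓ) (Model n) ∞ where
  toPartialEquiv := (sliceAt p).chart.toPartialEquiv
  open_source := (sliceAt p).chart.open_source
  open_target := (sliceAt p).chart.open_target
  contMDiffOn_toFun := contMDiffOn_of_mem_maximalAtlas (sliceAt p).chart_mem_maximalAtlas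
  contMDiffOn_invFun := contMDiffOn_symm_of_mem_maximalAtlas (sliceAt p).chart_mem_maximalAtlas

theorem isLocalDiffeomorphAt_of_lift {V : Type*} [NormedAddCommGroup V] [NormedSpace ℝ V]
    [FiniteDimensional ℝ V] {p : SmoothPart ℓ} {f : SmoothPart ℓ → V} {F : (Fin n → Vec) → V}
    (hf : ∀ᶠ y in 𝓝 (basePolygon p), ∀ (hy : y ∈ closedPolygons ℓ) (hc : NonCollinear y),
      f (smoothClass ⟨y, hy⟩ hc) = F y)
    (hF : ∀ᶠ y in 𝓝 (basePolygon p), ContDiffAt ℝ ∞ F y)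
    (hinj : ∀ u : Model n, fderiv ℝ F (basePolygon p) (tangentLift p u) = 0 → u = 0)
    (hdim : Module.finrank ℝ (Model n) = Module.finrank ℝ V) :
    IsLocalDiffeomorphAt 𝓘(ℝ, Model n) 𝓘(ℝ, V) ∞ f p := by
  have hne : (∞ : WithTop ℕ∞) ≠ 0 := by simp
  have hsec := (sliceAt p).differentiableAt_sec (mem_tgt p)
  have hG : ∀ᶠ v in 𝓝 ((sliceAt p).chart p), ContDiffAt ℝ ∞ (F ∘ (sliceAt p).sec) v := by
    filter_upwards [hsec.continuousAt.eventually hF,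
      (sliceAt p).isOpen_tgt.mem_nhds (mem_tgt p)] with v hv hvt
    exact ContDiffAt.comp v hv
      ((sliceAt p).contDiffOn_sec.contDiffAt ((sliceAt p).isOpen_tgt.mem_nhds hvt))
  have hFd : HasFDerivAt F (fderiv ℝ F (basePolygon p))
      ((sliceAt p).sec ((sliceAt p).chart p)) :=
    (hF.self_of_nhds.differentiableAt hne).hasFDerivAt
  have hGd : fderiv ℝ (F ∘ (sliceAt p).sec) ((sliceAt p).chart p) =
      fderiv ℝ F (basePolygon p) ∘L tangentLift p :=
    (hFd.comp _ hsec.hasFDerivAt).fderiv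
  have hi : Function.Injective (fderiv ℝ (F ∘ (sliceAt p).sec) ((sliceAt p).chart p)) := by
    rw [hGd]
    exact (injective_iff_map_eq_zero _).2 hinj
  obtain ⟨Φ, hxΦ, hΦU, hΦ⟩ := exists_partialDiffeomorph hG hi hdim
    (U := {v | (f ∘ (sliceAt p).chart.symm) v = (F ∘ (sliceAt p).sec) v}) (eventually_eq_lift hf)
  refine ⟨(chartDiffeomorph p).trans Φ, ⟨mem_sliceAt_source p, hxΦ⟩, fun q hq => ?_⟩
  have h1 : q ∈ (sliceAt p).chart.source := hq.1
  have h2 : (sliceAt p).chart q ∈ Φ.source := hq.2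
  have h3 := hΦU h2
  rw [Set.mem_ofPred_eq, Function.comp_apply, (sliceAt p).chart.left_inv h1, ← hΦ] at h3
  exact h3

end Manifold

end

/-! ### Action-angle coordinates on the regular set -/

section

variable {n : ℕ} {ℓ : Fin n → ℝ}

namespace Triangulation

variable (T : Triangulation n) (p : SmoothPart ℓ) (a : T.Internal)

/-- A real-valued branch of the dihedral angle near `p`. -/
def branch (q : SmoothPart ℓ) : ℝ :=
  (T.angle a q.1 - T.angle a p.1).toReal + (T.angle a p.1).toReal

theorem coe_branch (q : SmoothPart ℓ) : (T.branch p a q : Real.Angle) = T.angle a q.1 := by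
  rw [branch, Real.Angle.coe_add, Real.Angle.coe_toReal, Real.Angle.coe_toReal, sub_add_cancel]

theorem length_smoothClass (y : Fin n → Vec) (hy : y ∈ closedPolygons ℓ) (hc : NonCollinear y) :
    T.length a (smoothClass ⟨y, hy⟩ hc).1 = ‖edgeL a.1.1 a.1.2 y‖ := by
  rw [edgeL_apply]; rfl

theorem angle_smoothClass (y : Fin n → Vec) (hy : y ∈ closedPolygons ℓ) (hc : NonCollinear y) :
    T.angle a (smoothClass ⟨y, hy⟩ hc).1 = dihedral (edgeL a.1.1 a.1.2 y)
      (edgeL a.1.1 (T.outerApex a) y) (edgeL a.1.1 (T.innerApex a) y) := by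
  rw [edgeL_apply, edgeL_apply, edgeL_apply]; rfl

theorem card_internal : Fintype.card T.Internal + 3 = n := by
  rw [Fintype.card_coe, T.card_diagonals]

section Manifold

variable [hn : Fact (3 ≤ n)] [hpos : Fact (∀ j, 0 < ℓ j)]

/-- The dihedral angle relative to the base polygon. -/
def relativeAngleAt : (Fin n → Vec) → ℝ :=
  relativeAngle (edgeL a.1.1 a.1.2) (edgeL a.1.1 (T.outerApex a)) (edgeL a.1.1 (T.innerApex a))
    (basePolygon p)

variable {T p}

theorem eventually_branch_eq (hf : T.NondegenerateFaces (basePolygon p)) :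
    ∀ᶠ y in 𝓝 (basePolygon p), ∀ (hy : y ∈ closedPolygons ℓ) (hc : NonCollinear y),
      T.branch p a (smoothClass ⟨y, hy⟩ hc) =
        T.relativeAngleAt p a y + (T.angle a p.1).toReal := by
  obtain ⟨h1, h2⟩ := hf.cross_apex_ne_zero hn.1 a
  filter_upwards [eventually_toReal_dihedral_sub h1 h2] with y hy hyc hc
  have hp : T.angle a p.1 = dihedral (edgeL a.1.1 a.1.2 (basePolygon p))
      (edgeL a.1.1 (T.outerApex a) (basePolygon p))
      (edgeL a.1.1 (T.innerApex a) (basePolygon p)) := by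
    rw [← T.angle_smoothClass a _ (basePolygon_mem p) (nonCollinear_basePolygon p),
      smoothClass_basePolygon]
  rw [branch, angle_smoothClass, relativeAngleAt, ← hy, hp]

theorem hasFDerivAt_branch (hf : T.NondegenerateFaces (basePolygon p)) :
    ∃ L : (Fin n → Vec) →L[ℝ] ℝ,
      HasFDerivAt (fun y => T.relativeAngleAt p a y + (T.angle a p.1).toReal) L (basePolygon p) ∧
      ∀ u, L u = ‖edgeL a.1.1 a.1.2 (basePolygon p)‖ * T.angleRate (basePolygon p) u a := by
  obtain ⟨h1, h2⟩ := hf.cross_apex_ne_zero hn.1 a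
  obtain ⟨L, hL, hL'⟩ := hasFDerivAt_relativeAngle h1 h2
  exact ⟨L, hL.add_const _, hL'⟩

theorem hasFDerivAt_half_length (hf : T.NondegenerateFaces (basePolygon p)) :
    ∃ L : (Fin n → Vec) →L[ℝ] ℝ,
      HasFDerivAt (fun y => ‖edgeL a.1.1 a.1.2 y‖ / 2) L (basePolygon p) ∧
      ∀ u, L u = T.lengthRate (basePolygon p) u a /
        (2 * ‖edgeL a.1.1 a.1.2 (basePolygon p)‖) := by
  obtain ⟨h1, -⟩ := hf.cross_apex_ne_zero hn.1 a
  obtain ⟨L, hL, hL'⟩ := hasFDerivAt_norm _ (cross_ne_zero_left h1)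
  refine ⟨_, hL.mul_const (2⁻¹ : ℝ), fun u => ?_⟩
  rw [smul_apply, hL', lengthRate, smul_eq_mul]
  ring

/-- The symplectic form in action-angle coordinates. -/
theorem symplecticForm_eq_sum (hf : T.NondegenerateFaces (basePolygon p)) (u v : Model n) :
    symplecticForm p ![u, v] = ∑ a,
      (mvfderiv 𝓘(ℝ, Model n) (fun q : SmoothPart ℓ => T.length a q.1 / 2) p u *
          mvfderiv 𝓘(ℝ, Model n) (T.branch p a) p v -
        mvfderiv 𝓘(ℝ, Model n) (fun q : SmoothPart ℓ => T.length a q.1 / 2) p v *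
          mvfderiv 𝓘(ℝ, Model n) (T.branch p a) p u) := by
  refine (symplecticForm_apply p u v).trans ?_
  rw [T.orbitForm_eq_sum_diagonals hn.1 (basePolygon_mem p) hf (isTangent_tangentLift p u)
    (isTangent_tangentLift p v)]
  refine Finset.sum_congr rfl fun a _ => ?_
  obtain ⟨h1, -⟩ := hf.cross_apex_ne_zero hn.1 a
  have h0 := norm_ne_zero_iff.2 (cross_ne_zero_left h1)
  obtain ⟨L, hL, hL'⟩ := hasFDerivAt_half_length a hf
  obtain ⟨A, hA, hA'⟩ := hasFDerivAt_branch a hf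
  have e1 : ∀ w : Model n,
      mvfderiv 𝓘(ℝ, Model n) (fun q : SmoothPart ℓ => T.length a q.1 / 2) p w =
        L (tangentLift p w) := mvfderiv_of_lift (Filter.Eventually.of_forall fun y hy hc => by
      rw [length_smoothClass]) hL
  have e2 : ∀ w : Model n, mvfderiv 𝓘(ℝ, Model n) (T.branch p a) p w = A (tangentLift p w) :=
    mvfderiv_of_lift (eventually_branch_eq a hf) hA
  refine Eq.trans ?_ (congrArg₂ (· - ·) (congrArg₂ (· * ·) (e1 u) (e2 v))
    (congrArg₂ (· * ·) (e1 v) (e2 u))).symm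
  simp only [hL', hA']
  field_simp

/-- A tangent vector with zero length and angle rates pairs to zero with everything in
`orbitForm_eq_sum_diagonals`, so it vanishes by nondegeneracy. The dimensions agree since there are
n - 3 diagonals. -/
theorem isLocalDiffeomorphAt_actionAngle (hf : T.NondegenerateFaces (basePolygon p)) :
    IsLocalDiffeomorphAt 𝓘(ℝ, Model n) 𝓘(ℝ, (T.Internal → ℝ) × (T.Internal → ℝ)) ∞
      (fun q : SmoothPart ℓ => (fun a => T.length a q.1 / 2, fun a => T.branch p a q)) p := by
  let F : (Fin n → Vec) → (T.Internal → ℝ) × (T.Internal → ℝ) := fun y =>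
    (fun a => ‖edgeL a.1.1 a.1.2 y‖ / 2,
      fun a => T.relativeAngleAt p a y + (T.angle a p.1).toReal)
  refine isLocalDiffeomorphAt_of_lift (F := F) ?_ ?_ (fun u hu => ?_) ?_
  · filter_upwards [Filter.eventually_all.2 fun a => eventually_branch_eq a hf] with y h hy hc
    simp only [F, length_smoothClass, h _ hy hc]
  · have h1 : ∀ᶠ y in 𝓝 (basePolygon p), ∀ a : T.Internal,
        edgeL a.1.1 a.1.2 y ≠ 0 ∧ ContDiffAt ℝ ∞ (T.relativeAngleAt p a) y := by
      refine Filter.eventually_all.2 fun a => ?_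
      obtain ⟨h1, h2⟩ := hf.cross_apex_ne_zero hn.1 a
      exact ((edgeL a.1.1 a.1.2).continuous.continuousAt.eventually_ne
        (cross_ne_zero_left h1)).and (eventually_contDiffAt_relativeAngle h1 h2)
    filter_upwards [h1] with y hy
    refine ContDiffAt.prodMk (contDiffAt_pi.2 fun a => ?_) (contDiffAt_pi.2 fun a => ?_)
    · exact (contDiffAt_norm_comp _ (hy a).1).div_const 2
    · exact (hy a).2.add contDiffAt_const
  · choose L hL hL' using fun a => hasFDerivAt_half_length a hf
    choose A hA hA' using fun a => hasFDerivAt_branch a hf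
    have hF : HasFDerivAt F ((ContinuousLinearMap.pi L).prod (ContinuousLinearMap.pi A))
        (basePolygon p) := (hasFDerivAt_pi.2 hL).prodMk (hasFDerivAt_pi.2 hA)
    rw [hF.fderiv] at hu
    have hu1 : ∀ a, L a (tangentLift p u) = 0 := fun a => congrFun (congrArg Prod.fst hu) a
    have hu2 : ∀ a, A a (tangentLift p u) = 0 := fun a => congrFun (congrArg Prod.snd hu) a
    have hz : ∀ a, T.lengthRate (basePolygon p) (tangentLift p u) a = 0 ∧
        T.angleRate (basePolygon p) (tangentLift p u) a = 0 := by
      intro a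
      obtain ⟨h1, -⟩ := hf.cross_apex_ne_zero hn.1 a
      have h0 := norm_ne_zero_iff.2 (cross_ne_zero_left h1)
      have h3 := hu1 a
      have h4 := hu2 a
      rw [hL'] at h3
      rw [hA'] at h4
      exact ⟨(div_eq_zero_iff.1 h3).resolve_right (mul_ne_zero two_ne_zero h0),
        (mul_eq_zero.1 h4).resolve_left h0⟩
    refine isSymplecticForm_symplecticForm.nondegenerate p u fun v => ?_
    refine (symplecticForm_apply p u v).trans ?_
    rw [T.orbitForm_eq_sum_diagonals hn.1 (basePolygon_mem p) hf (isTangent_tangentLift p u)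
      (isTangent_tangentLift p v)]
    refine Finset.sum_eq_zero fun a _ => ?_
    rw [(hz a).1, (hz a).2]
    ring
  · rw [finrank_euclideanSpace_fin, Module.finrank_prod, Module.finrank_fintype_fun_eq_card]
    have := T.card_internal
    omega

/-- The faces of a regular polygon are nondegenerate. -/
theorem nondegenerateFaces_basePolygon (hp : p ∈ T.regularSet ℓ) :
    T.NondegenerateFaces (basePolygon p) := by
  by_cases h4 : 4 ≤ n
  · refine nondegenerateFaces_of_regular (x := ⟨basePolygon p, basePolygon_mem p⟩) h4 ?_
    rw [show polygonClass ⟨basePolygon p, basePolygon_mem p⟩ = p.1 from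
      congrArg Subtype.val (smoothClass_basePolygon p)]
    exact hp
  -- For n = 3 there are no diagonals and regularity says nothing. The single face is the triangle
  -- itself, nondegenerate because the polygon is not collinear.
  · intro i k j hf hc
    have hx := basePolygon_mem p
    have hik : (i : ℕ) < k := hf.1
    have hkj : (k : ℕ) < j := hf.2.1
    have h3 := hn.1
    have hk : (k : ℕ) = i + 1 := by omega
    have hj : (j : ℕ) = k + 1 := by omega
    have h0 : basePolygon p i ≠ 0 := norm_pos_iff.1 (by rw [hx.1]; exact hpos.1 i)
    have hsum := edgeL_add i k j (basePolygon p)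
    rw [edgeL_side hk, edgeL_side hj, edgeL_root (by omega) (by omega) hx.2] at hsum
    rw [edgeL_side hk, edgeL_side hj] at hc
    obtain ⟨c, hc⟩ : ∃ c : ℝ, basePolygon p k = c • basePolygon p i :=
      ⟨_, exists_smul_of_cross_eq_zero h0 hc⟩
    refine nonCollinear_basePolygon p ⟨basePolygon p i, fun m => ?_⟩
    have hm : m = i ∨ m = k ∨ m = j := by
      simp only [Fin.ext_iff]
      omega
    rcases hm with rfl | rfl | rfl
    · exact ⟨1, (one_smul ℝ _).symm⟩
    · exact ⟨c, hc⟩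
    · refine ⟨-(1 + c), ?_⟩
      rw [← neg_neg (basePolygon p m), ← hsum, hc, neg_smul, add_smul, one_smul]

end Manifold

end Triangulation

end

end PolygonSpaces

end

/-! ### The main theorem -/

theorem mainTheorem11 (n : ℕ) (hn : 3 ≤ n) (ℓ : Fin n → ℝ) (hpos : ∀ j, 0 < ℓ j)
    (hℓ : ∀ j, ℓ j < (∑ i, ℓ i) / 2) :
    ∃ (_ : ChartedSpace (EuclideanSpace ℝ (Fin (2 * (n - 3)))) (PolygonSpaces.SmoothPart ℓ))
      (_ : IsManifold 𝓘(ℝ, EuclideanSpace ℝ (Fin (2 * (n - 3)))) ∞ (PolygonSpaces.SmoothPart ℓ))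
      (σ : PolygonSpaces.TwoForm (2 * (n - 3)) (PolygonSpaces.SmoothPart ℓ)),
      -- the symplectic structure of the polygon space
      PolygonSpaces.IsSymplecticForm σ ∧ PolygonSpaces.IsSymplecticQuotient ℓ σ ∧
      -- the coplanar polygons
      IsClosed (PolygonSpaces.planarSet ℓ) ∧
      PolygonSpaces.IsLagrangianSubmanifold σ (PolygonSpaces.planarSet ℓ) ∧
      -- action-angle coordinates, where `ϑ` is a local real-valued branch of the angles
      ∀ T : PolygonSpaces.Triangulation n, ∀ p ∈ T.regularSet ℓ,
        ∃ ϑ : T.Internal → PolygonSpaces.SmoothPart ℓ → ℝ,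
          (∀ a, ∀ᶠ q in 𝓝 p, (ϑ a q : Real.Angle) = T.angle a q.1) ∧
          IsLocalDiffeomorphAt 𝓘(ℝ, EuclideanSpace ℝ (Fin (2 * (n - 3))))
            𝓘(ℝ, (T.Internal → ℝ) × (T.Internal → ℝ)) ∞
            (fun q => (fun a => T.length a q.1 / 2, fun a => ϑ a q)) p ∧
          ∀ u v : TangentSpace 𝓘(ℝ, EuclideanSpace ℝ (Fin (2 * (n - 3)))) p,
            σ p ![u, v] = ∑ a,
              (mvfderiv 𝓘(ℝ, EuclideanSpace ℝ (Fin (2 * (n - 3))))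
                  (fun q : PolygonSpaces.SmoothPart ℓ => T.length a q.1 / 2) p u *
                mvfderiv 𝓘(ℝ, EuclideanSpace ℝ (Fin (2 * (n - 3)))) (ϑ a) p v -
               mvfderiv 𝓘(ℝ, EuclideanSpace ℝ (Fin (2 * (n - 3))))
                  (fun q : PolygonSpaces.SmoothPart ℓ => T.length a q.1 / 2) p v *
                mvfderiv 𝓘(ℝ, EuclideanSpace ℝ (Fin (2 * (n - 3)))) (ϑ a) p u) := by
  have := Fact.mk hn
  have := Fact.mk hpos
  refine ⟨PolygonSpaces.instChartedSpaceSmoothPart, PolygonSpaces.instIsManifoldSmoothPart,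
    PolygonSpaces.symplecticForm, PolygonSpaces.isSymplecticForm_symplecticForm,
    PolygonSpaces.isSymplecticQuotient_symplecticForm, PolygonSpaces.isClosed_planarSet hpos,
    PolygonSpaces.isLagrangianSubmanifold_planarSet, fun T p hp => ?_⟩
  have hf := PolygonSpaces.Triangulation.nondegenerateFaces_basePolygon hp
  exact ⟨T.branch p, fun a => Filter.Eventually.of_forall (T.coe_branch p a),
    PolygonSpaces.Triangulation.isLocalDiffeomorphAt_actionAngle hf,
    PolygonSpaces.Triangulation.symplecticForm_eq_sum hf⟩
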